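/- Let $G$ be a finite group. All spectra are orthogonal $G$-spectra: continuous equivariant functors from the category whose objects are the finite-dimensional orthogonal $G$-representations $V$, and whose morphism spaces are the Thom spaces of the bundles of pairs $(\varphi,w)$ with $\varphi\colon V\to W$ a linear isometric embedding and $w\perp\operatorname{im}\varphi$ (with $G$ acting by conjugation), to pointed compactly generated $G$-spaces. Fix a universal $G$-representation $\mathcal U$, i.e. one into which every finite-dimensional orthogonal $G$-representation embeds. Put $\pi_k^H(E)=\operatorname{colim}_V [S^{V\oplus\mathbf R^k},E(V)]^H_*$ for $k\ge 0$ and $\pi_{k}^H(E)=\operatorname{colim}_V [S^{V},E(V\oplus\mathbf R^{-k})]^H_*$ for $k<0$, where $V$ runs over the finite-dimensional subrepresentations of $\mathcal U$; a morphism is a $\pi_*$-isomorphism if it induces bijections on $\pi_k^H$ for all $k\in\mathbf Z$ and all subgroups $H\le G$. A pair of morphisms $E\xrightarrow{f}F\xrightarrow{g}K$ is a cofiber sequence if $g$ extends to a morphism $C(f)\to K$ from the levelwise reduced mapping cone of $f$ which is a $\pi_*$-isomorphism. For $d\ge 0$ let $MTO_d(V)$ be the Thom space of the orthogonal complement $\xi^\perp=\{(L,v):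 v\perp L\}$ of the tautological bundle over the Grassmannian $\mathrm{Gr}_d(V)$ of $d$-planes in $V$, let $(\Sigma^\infty_+B_GO(d))(V)=S^V\wedge \mathrm{Gr}_d(V)_+$ and $(\Sigma^{\infty+1}_+B_GO(d))(V)=S^{V\oplus\mathbf R}\wedge \mathrm{Gr}_d(V)_+$; a morphism $(\varphi,w)$ acts on these by $(L,v)\mapsto(\varphi(L),\varphi(v)+w)$, by $(v,L)\mapsto(\varphi(v)+w,\varphi(L))$ and by $((v,t),L)\mapsto((\varphi(v)+w,t),\varphi(L))$ respectively. Let $(\mathrm{sh}_1E)(V)=E(V\oplus\mathbf R)$. Then for every $d\ge 1$ there is a cofiber sequence of orthogonal $G$-spectra $$MTO_{d-1}\longrightarrow \mathrm{sh}_1MTO_d\longrightarrow \Sigma^{\infty+1}_+B_GO(d),$$ where the third term is understood up to $\pi_*$-isomorphism. Precisely: the morphisms $\iota\colon MTO_{d-1}\to \mathrm{sh}_1MTO_d$, $(L,v)\mapsto(L\oplus\mathbf R,(v,0))$, and $q\colon \mathrm{sh}_1MTO_d\to \mathrm{sh}_1\Sigma^\infty_+B_GO(d)$, $(L,w)\mapsto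 (w,L)$, form a cofiber sequence, and the canonical morphism $\Sigma^{\infty+1}_+B_GO(d)\to \mathrm{sh}_1\Sigma^\infty_+B_GO(d)$, $((v,t),L)\mapsto((v,t),L\oplus 0)$, is a $\pi_*$-isomorphism. -/

import Mathlib

set_option linter.unusedSectionVars false

namespace GSpec

open Topology Set Filter OnePoint unitInterval

noncomputable section

/-! ### One-point compactifications -/

section SmashMap

variable {A B C : Type*}

/-- The pairing of one-point compactifications induced by `m : A → B → C`; it sends
`(∞, y)` and `(x, ∞)` to `∞`. -/
def smashMap (m : A → B → C) (x : OnePoint A) (y : OnePoint B) : OnePoint C :=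
  x.elim ∞ fun a => y.elim ∞ fun b => (m a b : OnePoint C)

@[simp] theorem smashMap_infty_left (m : A → B → C) (y : OnePoint B) :
    smashMap m ∞ y = ∞ := rfl

@[simp] theorem smashMap_infty_right (m : A → B → C) (x : OnePoint A) :
    smashMap m x ∞ = ∞ := by
  induction x using OnePoint.rec <;> rfl

@[simp] theorem smashMap_coe (m : A → B → C) (a : A) (b : B) :
    smashMap m (a : OnePoint A) (b : OnePoint B) = (m a b : OnePoint C) := rfl

end SmashMap

section OnePt

variable {A B C Z : Type*} [TopologicalSpace A] [TopologicalSpace B] [TopologicalSpace C]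
  [TopologicalSpace Z]

theorem continuous_smashMap {m : A → B → C} (hm : Continuous fun p : A × B => m p.1 p.2)
    (hp : ∀ K : Set C, IsClosed K → IsCompact K → ∃ (KA : Set A) (KB : Set B),
      (IsClosed KA ∧ IsCompact KA) ∧ (IsClosed KB ∧ IsCompact KB) ∧
        ∀ a b, m a b ∈ K → a ∈ KA ∧ b ∈ KB) :
    Continuous fun p : OnePoint A × OnePoint B => smashMap m p.1 p.2 := by
  have key : ∀ p : OnePoint A × OnePoint B, p.1 = ∞ ∨ p.2 = ∞ →
      ContinuousAt (fun p : OnePoint A × OnePoint B => smashMap m p.1 p.2) p := by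
    rintro ⟨x, y⟩ hxy
    have h0 : smashMap m x y = ∞ := by
      rcases hxy with h | h
      · simp only at h; subst h; rfl
      · simp only at h; subst h; simp
    unfold ContinuousAt
    simp only [h0]
    rw [hasBasis_nhds_infty.tendsto_right_iff]
    rintro K ⟨hKc, hK⟩
    obtain ⟨KA, KB, ⟨hA1, hA2⟩, ⟨hB1, hB2⟩, hAB⟩ := hp K hKc hK
    have hmem : ∀ q : OnePoint A × OnePoint B,
        (q.1 ∈ ((↑) '' KAᶜ ∪ {∞} : Set (OnePoint A)) ∨
          q.2 ∈ ((↑) '' KBᶜ ∪ {∞} : Set (OnePoint B))) →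
        smashMap m q.1 q.2 ∈ ((↑) '' Kᶜ ∪ {∞} : Set (OnePoint C)) := by
      rintro ⟨u, v⟩ h
      induction u using OnePoint.rec with
      | infty => right; rfl
      | coe a =>
        induction v using OnePoint.rec with
        | infty => right; rfl
        | coe b =>
          left
          refine ⟨m a b, fun hk => ?_, rfl⟩
          obtain ⟨h1, h2⟩ := hAB a b hk
          simp only [mem_union, mem_image, mem_compl_iff, mem_singleton_iff, coe_eq_coe,
            exists_eq_right, coe_ne_infty, or_false] at h
          tauto
    rcases hxy with h | h
    · have : ((↑) '' KAᶜ ∪ {∞} : Set (OnePoint A)) ∈ 𝓝 x := by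
        simp only at h; subst h
        exact hasBasis_nhds_infty.mem_of_mem ⟨hA1, hA2⟩
      filter_upwards [(continuous_fst.tendsto (x, y)) this] with q hq using hmem q (Or.inl hq)
    · have : ((↑) '' KBᶜ ∪ {∞} : Set (OnePoint B)) ∈ 𝓝 y := by
        simp only at h; subst h
        exact hasBasis_nhds_infty.mem_of_mem ⟨hB1, hB2⟩
      filter_upwards [(continuous_snd.tendsto (x, y)) this] with q hq using hmem q (Or.inr hq)
  rw [continuous_iff_continuousAt]
  rintro ⟨x, y⟩
  induction x using OnePoint.rec with
  | infty => exact key _ (Or.inl rfl)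
  | coe a =>
    induction y using OnePoint.rec with
    | infty => exact key _ (Or.inr rfl)
    | coe b =>
      have hemb := (isOpenEmbedding_coe (X := A)).prodMap (isOpenEmbedding_coe (X := B))
      have h := hemb.continuousAt_iff (x := (a, b))
        (g := fun p : OnePoint A × OnePoint B => smashMap m p.1 p.2)
      exact h.1 ((continuous_coe.comp hm).continuousAt)

/-- Extension by the base point of a map that factors properly through a product. -/
theorem continuous_elim_of_smash {Φ : OnePoint A × OnePoint B → Z} (hΦ : Continuous Φ) {z : Z}
    (h1 : ∀ y, Φ (∞, y) = z) (h2 : ∀ x, Φ (x, ∞) = z) {r : C → A × B} (hr : Continuous r)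
    (hp : ∀ (KA : Set A) (KB : Set B), IsCompact KA → IsCompact KB →
      ∃ KC : Set C, IsClosed KC ∧ IsCompact KC ∧ ∀ c, (r c).1 ∈ KA → (r c).2 ∈ KB → c ∈ KC) :
    Continuous fun c : OnePoint C =>
      c.elim z fun c => Φ (((r c).1 : OnePoint A), ((r c).2 : OnePoint B)) := by
  have hc : Continuous fun c : C => Φ (((r c).1 : OnePoint A), ((r c).2 : OnePoint B)) := by
    exact hΦ.comp ((continuous_coe.comp (continuous_fst.comp hr)).prodMk
      (continuous_coe.comp (continuous_snd.comp hr)))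
  rw [continuous_iff_continuousAt]
  intro c
  induction c using OnePoint.rec with
  | coe c => rw [continuousAt_coe]; exact hc.continuousAt
  | infty =>
    rw [continuousAt_infty]
    intro s hs
    simp only [elim_infty] at hs
    obtain ⟨N, hNs, hN, hzN⟩ := mem_nhds_iff.1 hs
    set S : Set (OnePoint A × OnePoint B) := (Φ ⁻¹' N)ᶜ with hS
    have hSc : IsClosed S := (hN.preimage hΦ).isClosed_compl
    have hA : IsClosed (Prod.fst '' S) := isClosedMap_fst_of_compactSpace _ hSc
    have hB : IsClosed (Prod.snd '' S) := isClosedMap_snd_of_compactSpace _ hSc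
    have hA' : ∞ ∉ Prod.fst '' S := by
      rintro ⟨⟨x, y⟩, h, rfl : x = ∞⟩
      exact h (by simpa [h1] using hzN)
    have hB' : ∞ ∉ Prod.snd '' S := by
      rintro ⟨⟨x, y⟩, h, rfl : y = ∞⟩
      exact h (by simpa [h2] using hzN)
    obtain ⟨KC, hKc, hK, hKC⟩ := hp _ _ ((isClosed_iff_of_notMem hA').1 hA).2
      ((isClosed_iff_of_notMem hB').1 hB).2
    refine ⟨KC, hKc, hK, fun c hcK => hNs ?_⟩
    by_contra hcon
    refine hcK (hKC c ?_ ?_)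
    · exact ⟨_, hcon, rfl⟩
    · exact ⟨_, hcon, rfl⟩

/-- The product of a compactly generated space and the unit interval is compactly generated. -/
instance compactlyGeneratedSpace_prod_unitInterval {X : Type} [TopologicalSpace X]
    [CompactlyGeneratedSpace X] : CompactlyGeneratedSpace (X × I) := by
  refine compactlyGeneratedSpace_of_continuous_maps fun {Y} _ f hf => ?_
  have h : ∀ x : X, Continuous fun t : I => f (x, t) := fun x =>
    hf I (fun t => (x, t)) (by fun_prop)
  let F : X → C(I, Y) := fun x => ⟨_, h x⟩
  have hF : Continuous F := by
    refine continuous_from_compactlyGeneratedSpace F fun K _ _ _ g hg => ?_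
    exact ContinuousMap.continuous_of_continuous_uncurry _
      (hf (K × I) (fun p => (g p.1, p.2)) (by fun_prop))
  exact ContinuousMap.continuous_uncurry_of_continuous ⟨F, hF⟩

end OnePt

/-! ### Orthogonal representations -/

/-- Finite dimensional orthogonal representations of `G`. -/
structure OrthRep (G : Type*) [Group G] where
  carrier : Type
  [normed : NormedAddCommGroup carrier]
  [innerProd : InnerProductSpace ℝ carrier]
  [finDim : FiniteDimensional ℝ carrier]
  ρ : G →* (carrier ≃ₗᵢ[ℝ] carrier)

instance {G : Type*} [Group G] : CoeSort (OrthRep G) Type := ⟨OrthRep.carrier⟩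

attribute [instance] OrthRep.normed OrthRep.innerProd OrthRep.finDim

/-- `ℝⁿ` with its Euclidean norm. -/
abbrev Eucl (n : ℕ) : Type := EuclideanSpace ℝ (Fin n)

/-- The orthogonal direct sum `V ⊕ ℝⁿ`. -/
abbrev AddE (V : Type) [NormedAddCommGroup V] [InnerProductSpace ℝ V] (n : ℕ) : Type :=
  WithLp 2 (V × Eucl n)

theorem AddE.ext {V : Type} [NormedAddCommGroup V] [InnerProductSpace ℝ V] {n : ℕ}
    {x y : AddE V n} (h1 : x.fst = y.fst) (h2 : x.snd = y.snd) : x = y :=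
  WithLp.ofLp_injective 2 (Prod.ext h1 h2)

section JDef

variable {V W X : Type} [NormedAddCommGroup V] [InnerProductSpace ℝ V]
  [NormedAddCommGroup W] [InnerProductSpace ℝ W] [NormedAddCommGroup X] [InnerProductSpace ℝ X]

/-- The linear isometric embedding `φ ⊕ id : V ⊕ ℝⁿ → W ⊕ ℝⁿ`. -/
def addIsom (φ : V →ₗᵢ[ℝ] W) (n : ℕ) : AddE V n →ₗᵢ[ℝ] AddE W n where
  toFun x := WithLp.toLp 2 (φ x.fst, x.snd)
  map_add' x y := by apply AddE.ext <;> simp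
  map_smul' c x := by apply AddE.ext <;> simp
  norm_map' x := by
    change ‖(WithLp.toLp 2 (φ x.fst, x.snd) : AddE W n)‖ = ‖x‖
    rw [← sq_eq_sq₀ (norm_nonneg _) (norm_nonneg _), WithLp.prod_norm_sq_eq_of_L2,
      WithLp.prod_norm_sq_eq_of_L2]
    simp

@[simp] theorem addIsom_apply (φ : V →ₗᵢ[ℝ] W) (n : ℕ) (x : AddE V n) :
    addIsom φ n x = WithLp.toLp 2 (φ x.fst, x.snd) := rfl

/-- The inclusion `V → V ⊕ ℝⁿ`. -/
def inclE (V : Type) [NormedAddCommGroup V] [InnerProductSpace ℝ V] (n : ℕ) :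
    V →ₗᵢ[ℝ] AddE V n where
  toFun x := WithLp.toLp 2 (x, 0)
  map_add' x y := by apply AddE.ext <;> simp
  map_smul' c x := by apply AddE.ext <;> simp
  norm_map' x := by
    change ‖(WithLp.toLp 2 (x, 0) : AddE V n)‖ = ‖x‖
    rw [← sq_eq_sq₀ (norm_nonneg _) (norm_nonneg _), WithLp.prod_norm_sq_eq_of_L2]
    simp

@[simp] theorem inclE_apply (n : ℕ) (x : V) : inclE V n x = WithLp.toLp 2 (x, 0) := rfl

variable (V W) in
/-- The total space of the bundle of pairs `(φ, w)` with `φ : V → W` a linear isometric embedding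
and `w` orthogonal to the image of `φ`. Its Thom space, which is the one-point compactification
`OnePoint (JPt V W)` because the space of linear isometric embeddings is compact, is the morphism
space of the indexing category of orthogonal spectra. -/
@[ext] structure JPt where
  emb : V →ₗᵢ[ℝ] W
  vec : W
  orth : ∀ x, inner ℝ (emb x) vec = 0

namespace JPt

/-- The pair of the underlying continuous linear map and the vector. -/
def pair (j : JPt V W) : (V →L[ℝ] W) × W := (j.emb.toContinuousLinearMap, j.vec)

theorem pair_injective : Function.Injective (pair : JPt V W → _) := by
  intro a b h
  simp only [pair, Prod.mk.injEq] at h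
  ext x
  · exact congrArg (fun f : V →L[ℝ] W => f x) h.1
  · exact h.2

/-- The subspace topology from `Hom(V, W) × W`. -/
instance : TopologicalSpace (JPt V W) := TopologicalSpace.induced pair inferInstance

theorem isEmbedding_pair : IsEmbedding (pair : JPt V W → _) := ⟨⟨rfl⟩, pair_injective⟩

theorem continuous_pair : Continuous (pair : JPt V W → _) := isEmbedding_pair.continuous

theorem continuous_emb : Continuous fun j : JPt V W => j.emb.toContinuousLinearMap :=
  continuous_fst.comp continuous_pair

theorem continuous_vec : Continuous fun j : JPt V W => j.vec :=
  continuous_snd.comp continuous_pair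

theorem continuous_iff' {T : Type*} [TopologicalSpace T] {f : T → JPt V W} :
    Continuous f ↔ Continuous (fun t => (f t).emb.toContinuousLinearMap) ∧
      Continuous fun t => (f t).vec := by
  rw [isEmbedding_pair.continuous_iff]
  exact continuous_prodMk

instance : T2Space (JPt V W) := T2Space.of_injective_continuous pair_injective continuous_pair

theorem norm_emb_le (φ : V →ₗᵢ[ℝ] W) : ‖φ.toContinuousLinearMap‖ ≤ 1 :=
  ContinuousLinearMap.opNorm_le_bound _ zero_le_one fun x => by simp

theorem isClosed_range_pair : IsClosed (range (pair : JPt V W → _)) := by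
  have : range (pair : JPt V W → _) =
      {p : (V →L[ℝ] W) × W | (∀ x, ‖p.1 x‖ = ‖x‖) ∧ ∀ x, inner ℝ (p.1 x) p.2 = 0} := by
    ext p
    constructor
    · rintro ⟨j, rfl⟩
      exact ⟨fun x => j.emb.norm_map x, j.orth⟩
    · rintro ⟨h1, h2⟩
      exact ⟨⟨⟨p.1.toLinearMap, h1⟩, p.2, h2⟩, rfl⟩
  rw [this, ofPred_and, ofPred_forall, ofPred_forall]
  refine (isClosed_iInter fun x => ?_).inter (isClosed_iInter fun x => ?_)
  · exact isClosed_eq (by fun_prop) continuous_const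
  · exact isClosed_eq (by fun_prop) continuous_const

theorem isCompact_norm_le [FiniteDimensional ℝ V] [FiniteDimensional ℝ W] (r : ℝ) :
    IsCompact {j : JPt V W | ‖j.vec‖ ≤ r} := by
  have hemb : IsClosedEmbedding (pair : JPt V W → _) := ⟨isEmbedding_pair, isClosed_range_pair⟩
  have : ProperSpace ((V →L[ℝ] W) × W) := FiniteDimensional.proper ℝ _
  have := hemb.isCompact_preimage
    (isCompact_closedBall (0 : (V →L[ℝ] W) × W) (max 1 r))
  refine this.of_isClosed_subset (isClosed_le continuous_vec.norm continuous_const) ?_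
  intro j hj
  simp only [mem_preimage, Metric.mem_closedBall, dist_zero_right, Prod.norm_def, pair]
  exact max_le_max (norm_emb_le _) hj

instance [FiniteDimensional ℝ V] [FiniteDimensional ℝ W] :
    WeaklyLocallyCompactSpace (JPt V W) where
  exists_compact_mem_nhds j := ⟨_, isCompact_norm_le (‖j.vec‖ + 1), by
    have h : IsOpen {k : JPt V W | ‖k.vec‖ < ‖j.vec‖ + 1} :=
      isOpen_lt (continuous_norm.comp continuous_vec) continuous_const
    have hj : ‖j.vec‖ < ‖j.vec‖ + 1 := lt_add_one _
    exact mem_of_superset (h.mem_nhds hj) fun k (hk : ‖k.vec‖ < ‖j.vec‖ + 1) =>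
      show ‖k.vec‖ ≤ ‖j.vec‖ + 1 from hk.le⟩

/-- The identity `(id, 0)`. -/
def id (V : Type) [NormedAddCommGroup V] [InnerProductSpace ℝ V] : JPt V V where
  emb := LinearIsometry.id
  vec := 0
  orth x := by simp

/-- The morphism `(φ, 0)`. -/
def ofIsom (φ : V →ₗᵢ[ℝ] W) : JPt V W where
  emb := φ
  vec := 0
  orth x := by simp

/-- Composition `(ψ, u) ∘ (φ, w) = (ψ ∘ φ, ψ w + u)`. -/
def comp (k : JPt W X) (j : JPt V W) : JPt V X where
  emb := k.emb.comp j.emb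
  vec := k.emb j.vec + k.vec
  orth x := by simp [inner_add_right, j.orth, k.orth]

/-- The morphism `(φ ⊕ id, (w, 0))`. -/
def add (j : JPt V W) (n : ℕ) : JPt (AddE V n) (AddE W n) where
  emb := addIsom j.emb n
  vec := WithLp.toLp 2 (j.vec, 0)
  orth x := by simp [WithLp.prod_inner_apply, j.orth]

@[simp] theorem id_emb_apply (x : V) : (id V).emb x = x := rfl
@[simp] theorem id_vec : (id V).vec = 0 := rfl
@[simp] theorem ofIsom_emb (φ : V →ₗᵢ[ℝ] W) : (ofIsom φ).emb = φ := rfl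
@[simp] theorem ofIsom_vec (φ : V →ₗᵢ[ℝ] W) : (ofIsom φ).vec = 0 := rfl
@[simp] theorem comp_emb_apply (k : JPt W X) (j : JPt V W) (x : V) :
    (k.comp j).emb x = k.emb (j.emb x) := rfl
@[simp] theorem comp_vec (k : JPt W X) (j : JPt V W) :
    (k.comp j).vec = k.emb j.vec + k.vec := rfl
@[simp] theorem add_emb (j : JPt V W) (n : ℕ) : (j.add n).emb = addIsom j.emb n := rfl
@[simp] theorem add_vec (j : JPt V W) (n : ℕ) :
    (j.add n).vec = WithLp.toLp 2 (j.vec, 0) := rfl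

theorem add_id (n : ℕ) : (id V).add n = id (AddE V n) := by
  apply JPt.ext
  · ext x; rfl
  · rfl

theorem add_ofIsom (φ : V →ₗᵢ[ℝ] W) (n : ℕ) : (ofIsom φ).add n = ofIsom (addIsom φ n) := rfl

theorem add_comp (k : JPt W X) (j : JPt V W) (n : ℕ) :
    (k.comp j).add n = (k.add n).comp (j.add n) := by
  apply JPt.ext
  · ext x; rfl
  · apply AddE.ext <;> simp

/-- The map `j ↦ j ⊕ ℝⁿ` extended to the one-point compactifications. -/
def addPlus (n : ℕ) : OnePoint (JPt V W) → OnePoint (JPt (AddE V n) (AddE W n)) :=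
  OnePoint.map fun j => j.add n

theorem continuous_of_apply [FiniteDimensional ℝ V] {T : Type*} [TopologicalSpace T]
    {f : T → JPt V W} (h1 : ∀ x, Continuous fun t => (f t).emb x)
    (h2 : Continuous fun t => (f t).vec) : Continuous f :=
  continuous_iff'.2 ⟨continuous_clm_apply.2 h1, h2⟩

theorem continuous_emb_apply {T : Type*} [TopologicalSpace T] {f : T → JPt V W} {x : T → V}
    (hf : Continuous f) (hx : Continuous x) : Continuous fun t => (f t).emb (x t) :=
  (continuous_emb.comp hf).clm_apply hx

theorem continuous_toLp {T : Type*} [TopologicalSpace T] {n : ℕ} {x : T → V} {y : T → Eucl n}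
    (hx : Continuous x) (hy : Continuous y) :
    Continuous fun t => (WithLp.toLp 2 (x t, y t) : AddE V n) :=
  (WithLp.prod_continuous_toLp 2 V (Eucl n)).comp (hx.prodMk hy)

theorem continuous_add [FiniteDimensional ℝ V] (n : ℕ) :
    Continuous fun j : JPt V W => j.add n :=
  continuous_of_apply
    (fun _ => continuous_toLp (continuous_emb_apply continuous_id continuous_const)
      continuous_const)
    (continuous_toLp continuous_vec continuous_const)

theorem norm_toLp_zero (n : ℕ) (x : V) : ‖(WithLp.toLp 2 (x, 0) : AddE V n)‖ = ‖x‖ :=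
  (inclE V n).norm_map x

theorem continuous_addPlus [FiniteDimensional ℝ V] [FiniteDimensional ℝ W] (n : ℕ) :
    Continuous (addPlus n : OnePoint (JPt V W) → _) := by
  refine OnePoint.continuous_map (continuous_add n) ?_
  rw [hasBasis_coclosedCompact.tendsto_right_iff]
  rintro K ⟨-, hK⟩
  obtain ⟨r, hr⟩ := (hK.image continuous_vec).isBounded.exists_norm_le
  have hc := isCompact_norm_le (V := V) (W := W) r
  refine mem_of_superset (hasBasis_coclosedCompact.mem_of_mem ⟨hc.isClosed, hc⟩) ?_
  intro j hj hjK
  refine hj ?_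
  have := hr _ (mem_image_of_mem _ hjK)
  rw [add_vec, norm_toLp_zero] at this
  exact this

end JPt
end JDef

/-! ### Constructions on representations -/

namespace OrthRep

variable {G : Type*} [Group G]

/-- The orthogonal direct sum of `V` with the trivial representation `ℝⁿ`. -/
def add (V : OrthRep G) (n : ℕ) : OrthRep G where
  carrier := AddE V n
  ρ :=
    { toFun := fun g =>
        { toLinearEquiv := LinearEquiv.ofLinearMap (addIsom (V.ρ g).toLinearIsometry n).toLinearMap
            (addIsom (V.ρ g⁻¹).toLinearIsometry n).toLinearMap
            (by
              ext x : 1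
              exact AddE.ext (by simp) (by simp))
            (by
              ext x : 1
              exact AddE.ext (by simp) (by simp))
          norm_map' := (addIsom (V.ρ g).toLinearIsometry n).norm_map }
      map_one' := by
        ext x
        apply AddE.ext <;> simp
      map_mul' := fun g h => by
        ext x
        apply AddE.ext <;> simp }

/-- The isometry by which `g` acts, as a linear isometric embedding. -/
def isom (V : OrthRep G) (g : G) : V →ₗᵢ[ℝ] V := (V.ρ g).toLinearIsometry

@[simp] theorem isom_apply (V : OrthRep G) (g : G) (x : V) : V.isom g x = V.ρ g x := rfl

theorem add_isom (V : OrthRep G) (n : ℕ) (g : G) :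
    (V.add n).isom g = addIsom (V.isom g) n := rfl

end OrthRep

/-- The conjugation action `g (φ, w) = (g φ g⁻¹, g w)` on the morphism spaces. -/
def JPt.conj {G : Type*} [Group G] {V W : OrthRep G} (g : G) (j : JPt V W) : JPt V W where
  emb := (W.isom g).comp (j.emb.comp (V.isom g⁻¹))
  vec := W.ρ g j.vec
  orth x := by simp [j.orth]

/-! ### Orthogonal `G`-spectra -/

/-- An orthogonal `G`-spectrum: a continuous equivariant functor from the category with objects
the finite dimensional orthogonal representations and morphism spaces the Thom spaces
`OnePoint (JPt V W)`, to pointed compactly generated `G`-spaces and all pointed maps. -/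
structure OrthSpectrum (G : Type*) [Group G] where
  X : OrthRep G → Type
  [top : ∀ V, TopologicalSpace (X V)]
  [compactlyGenerated : ∀ V, CompactlyGeneratedSpace (X V)]
  [mulAction : ∀ V, MulAction G (X V)]
  pt : ∀ V, X V
  continuous_smul : ∀ V (g : G), Continuous fun x : X V => g • x
  smul_pt : ∀ V (g : G), g • pt V = pt V
  act : ∀ {V W : OrthRep G}, OnePoint (JPt V W) → X V → X W
  continuous_act : ∀ V W : OrthRep G,
    Continuous fun p : OnePoint (JPt V W) × X V => act p.1 p.2
  act_infty : ∀ {V W : OrthRep G} (x : X V), act (∞ : OnePoint (JPt V W)) x = pt W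
  act_pt : ∀ {V W : OrthRep G} (j : OnePoint (JPt V W)), act j (pt V) = pt W
  act_id : ∀ {V : OrthRep G} (x : X V), act (JPt.id V : OnePoint (JPt V V)) x = x
  act_comp : ∀ {V W Z : OrthRep G} (k : JPt W Z) (j : JPt V W) (x : X V),
    act (k.comp j : OnePoint (JPt V Z)) x = act (k : OnePoint (JPt W Z)) (act j x)
  smul_act : ∀ {V W : OrthRep G} (g : G) (j : JPt V W) (x : X V),
    g • act (j : OnePoint (JPt V W)) x = act (j.conj g : OnePoint (JPt V W)) (g • x)

attribute [instance] OrthSpectrum.top OrthSpectrum.compactlyGenerated OrthSpectrum.mulAction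

namespace OrthSpectrum

variable {G : Type*} [Group G]

/-- Morphisms of orthogonal `G`-spectra: natural equivariant continuous pointed maps. -/
structure Hom (E F : OrthSpectrum G) where
  app : ∀ V, E.X V → F.X V
  continuous_app : ∀ V, Continuous (app V)
  app_pt : ∀ V, app V (E.pt V) = F.pt V
  app_smul : ∀ V (g : G) (x : E.X V), app V (g • x) = g • app V x
  app_act : ∀ {V W : OrthRep G} (j : JPt V W) (x : E.X V),
    app W (E.act (j : OnePoint (JPt V W)) x) = F.act (j : OnePoint (JPt V W)) (app V x)

theorem Hom.app_act' {E F : OrthSpectrum G} (f : Hom E F) {V W : OrthRep G}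
    (j : OnePoint (JPt V W)) (x : E.X V) : f.app W (E.act j x) = F.act j (f.app V x) := by
  induction j using OnePoint.rec with
  | infty => rw [act_infty, act_infty, f.app_pt]
  | coe j => exact f.app_act j x

/-- Composition of morphisms, `(g.comp f) x = g (f x)`. -/
def Hom.comp {E F K : OrthSpectrum G} (g : Hom F K) (f : Hom E F) : Hom E K where
  app V x := g.app V (f.app V x)
  continuous_app V := (g.continuous_app V).comp (f.continuous_app V)
  app_pt V := by rw [f.app_pt, g.app_pt]
  app_smul V a x := by rw [f.app_smul, g.app_smul]
  app_act j x := by rw [f.app_act, g.app_act]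

/-- The shift `sh_n E`, with `(sh_n E)(V) = E(V ⊕ ℝⁿ)`. -/
def shift (E : OrthSpectrum G) (n : ℕ) : OrthSpectrum G where
  X V := E.X (V.add n)
  pt V := E.pt (V.add n)
  continuous_smul V g := E.continuous_smul (V.add n) g
  smul_pt V g := E.smul_pt (V.add n) g
  act {V W} j x := E.act (V := V.add n) (W := W.add n) (JPt.addPlus n j) x
  continuous_act V W := (E.continuous_act (V.add n) (W.add n)).comp
    (((JPt.continuous_addPlus n).comp continuous_fst).prodMk continuous_snd)
  act_infty x := E.act_infty x
  act_pt j := E.act_pt _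
  act_id {V} x := by
    have h : JPt.addPlus n (JPt.id V : OnePoint (JPt V V)) =
        (JPt.id (AddE V n) : OnePoint (JPt (AddE V n) (AddE V n))) :=
      congrArg _ (JPt.add_id n)
    rw [h]; exact E.act_id (V := V.add n) x
  act_comp {V W Z} k j x := by
    have h : JPt.addPlus n (k.comp j : OnePoint (JPt V Z)) =
        ((k.add n).comp (j.add n) : JPt (AddE V n) (AddE Z n)) :=
      congrArg _ (JPt.add_comp k j n)
    rw [h]; exact E.act_comp (V := V.add n) (W := W.add n) (Z := Z.add n) _ _ x
  smul_act {V W} g j x := by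
    have h : JPt.addPlus n (j.conj g : OnePoint (JPt V W)) =
        OnePoint.some (JPt.conj (V := V.add n) (W := W.add n) g (j.add n)) := by
      refine congrArg OnePoint.some (JPt.ext ?_ ?_)
      · ext x
        exact AddE.ext rfl rfl
      · exact AddE.ext rfl rfl
    rw [h]; exact E.smul_act (V := V.add n) (W := W.add n) g _ x

/-- The shift of a morphism. -/
def Hom.shift {E F : OrthSpectrum G} (f : Hom E F) (n : ℕ) : Hom (E.shift n) (F.shift n) where
  app V := f.app (V.add n)
  continuous_app V := f.continuous_app (V.add n)
  app_pt V := f.app_pt (V.add n)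
  app_smul V := f.app_smul (V.add n)
  app_act {V W} j x := f.app_act (V := V.add n) (W := W.add n) (j.add n) x

end OrthSpectrum

/-! ### Mapping cones -/

namespace OrthSpectrum

variable {G : Type*} [Group G]

/-- The identifications on `E(V) × [0,1] ⊔ F(V)` which define the reduced mapping cone. -/
inductive ConeRel {E F : OrthSpectrum G} (f : Hom E F) (V : OrthRep G) :
    (E.X V × I) ⊕ F.X V → (E.X V × I) ⊕ F.X V → Prop
  | glue (x : E.X V) : ConeRel f V (Sum.inl (x, 1)) (Sum.inr (f.app V x))
  | tip (x : E.X V) : ConeRel f V (Sum.inl (x, 0)) (Sum.inr (F.pt V))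
  | line (t : I) : ConeRel f V (Sum.inl (E.pt V, t)) (Sum.inr (F.pt V))

/-- The underlying spaces of the reduced mapping cone, with the quotient topology. -/
abbrev ConeX {E F : OrthSpectrum G} (f : Hom E F) (V : OrthRep G) : Type := Quot (ConeRel f V)

section Cone

variable {E F : OrthSpectrum G} (f : Hom E F)

/-- The map of cones induced by compatible maps `E(V) → E(W)` and `F(V) → F(W)`. -/
def coneMap {V W : OrthRep G} (a : E.X V → E.X W) (b : F.X V → F.X W)
    (hab : ∀ x, b (f.app V x) = f.app W (a x)) (ha : a (E.pt V) = E.pt W)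
    (hb : b (F.pt V) = F.pt W) : ConeX f V → ConeX f W :=
  Quot.map (Sum.map (Prod.map a _root_.id) b) fun _ _ h => by
    cases h with
    | glue x => simp only [Sum.map_inl, Sum.map_inr, Prod.map, hab]; exact ConeRel.glue _
    | tip x => simp only [Sum.map_inl, Sum.map_inr, Prod.map, hb]; exact ConeRel.tip _
    | line t => simp only [Sum.map_inl, Sum.map_inr, Prod.map, ha, hb]; exact ConeRel.line _

theorem continuous_coneMap {V W : OrthRep G} {a : E.X V → E.X W} {b : F.X V → F.X W}
    (hab : ∀ x, b (f.app V x) = f.app W (a x)) (ha : a (E.pt V) = E.pt W)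
    (hb : b (F.pt V) = F.pt W) (hac : Continuous a) (hbc : Continuous b) :
    Continuous (coneMap f a b hab ha hb) :=
  continuous_quot_lift _ (continuous_quot_mk.comp
    (Continuous.sumMap (hac.prodMap continuous_id) hbc))

instance (V : OrthRep G) : CompactlyGeneratedSpace (ConeX f V) :=
  uCompactlyGeneratedSpace_of_coinduced (f := Quot.mk (ConeRel f V)) continuous_quot_mk rfl

instance (V : OrthRep G) : MulAction G (ConeX f V) where
  smul g := coneMap f (g • ·) (g • ·) (fun x => (f.app_smul V g x).symm)
    (E.smul_pt V g) (F.smul_pt V g)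
  one_smul x := by
    induction x using Quot.ind with
    | mk x =>
      refine congrArg (Quot.mk _) ?_
      rcases x with ⟨x, t⟩ | x <;> simp
  mul_smul g h x := by
    induction x using Quot.ind with
    | mk x =>
      refine congrArg (Quot.mk _) ?_
      rcases x with ⟨x, t⟩ | x <;> simp [mul_smul]

/-- The action of morphisms on the mapping cone. -/
def coneAct {V W : OrthRep G} (j : OnePoint (JPt V W)) : ConeX f V → ConeX f W :=
  coneMap f (E.act j) (F.act j) (fun x => (f.app_act' j x).symm) (E.act_pt j) (F.act_pt j)

theorem continuous_coneAct (V W : OrthRep G) :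
    Continuous fun p : OnePoint (JPt V W) × ConeX f V => coneAct f p.1 p.2 := by
  refine isQuotientMap_quot_mk.continuous_lift_prod_right ?_
  rw [Homeomorph.prodSumDistrib.symm.isQuotientMap.continuous_iff, continuous_sum_dom]
  constructor
  · have h : Continuous fun p : OnePoint (JPt V W) × (E.X V × I) =>
        (Sum.inl (E.act p.1 p.2.1, p.2.2) : (E.X W × I) ⊕ F.X W) :=
      continuous_inl.comp (((E.continuous_act V W).comp
        (continuous_fst.prodMk (continuous_fst.comp continuous_snd))).prodMk
          (continuous_snd.comp continuous_snd))
    exact (continuous_quot_mk (r := ConeRel f W)).comp h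
  · exact (continuous_quot_mk (r := ConeRel f W)).comp
      (continuous_inr.comp (F.continuous_act V W))

/-- The reduced mapping cone `C(f)` of a morphism, formed levelwise:
`C(f)(V) = E(V) ∧ [0,1] ∪ F(V)`, where `[0,1]` is pointed by `0` and `(x, 1)` is glued
to `f(x)`. -/
def cone : OrthSpectrum G where
  X V := ConeX f V
  pt V := Quot.mk _ (Sum.inr (F.pt V))
  continuous_smul V g :=
    continuous_coneMap f _ _ _ (E.continuous_smul V g) (F.continuous_smul V g)
  smul_pt V g := congrArg (fun y => Quot.mk _ (Sum.inr y)) (F.smul_pt V g)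
  act j := coneAct f j
  continuous_act V W := continuous_coneAct f V W
  act_infty x := by
    induction x using Quot.ind with
    | mk x =>
      rcases x with ⟨x, t⟩ | x
      · refine Eq.trans (congrArg (fun y => Quot.mk _ (Sum.inl (y, t))) (E.act_infty x)) ?_
        exact Quot.sound (ConeRel.line t)
      · exact congrArg (fun y => Quot.mk _ (Sum.inr y)) (F.act_infty x)
  act_pt j := congrArg (fun y => Quot.mk _ (Sum.inr y)) (F.act_pt j)
  act_id x := by
    induction x using Quot.ind with
    | mk x =>
      rcases x with ⟨x, t⟩ | x
      · exact congrArg (fun y => Quot.mk _ (Sum.inl (y, t))) (E.act_id x)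
      · exact congrArg (fun y => Quot.mk _ (Sum.inr y)) (F.act_id x)
  act_comp k j x := by
    induction x using Quot.ind with
    | mk x =>
      rcases x with ⟨x, t⟩ | x
      · exact congrArg (fun y => Quot.mk _ (Sum.inl (y, t))) (E.act_comp k j x)
      · exact congrArg (fun y => Quot.mk _ (Sum.inr y)) (F.act_comp k j x)
  smul_act g j x := by
    induction x using Quot.ind with
    | mk x =>
      rcases x with ⟨x, t⟩ | x
      · exact congrArg (fun y => Quot.mk _ (Sum.inl (y, t))) (E.smul_act g j x)
      · exact congrArg (fun y => Quot.mk _ (Sum.inr y)) (F.smul_act g j x)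

/-- The inclusion `F → C(f)`. -/
def coneIncl : Hom F (cone f) where
  app _ x := Quot.mk _ (Sum.inr x)
  continuous_app _ := continuous_quot_mk.comp continuous_inr
  app_pt _ := rfl
  app_smul _ _ _ := rfl
  app_act _ _ := rfl

end Cone

end OrthSpectrum

/-! ### Equivariant stable homotopy -/

/-- A universal representation of `G`: a real inner product space with an orthogonal action of `G`
into which every finite dimensional orthogonal representation embeds. -/
structure UnivRep (G : Type*) [Group G] where
  carrier : Type
  [normed : NormedAddCommGroup carrier]
  [innerProd : InnerProductSpace ℝ carrier]
  ρ : G →* (carrier ≃ₗᵢ[ℝ] carrier)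
  universal : ∀ V : OrthRep G, ∃ φ : V →ₗᵢ[ℝ] carrier, ∀ g x, φ (V.ρ g x) = ρ g (φ x)

instance {G : Type*} [Group G] : CoeSort (UnivRep G) Type := ⟨UnivRep.carrier⟩

attribute [instance] UnivRep.normed UnivRep.innerProd

/-- The finite dimensional subrepresentations of a universal representation. -/
structure SubRep {G : Type*} [Group G] (U : UnivRep G) where
  space : Submodule ℝ U
  finDim : FiniteDimensional ℝ space
  invariant : ∀ g, ∀ x ∈ space, U.ρ g x ∈ space

attribute [instance] SubRep.finDim

namespace SubRep

variable {G : Type*} [Group G] {U : UnivRep G}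

/-- The restriction of the action to a subrepresentation. -/
def restrict (V : SubRep U) (g : G) : V.space →ₗ[ℝ] V.space :=
  (U.ρ g).toLinearEquiv.toLinearMap.restrict (V.invariant g)

@[simp] theorem coe_restrict (V : SubRep U) (g : G) (x : V.space) :
    (V.restrict g x : U) = U.ρ g x := rfl

/-- A finite dimensional subrepresentation as an orthogonal representation. -/
def toRep (V : SubRep U) : OrthRep G where
  carrier := V.space
  ρ :=
    { toFun := fun g =>
        { toLinearEquiv := LinearEquiv.ofLinearMap (V.restrict g) (V.restrict g⁻¹)
            (by ext x; simp) (by ext x; simp)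
          norm_map' := fun x => (U.ρ g).norm_map x }
      map_one' := by ext x; simp
      map_mul' := fun g h => by
        ext x
        change U.ρ (g * h) (x : U) = U.ρ g (U.ρ h (x : U))
        rw [map_mul]; rfl }

/-- The inclusion of a subrepresentation. -/
def incl (V : SubRep U) : V.toRep →ₗᵢ[ℝ] U := V.space.subtypeₗᵢ

theorem incl_injective (V : SubRep U) : Function.Injective V.incl := V.incl.injective

theorem incl_ρ (V : SubRep U) (g : G) (x : V.toRep) : V.incl (V.toRep.ρ g x) = U.ρ g (V.incl x) :=
  rfl

/-- The inclusion `V → W` for `V ⊆ W`. -/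
def inclInto {V W : SubRep U} (h : V.space ≤ W.space) : V.toRep →ₗᵢ[ℝ] W.toRep :=
  ⟨Submodule.inclusion h, fun _ => rfl⟩

/-- The orthogonal projection `W → V`. -/
def proj (V W : SubRep U) (w : W.toRep) : V.toRep := V.space.orthogonalProjectionOnto (W.incl w)

/-- For `V ⊆ W` and `w ∈ W`, the morphism `(φ, u)` with `φ : V → W` the inclusion and `u` the
component of `w` in the orthogonal complement of `V`. -/
def jInto {V W : SubRep U} (h : V.space ≤ W.space) (w : W.toRep) : JPt V.toRep W.toRep where
  emb := inclInto h
  vec := w - inclInto h (proj V W w)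
  orth x := V.space.sub_starProjection_mem_orthogonal (W.incl w) (V.incl x) x.2

theorem proj_ρ {V W : SubRep U} (g : G) (w : W.toRep) :
    proj V W (W.toRep.ρ g w) = V.toRep.ρ g (proj V W w) := by
  apply V.incl_injective
  rw [incl_ρ]
  change V.space.starProjection (U.ρ g (W.incl w)) = U.ρ g (V.space.starProjection (W.incl w))
  refine Submodule.eq_starProjection_of_mem_of_inner_eq_zero
    (V.invariant g _ (Submodule.starProjection_apply_mem _ _)) fun x hx => ?_
  have hx' : x = U.ρ g (U.ρ g⁻¹ x) := by
    rw [map_inv]; exact ((U.ρ g).apply_symm_apply x).symm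
  rw [hx', ← map_sub, LinearIsometryEquiv.inner_map_map]
  exact Submodule.starProjection_inner_eq_zero _ _ (V.invariant g⁻¹ x hx)

theorem conj_jInto {V W : SubRep U} (h : V.space ≤ W.space) (g : G) (w : W.toRep) :
    (jInto h w).conj g = jInto h (W.toRep.ρ g w) := by
  apply JPt.ext
  · ext x
    apply W.incl_injective
    change U.ρ g (U.ρ g⁻¹ (V.incl x)) = V.incl x
    rw [map_inv]; exact (U.ρ g).apply_symm_apply _
  · change W.toRep.ρ g (w - inclInto h (proj V W w)) = W.toRep.ρ g w - inclInto h _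
    rw [map_sub, proj_ρ]; rfl

end SubRep

namespace OrthSpectrum

variable {G : Type*} [Group G]

/-- Pointed `H`-equivariant maps from the one-point compactification `S^{V ⊕ ℝᵐ}` to `E(V)`. -/
@[ext] structure SphereMap (H : Subgroup G) (m : ℕ) (E : OrthSpectrum G) (V : OrthRep G) where
  toFun : OnePoint (V × Eucl m) → E.X V
  continuous_toFun : Continuous toFun
  map_infty : toFun ∞ = E.pt V
  map_smul : ∀ h ∈ H, ∀ (v : V) (t : Eucl m),
    toFun ((V.ρ h v, t) : V × Eucl m) = h • toFun ((v, t) : V × Eucl m)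

/-- Pointed `H`-equivariant homotopy. -/
def SphereMap.Homotopic {H : Subgroup G} {m : ℕ} {E : OrthSpectrum G} {V : OrthRep G}
    (f₀ f₁ : SphereMap H m E V) : Prop :=
  ∃ K : I → SphereMap H m E V, K 0 = f₀ ∧ K 1 = f₁ ∧
    Continuous fun p : I × OnePoint (V × Eucl m) => (K p.1).toFun p.2

/-- Postcomposition with a morphism of spectra. -/
def SphereMap.map {H : Subgroup G} {m : ℕ} {E F : OrthSpectrum G} (φ : Hom E F)
    {V : OrthRep G} (f : SphereMap H m E V) : SphereMap H m F V where
  toFun x := φ.app V (f.toFun x)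
  continuous_toFun := (φ.continuous_app V).comp f.continuous_toFun
  map_infty := by rw [f.map_infty, φ.app_pt]
  map_smul h hh v t := by rw [f.map_smul h hh, φ.app_smul]

section Stab

variable {U : UnivRep G}

theorem continuous_proj (V W : SubRep U) : Continuous (SubRep.proj V W) :=
  V.space.orthogonalProjectionOnto.continuous.comp W.incl.continuous

theorem continuous_jInto {V W : SubRep U} (h : V.space ≤ W.space) :
    Continuous (SubRep.jInto h) :=
  JPt.continuous_of_apply (fun _ => continuous_const)
    (continuous_id.sub ((SubRep.inclInto h).continuous.comp (continuous_proj V W)))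

/-- The underlying function of the stabilisation, see `SphereMap.stab`. -/
def stabFun {V W : SubRep U} (h : V.space ≤ W.space) {m : ℕ} (E : OrthSpectrum G)
    (f : OnePoint (V.toRep × Eucl m) → E.X V.toRep) (x : OnePoint (W.toRep × Eucl m)) :
    E.X W.toRep :=
  x.elim (E.pt W.toRep) fun p =>
    E.act (OnePoint.some (SubRep.jInto h p.1)) (f (OnePoint.some (SubRep.proj V W p.1, p.2)))

theorem continuous_stabFun {V W : SubRep U} (h : V.space ≤ W.space) {m : ℕ} (E : OrthSpectrum G)
    (f : OnePoint (V.toRep × Eucl m) → E.X V.toRep) (hf : Continuous f)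
    (hpt : f ∞ = E.pt V.toRep) : Continuous (stabFun h E f) := by
  refine continuous_elim_of_smash (A := JPt V.toRep W.toRep) (B := V.toRep × Eucl m)
    (C := W.toRep × Eucl m) (Φ := fun p => E.act p.1 (f p.2))
    ((E.continuous_act V.toRep W.toRep).comp
      (continuous_fst.prodMk (hf.comp continuous_snd)))
    (z := E.pt W.toRep) (fun y => E.act_infty _)
    (fun x => by simp only [hpt]; exact E.act_pt x)
    (r := fun c => (SubRep.jInto h c.1, (SubRep.proj V W c.1, c.2)))
    (((continuous_jInto h).comp continuous_fst).prodMk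
      (((continuous_proj V W).comp continuous_fst).prodMk continuous_snd)) ?_
  intro KA KB hA hB
  obtain ⟨a, ha⟩ := (hA.image JPt.continuous_vec).isBounded.exists_norm_le
  obtain ⟨b, hb⟩ := hB.isBounded.exists_norm_le
  have : ProperSpace (W.toRep × Eucl m) := FiniteDimensional.proper ℝ _
  refine ⟨Metric.closedBall 0 (max (a + b) b), Metric.isClosed_closedBall,
    isCompact_closedBall _ _, ?_⟩
  rintro ⟨w, t⟩ h1 h2
  have h3 : ‖(SubRep.jInto h w).vec‖ ≤ a := ha _ (mem_image_of_mem _ h1)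
  have h4 := hb _ h2
  simp only [Prod.norm_def, sup_le_iff] at h4
  have h5 : ‖w‖ ≤ a + b := by
    have e : w = (SubRep.jInto h w).vec + SubRep.inclInto h (SubRep.proj V W w) :=
      (sub_add_cancel _ _).symm
    rw [e]
    refine (norm_add_le _ _).trans (add_le_add h3 ?_)
    rw [LinearIsometry.norm_map]
    exact h4.1
  simp only [Metric.mem_closedBall, dist_zero_right, Prod.norm_def]
  exact max_le_max h5 h4.2

/-- The stabilisation of a map `S^{V ⊕ ℝᵐ} → E(V)` along an inclusion `V ⊆ W`: it sends
`(w, t)`, with `w = v + u` for `v ∈ V` and `u` orthogonal to `V`, to the image of `f (v, t)` under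
the structure map given by the inclusion and `u`. -/
def SphereMap.stab {H : Subgroup G} {m : ℕ} {E : OrthSpectrum G} {V W : SubRep U}
    (h : V.space ≤ W.space) (f : SphereMap H m E V.toRep) : SphereMap H m E W.toRep where
  toFun := stabFun h E f.toFun
  continuous_toFun := continuous_stabFun h E f.toFun f.continuous_toFun f.map_infty
  map_infty := rfl
  map_smul g hg w t := by
    simp only [stabFun, elim_some]
    rw [E.smul_act, SubRep.conj_jInto, SubRep.proj_ρ, f.map_smul g hg]

theorem SphereMap.stab_map {H : Subgroup G} {m : ℕ} {E F : OrthSpectrum G} (φ : Hom E F)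
    {V W : SubRep U} (h : V.space ≤ W.space) (f : SphereMap H m E V.toRep) :
    (f.map φ).stab h = (f.stab h).map φ := by
  ext x
  induction x using OnePoint.rec with
  | infty => exact (φ.app_pt _).symm
  | coe p => exact (φ.app_act _ _).symm

end Stab

/-- The relation generating the colimit over the finite dimensional subrepresentations of `U` of
the sets of homotopy classes of pointed `H`-maps `S^{V ⊕ ℝᵐ} → E(V)`. -/
def StabRel (U : UnivRep G) (H : Subgroup G) (m : ℕ) (E : OrthSpectrum G)
    (a b : Σ V : SubRep U, SphereMap H m E V.toRep) : Prop :=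
  ∃ h : a.1.space ≤ b.1.space, (a.2.stab h).Homotopic b.2

/-- The colimit of the sets `[S^{V ⊕ ℝᵐ}, E(V)]^H` over the finite dimensional subrepresentations
`V` of `U`. -/
def StableMaps (U : UnivRep G) (H : Subgroup G) (m : ℕ) (E : OrthSpectrum G) : Type :=
  Quot (StabRel U H m E)

/-- The underlying pointed set of the equivariant homotopy group `π_k^H E`, for an integer `k`: for
`k ≥ 0` it is the colimit of `[S^{V ⊕ ℝᵏ}, E(V)]^H`, and for `k < 0` the colimit of
`[S^V, E(V ⊕ ℝ^{-k})]^H`. -/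
def PiSet (U : UnivRep G) (H : Subgroup G) (k : ℤ) (E : OrthSpectrum G) : Type :=
  StableMaps U H k.toNat (E.shift (-k).toNat)

/-- The map induced on `StableMaps` by a morphism. -/
def stableMapsMap (U : UnivRep G) (H : Subgroup G) (m : ℕ) {E F : OrthSpectrum G}
    (φ : Hom E F) : StableMaps U H m E → StableMaps U H m F :=
  Quot.map (fun a => ⟨a.1, a.2.map φ⟩) <| by
    rintro a b ⟨h, K, h0, h1, hK⟩
    refine ⟨h, fun t => (K t).map φ, ?_, ?_, (φ.continuous_app _).comp hK⟩
    · exact (congrArg (SphereMap.map φ) h0).trans (SphereMap.stab_map φ h a.2).symm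
    · exact congrArg (SphereMap.map φ) h1

/-- The map induced on homotopy groups by a morphism. -/
def piMap (U : UnivRep G) (H : Subgroup G) (k : ℤ) {E F : OrthSpectrum G} (φ : Hom E F) :
    PiSet U H k E → PiSet U H k F :=
  stableMapsMap U H k.toNat (φ.shift (-k).toNat)

/-- A `π_*`-isomorphism (stable equivalence) of orthogonal `G`-spectra: a morphism inducing
bijections on `π_k^H` for all integers `k` and all subgroups `H` of `G`. -/
def IsPiIso (U : UnivRep G) {E F : OrthSpectrum G} (φ : Hom E F) : Prop :=
  ∀ (H : Subgroup G) (k : ℤ), Function.Bijective (piMap U H k φ)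

/-- `E --f--> F --g--> K` is a (homotopy) cofiber sequence: `g` extends over the mapping cone of
`f`, that is, `g ∘ f` has a null-homotopy, in such a way that the resulting map `C(f) → K` is a
`π_*`-isomorphism. -/
def IsCofiberSequence (U : UnivRep G) {E F K : OrthSpectrum G} (f : Hom E F) (g : Hom F K) :
    Prop :=
  ∃ φ : Hom (cone f) K, φ.comp (coneIncl f) = g ∧ IsPiIso U φ

end OrthSpectrum

/-! ### Thom spectra of functorial bundles -/

/-- A functor from pairs `(φ, w)` as above to locally compact spaces, for which the functions
`size` exhibit the actions as proper. The examples are total spaces `A(V)` of vector bundles over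
compact spaces, `size` is the norm in the fibres, and the one-point compactification of `A(V)` is
the Thom space. -/
structure ThomFunctor (G : Type*) [Group G] where
  A : OrthRep G → Type
  [top : ∀ V, TopologicalSpace (A V)]
  [t2 : ∀ V, T2Space (A V)]
  size : ∀ V, A V → ℝ
  continuous_size : ∀ V, Continuous (size V)
  isCompact_size : ∀ V r, IsCompact {a | size V a ≤ r}
  act : ∀ {V W : OrthRep G}, JPt V W → A V → A W
  continuous_act : ∀ V W : OrthRep G, Continuous fun p : JPt V W × A V => act p.1 p.2
  vec_le : ∀ {V W : OrthRep G} (j : JPt V W) (a : A V), ‖j.vec‖ ≤ size W (act j a)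
  size_le : ∀ {V W : OrthRep G} (j : JPt V W) (a : A V), size V a ≤ size W (act j a)
  act_id : ∀ {V : OrthRep G} (a : A V), act (JPt.id V) a = a
  act_comp : ∀ {V W Z : OrthRep G} (k : JPt W Z) (j : JPt V W) (a : A V),
    act (k.comp j) a = act k (act j a)

attribute [instance] ThomFunctor.top ThomFunctor.t2

namespace ThomFunctor

variable {G : Type*} [Group G]

instance (T : ThomFunctor G) (V : OrthRep G) : WeaklyLocallyCompactSpace (T.A V) where
  exists_compact_mem_nhds a := ⟨_, T.isCompact_size V (T.size V a + 1), by
    have h : IsOpen {b | T.size V b < T.size V a + 1} :=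
      isOpen_lt (T.continuous_size V) continuous_const
    have ha : T.size V a < T.size V a + 1 := lt_add_one _
    exact mem_of_superset (h.mem_nhds ha) fun b (hb : T.size V b < T.size V a + 1) =>
      show T.size V b ≤ T.size V a + 1 from hb.le⟩

theorem continuous_map (T S : ThomFunctor G) {V W : OrthRep G} {f : T.A V → S.A W}
    (hf : Continuous f) (hs : ∀ a, T.size V a ≤ S.size W (f a)) :
    Continuous (OnePoint.map f) := by
  refine OnePoint.continuous_map hf ?_
  rw [hasBasis_coclosedCompact.tendsto_right_iff]
  rintro K ⟨-, hK⟩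
  obtain ⟨r, hr⟩ := (hK.image (S.continuous_size W)).isBounded.exists_norm_le
  have hc := T.isCompact_size V r
  refine mem_of_superset (hasBasis_coclosedCompact.mem_of_mem ⟨hc.isClosed, hc⟩) ?_
  intro a ha haK
  exact ha ((hs a).trans ((le_abs_self _).trans (hr _ (mem_image_of_mem _ haK))))

theorem continuous_actPlus (T : ThomFunctor G) (V W : OrthRep G) :
    Continuous fun p : OnePoint (JPt V W) × OnePoint (T.A V) =>
      smashMap (T.act (V := V) (W := W)) p.1 p.2 := by
  refine continuous_smashMap (T.continuous_act V W) fun K _ hK => ?_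
  obtain ⟨r, hr⟩ := (hK.image (T.continuous_size W)).isBounded.exists_norm_le
  have h1 := JPt.isCompact_norm_le (V := V) (W := W) r
  have h2 := T.isCompact_size V r
  refine ⟨_, _, ⟨h1.isClosed, h1⟩, ⟨h2.isClosed, h2⟩, fun j a hja => ?_⟩
  have h3 : T.size W (T.act j a) ≤ r :=
    (le_abs_self _).trans (hr _ (mem_image_of_mem _ hja))
  exact ⟨(T.vec_le j a).trans h3, (T.size_le j a).trans h3⟩

/-- The element `g` acts on `V` by a linear isometry, hence on `A(V)`, and on its one-point
compactification with `∞` fixed. -/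
instance (T : ThomFunctor G) (V : OrthRep G) : MulAction G (OnePoint (T.A V)) where
  smul g := OnePoint.map (T.act (JPt.ofIsom (V.isom g)))
  one_smul x := by
    induction x using OnePoint.rec with
    | infty => rfl
    | coe a =>
      refine congrArg OnePoint.some ?_
      have : JPt.ofIsom (V.isom (1 : G)) = JPt.id V := by
        apply JPt.ext
        · ext x; simp
        · rfl
      rw [this, T.act_id]
  mul_smul g h x := by
    induction x using OnePoint.rec with
    | infty => rfl
    | coe a =>
      refine congrArg OnePoint.some ?_
      have : JPt.ofIsom (V.isom (g * h)) =
          (JPt.ofIsom (V.isom g)).comp (JPt.ofIsom (V.isom h)) := by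
        apply JPt.ext
        · ext x; simp
        · simp
      rw [this, T.act_comp]

theorem smul_infty (T : ThomFunctor G) (V : OrthRep G) (g : G) :
    g • (∞ : OnePoint (T.A V)) = ∞ := rfl

/-- The orthogonal `G`-spectrum `V ↦ OnePoint (A(V))`. -/
def spectrum (T : ThomFunctor G) : OrthSpectrum G where
  X V := OnePoint (T.A V)
  pt _ := ∞
  continuous_smul V g := continuous_map T T
    ((T.continuous_act V V).comp (continuous_const.prodMk continuous_id)) (T.size_le _)
  smul_pt V g := T.smul_infty V g
  act {V W} j x := smashMap (T.act (V := V) (W := W)) j x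
  continuous_act := T.continuous_actPlus
  act_infty _ := rfl
  act_pt j := smashMap_infty_right _ j
  act_id x := by
    induction x using OnePoint.rec with
    | infty => rfl
    | coe a => exact congrArg OnePoint.some (T.act_id a)
  act_comp k j x := by
    induction x using OnePoint.rec with
    | infty => rfl
    | coe a => exact congrArg OnePoint.some (T.act_comp k j a)
  smul_act {V W} g j x := by
    induction x using OnePoint.rec with
    | infty => rfl
    | coe a =>
      refine congrArg OnePoint.some ?_
      rw [← T.act_comp, ← T.act_comp]
      congr 1
      apply JPt.ext
      · ext x
        change W.ρ g (j.emb x) = W.ρ g (j.emb (V.ρ g⁻¹ (V.ρ g x)))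
        rw [map_inv]
        exact congrArg (fun y => W.ρ g (j.emb y)) ((V.ρ g).symm_apply_apply x).symm
      · simp [JPt.conj]

/-- A natural family of maps `A(V) → B(V)` which does not decrease sizes induces a morphism of
spectra. -/
def homOfMaps (T S : ThomFunctor G) (f : ∀ V, T.A V → S.A V) (hf : ∀ V, Continuous (f V))
    (hs : ∀ V a, T.size V a ≤ S.size V (f V a))
    (hact : ∀ {V W : OrthRep G} (j : JPt V W) a, f W (T.act j a) = S.act j (f V a)) :
    OrthSpectrum.Hom T.spectrum S.spectrum where
  app V := OnePoint.map (f V)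
  continuous_app V := continuous_map T S (hf V) (hs V)
  app_pt _ := rfl
  app_smul V g x := by
    induction x using OnePoint.rec with
    | infty => rfl
    | coe a => exact congrArg OnePoint.some (hact _ a)
  app_act j x := by
    induction x using OnePoint.rec with
    | infty => rfl
    | coe a => exact congrArg OnePoint.some (hact j a)

/-- A natural family of maps `A(V) → B(V ⊕ ℝⁿ)` which does not decrease sizes induces a morphism
to the shifted spectrum. -/
def homToShift (T S : ThomFunctor G) (n : ℕ) (f : ∀ V : OrthRep G, T.A V → S.A (V.add n))
    (hf : ∀ V, Continuous (f V)) (hs : ∀ V a, T.size V a ≤ S.size (V.add n) (f V a))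
    (hact : ∀ {V W : OrthRep G} (j : JPt V W) a,
      f W (T.act j a) = S.act (V := V.add n) (W := W.add n) (j.add n) (f V a)) :
    OrthSpectrum.Hom T.spectrum (S.spectrum.shift n) where
  app V := OnePoint.map (f V)
  continuous_app V := continuous_map T S (hf V) (hs V)
  app_pt _ := rfl
  app_smul V g x := by
    induction x using OnePoint.rec with
    | infty => rfl
    | coe a => exact congrArg OnePoint.some (hact _ a)
  app_act j x := by
    induction x using OnePoint.rec with
    | infty => rfl
    | coe a => exact congrArg OnePoint.some (hact j a)

end ThomFunctor

/-! ### Grassmannians -/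

/-- The Grassmannian of `d`-dimensional linear subspaces of `V`. -/
def Gr (d : ℕ) (V : Type) [NormedAddCommGroup V] [InnerProductSpace ℝ V] : Type :=
  {L : Submodule ℝ V // Module.finrank ℝ L = d}

namespace Gr

variable {d : ℕ} {V W X : Type}
  [NormedAddCommGroup V] [InnerProductSpace ℝ V] [FiniteDimensional ℝ V]
  [NormedAddCommGroup W] [InnerProductSpace ℝ W] [FiniteDimensional ℝ W]
  [NormedAddCommGroup X] [InnerProductSpace ℝ X] [FiniteDimensional ℝ X]

/-- The orthogonal projection onto a point of the Grassmannian. -/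
def toProj (L : Gr d V) : V →L[ℝ] V := L.1.starProjection

theorem toProj_injective : Function.Injective (toProj : Gr d V → _) := by
  intro L M h
  apply Subtype.ext
  have h' : L.1.starProjection = M.1.starProjection := h
  rw [← Submodule.range_starProjection L.1, h', Submodule.range_starProjection]

/-- The usual topology, in which a subspace is identified with the orthogonal projection onto it. -/
instance : TopologicalSpace (Gr d V) := TopologicalSpace.induced toProj inferInstance

theorem isEmbedding_toProj : IsEmbedding (toProj : Gr d V → _) := ⟨⟨rfl⟩, toProj_injective⟩

theorem continuous_toProj : Continuous (toProj : Gr d V → _) := isEmbedding_toProj.continuous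

instance : T2Space (Gr d V) := T2Space.of_injective_continuous toProj_injective continuous_toProj

theorem continuous_of_apply {T : Type*} [TopologicalSpace T] {f : T → Gr d V}
    (h : ∀ x, Continuous fun t => (f t).toProj x) : Continuous f :=
  isEmbedding_toProj.continuous_iff.2 (continuous_clm_apply.2 h)

theorem isClosed_range_toProj : IsClosed (range (toProj : Gr d V → _)) := by
  have : range (toProj : Gr d V → _) =
      {P : V →L[ℝ] V | (P * P = P ∧ star P = P) ∧ LinearMap.trace ℝ V P.toLinearMap = d} := by
    ext P
    constructor
    · rintro ⟨L, rfl⟩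
      have h := isStarProjection_starProjection (𝕜 := ℝ) (U := L.1)
      refine ⟨⟨h.1, h.2⟩, ?_⟩
      have hp : LinearMap.IsProj L.1 L.1.starProjection.toLinearMap :=
        ⟨fun x => Submodule.starProjection_apply_mem _ x,
          fun x hx => Submodule.starProjection_eq_self_iff.2 hx⟩
      have := hp.trace
      rw [L.2] at this
      exact this
    · rintro ⟨⟨h1, h2⟩, h3⟩
      obtain ⟨L, hL, rfl⟩ := isStarProjection_iff_eq_starProjection.1 (⟨h1, h2⟩ :
        IsStarProjection P)
      have hp : LinearMap.IsProj L L.starProjection.toLinearMap :=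
        ⟨fun x => Submodule.starProjection_apply_mem _ x,
          fun x hx => Submodule.starProjection_eq_self_iff.2 hx⟩
      have := hp.trace
      rw [h3] at this
      exact ⟨⟨L, by exact_mod_cast this.symm⟩, rfl⟩
  rw [this, ofPred_and, ofPred_and]
  refine ((isClosed_eq (by fun_prop) continuous_id).inter
    (isClosed_eq continuous_star continuous_id)).inter (isClosed_eq ?_ continuous_const)
  exact LinearMap.continuous_of_finiteDimensional
    ((LinearMap.trace ℝ V).comp (ContinuousLinearMap.coeLM ℝ))

instance : CompactSpace (Gr d V) := by
  have hemb : IsClosedEmbedding (toProj : Gr d V → _) :=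
    ⟨isEmbedding_toProj, isClosed_range_toProj⟩
  have : ProperSpace (V →L[ℝ] V) := FiniteDimensional.proper ℝ _
  refine ⟨(hemb.isCompact_preimage (isCompact_closedBall (0 : V →L[ℝ] V) 1)).of_isClosed_subset
    isClosed_univ ?_⟩
  intro L _
  simp only [mem_preimage, Metric.mem_closedBall, dist_zero_right]
  exact L.1.starProjection_norm_le

/-- The image of a subspace under a linear isometric embedding. -/
def map (φ : V →ₗᵢ[ℝ] W) (L : Gr d V) : Gr d W :=
  ⟨L.1.map φ.toLinearMap, by
    exact (Submodule.equivMapOfInjective φ.toLinearMap φ.injective L.1).finrank_eq.symm.trans L.2⟩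

theorem toProj_map (φ : V →ₗᵢ[ℝ] W) (L : Gr d V) (y : W) :
    (L.map φ).toProj y = φ (L.toProj (φ.toContinuousLinearMap.adjoint y)) := by
  refine Submodule.eq_starProjection_of_mem_of_inner_eq_zero
    (Submodule.mem_map_of_mem (Submodule.starProjection_apply_mem _ _)) ?_
  rintro _ ⟨x, hx, rfl⟩
  have h := Submodule.starProjection_inner_eq_zero (K := L.1)
    (φ.toContinuousLinearMap.adjoint y) x hx
  rw [inner_sub_left, ContinuousLinearMap.adjoint_inner_left] at h
  rw [inner_sub_left]
  refine Eq.trans ?_ h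
  congr 1
  exact φ.inner_map_map _ _

theorem map_id (L : Gr d V) : L.map LinearIsometry.id = L := Subtype.ext (Submodule.map_id _)

theorem map_comp (ψ : W →ₗᵢ[ℝ] X) (φ : V →ₗᵢ[ℝ] W) (L : Gr d V) :
    L.map (ψ.comp φ) = (L.map φ).map ψ := Subtype.ext (Submodule.map_comp _ _ _)

theorem continuous_map {T : Type*} [TopologicalSpace T] {j : T → JPt V W} {L : T → Gr d V}
    (hj : Continuous j) (hL : Continuous L) : Continuous fun t => (L t).map (j t).emb := by
  refine continuous_of_apply fun y => ?_
  simp only [toProj_map]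
  have h1 : Continuous fun t => ((j t).emb.toContinuousLinearMap).adjoint y :=
    ((ContinuousLinearMap.adjoint (𝕜 := ℝ) (E := V) (F := W)).continuous.comp
      (JPt.continuous_emb.comp hj)).clm_apply continuous_const
  exact JPt.continuous_emb_apply hj ((continuous_toProj.comp hL).clm_apply h1)

theorem finrank_comap_fst (L : Submodule ℝ V) (n : ℕ) :
    Module.finrank ℝ (L.comap (WithLp.fstₗ 2 ℝ V (Eucl n))) = Module.finrank ℝ L + n := by
  let e : L.comap (WithLp.fstₗ 2 ℝ V (Eucl n)) ≃ₗ[ℝ] L × Eucl n :=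
    { toFun := fun x => (⟨x.1.fst, x.2⟩, x.1.snd)
      invFun := fun y => ⟨WithLp.toLp 2 (y.1.1, y.2), y.1.2⟩
      map_add' := fun _ _ => rfl
      map_smul' := fun _ _ => rfl
      left_inv := fun _ => rfl
      right_inv := fun _ => rfl }
  rw [e.finrank_eq, Module.finrank_prod, finrank_euclideanSpace_fin]

/-- The subspace `L ⊕ ℝ` of `V ⊕ ℝ`. -/
def addLine (L : Gr d V) : Gr (d + 1) (AddE V 1) :=
  ⟨L.1.comap (WithLp.fstₗ 2 ℝ V (Eucl 1)), by
    rw [finrank_comap_fst, L.2]⟩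

theorem inclE_mem_addLine {L : Gr d V} {v : V} (h : v ∈ L.1ᗮ) : inclE V 1 v ∈ L.addLine.1ᗮ := by
  intro x hx
  have h' := h x.fst hx
  rw [WithLp.prod_inner_apply]
  simpa using h'

theorem toProj_addLine (L : Gr d V) (x : AddE V 1) :
    L.addLine.toProj x = WithLp.toLp 2 (L.toProj x.fst, x.snd) := by
  refine Submodule.eq_starProjection_of_mem_of_inner_eq_zero
    (Submodule.starProjection_apply_mem L.1 x.fst) ?_
  intro y hy
  have h := Submodule.starProjection_inner_eq_zero (K := L.1) x.fst y.fst hy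
  simpa [WithLp.prod_inner_apply, toProj] using h

theorem continuous_addLine : Continuous (addLine : Gr d V → _) :=
  continuous_of_apply fun x => by
    simp only [toProj_addLine]
    exact JPt.continuous_toLp (continuous_toProj.clm_apply continuous_const) continuous_const

theorem addLine_map (φ : V →ₗᵢ[ℝ] W) (L : Gr d V) :
    (L.map φ).addLine = L.addLine.map (addIsom φ 1) := by
  apply Subtype.ext
  ext x
  constructor
  · rintro ⟨y, hy, hyx⟩
    exact ⟨WithLp.toLp 2 (y, x.snd), hy, AddE.ext hyx rfl⟩
  · rintro ⟨y, hy, rfl⟩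
    exact ⟨y.fst, hy, rfl⟩

end Gr

/-- The total space `{(L, v) : v ⟂ L}` of the orthogonal complement `ξ^⟂` of the tautological
bundle over the Grassmannian of `d`-planes in `V`. -/
def PerpBundle (d : ℕ) (V : Type) [NormedAddCommGroup V] [InnerProductSpace ℝ V]
    [FiniteDimensional ℝ V] : Type := {p : Gr d V × V // p.2 ∈ p.1.1ᗮ}

instance (d : ℕ) (V : Type) [NormedAddCommGroup V] [InnerProductSpace ℝ V]
    [FiniteDimensional ℝ V] : TopologicalSpace (PerpBundle d V) := instTopologicalSpaceSubtype

instance (d : ℕ) (V : Type) [NormedAddCommGroup V] [InnerProductSpace ℝ V]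
    [FiniteDimensional ℝ V] : T2Space (PerpBundle d V) :=
  inferInstanceAs (T2Space {p : Gr d V × V // p.2 ∈ p.1.1ᗮ})

section Spectra

variable (G : Type*) [Group G]

theorem JPt.norm_sq {V W : Type} [NormedAddCommGroup V] [InnerProductSpace ℝ V]
    [NormedAddCommGroup W] [InnerProductSpace ℝ W] (j : JPt V W) (v : V) :
    ‖j.emb v + j.vec‖ ^ 2 = ‖v‖ ^ 2 + ‖j.vec‖ ^ 2 := by
  rw [norm_add_sq_real, j.orth]; simp

theorem JPt.vec_le {V W : Type} [NormedAddCommGroup V] [InnerProductSpace ℝ V]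
    [NormedAddCommGroup W] [InnerProductSpace ℝ W] (j : JPt V W) (v : V) :
    ‖j.vec‖ ≤ ‖j.emb v + j.vec‖ := by
  have := j.norm_sq v
  nlinarith [norm_nonneg v, norm_nonneg j.vec, norm_nonneg (j.emb v + j.vec)]

theorem JPt.size_le {V W : Type} [NormedAddCommGroup V] [InnerProductSpace ℝ V]
    [NormedAddCommGroup W] [InnerProductSpace ℝ W] (j : JPt V W) (v : V) :
    ‖v‖ ≤ ‖j.emb v + j.vec‖ := by
  have := j.norm_sq v
  nlinarith [norm_nonneg v, norm_nonneg j.vec, norm_nonneg (j.emb v + j.vec)]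

/-- The total spaces of the bundles `ξ^⟂` over `Gr_d(V)`, on which `(φ, w)` acts by
`(L, v) ↦ (φ(L), φ(v) + w)`. -/
def mtoFunctor (d : ℕ) : ThomFunctor G where
  A V := PerpBundle d V
  size _ p := ‖p.1.2‖
  continuous_size _ := continuous_norm.comp (continuous_snd.comp continuous_subtype_val)
  isCompact_size V r := by
    have hc : IsClosed {p : Gr d V × V | p.2 ∈ p.1.1ᗮ} := by
      have : {p : Gr d V × V | p.2 ∈ p.1.1ᗮ} = {p | p.1.toProj p.2 = 0} := by
        ext p; exact (Submodule.starProjection_apply_eq_zero_iff _).symm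
      rw [this]
      exact isClosed_eq ((Gr.continuous_toProj.comp continuous_fst).clm_apply continuous_snd)
        continuous_const
    have hemb : IsClosedEmbedding (Subtype.val : PerpBundle d V → _) :=
      hc.isClosedEmbedding_subtypeVal
    have h := hemb.isCompact_preimage
      ((isCompact_univ (X := Gr d V)).prod (isCompact_closedBall (0 : V) r))
    refine h.of_isClosed_subset (isClosed_le (continuous_norm.comp
      (continuous_snd.comp continuous_subtype_val)) continuous_const) fun p hp => ?_
    exact ⟨mem_univ _, mem_closedBall_zero_iff.2 hp⟩
  act j p := ⟨(p.1.1.map j.emb, j.emb p.1.2 + j.vec), by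
    refine Submodule.add_mem _ ?_ ?_
    · rintro _ ⟨x, hx, rfl⟩
      exact (j.emb.inner_map_map _ _).trans (p.2 x hx)
    · rintro _ ⟨x, hx, rfl⟩
      exact j.orth x⟩
  continuous_act V W := by
    have hp : Continuous fun q : JPt V W × PerpBundle d V => q.2.1 :=
      continuous_subtype_val.comp continuous_snd
    exact ((Gr.continuous_map continuous_fst (continuous_fst.comp hp)).prodMk
      ((JPt.continuous_emb_apply continuous_fst (continuous_snd.comp hp)).add
        (JPt.continuous_vec.comp continuous_fst))).subtype_mk _
  vec_le j p := j.vec_le p.1.2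
  size_le j p := j.size_le p.1.2
  act_id p := by
    refine Subtype.ext (Prod.ext (Gr.map_id _) ?_)
    simp
  act_comp k j p := by
    refine Subtype.ext (Prod.ext (Gr.map_comp _ _ _) ?_)
    simp [add_assoc]

/-- The orthogonal `G`-spectrum `MTO_d`, with `MTO_d(V)` the Thom space of the orthogonal
complement of the tautological bundle over `Gr_d(V)`; as `Gr_d(V)` is compact, this is the
one-point compactification of the total space. -/
def MTO (d : ℕ) : OrthSpectrum G := (mtoFunctor G d).spectrum

/-- The spaces `V × Gr_d(V)`, on which `(φ, w)` acts by `(v, L) ↦ (φ(v) + w, φ(L))`. -/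
def suspFunctor (d : ℕ) : ThomFunctor G where
  A V := V × Gr d V
  size _ p := ‖p.1‖
  continuous_size _ := continuous_norm.comp continuous_fst
  isCompact_size V r := by
    have h := (isCompact_closedBall (0 : V) r).prod (isCompact_univ (X := Gr d V))
    convert h using 1
    ext p
    simp
  act j p := (j.emb p.1 + j.vec, p.2.map j.emb)
  continuous_act V W :=
    ((JPt.continuous_emb_apply continuous_fst (continuous_fst.comp continuous_snd)).add
      (JPt.continuous_vec.comp continuous_fst)).prodMk
      (Gr.continuous_map continuous_fst (continuous_snd.comp continuous_snd))
  vec_le j p := j.vec_le p.1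
  size_le j p := j.size_le p.1
  act_id p := Prod.ext (by simp) (Gr.map_id _)
  act_comp k j p := Prod.ext (by simp [add_assoc]) (Gr.map_comp _ _ _)

/-- The suspension spectrum `Σ^∞_+ B_G O(d)`, with value `S^V ∧ Gr_d(V)_+` at `V`; as `Gr_d(V)` is
compact, this smash product is the one-point compactification of `V × Gr_d(V)`. -/
def suspBO (d : ℕ) : OrthSpectrum G := (suspFunctor G d).spectrum

/-- The spaces `(V ⊕ ℝ) × Gr_d(V)`, on which `(φ, w)` acts by
`((v, t), L) ↦ ((φ(v) + w, t), φ(L))`. -/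
def suspOneFunctor (d : ℕ) : ThomFunctor G where
  A V := AddE V 1 × Gr d V
  size _ p := ‖p.1‖
  continuous_size _ := continuous_norm.comp continuous_fst
  isCompact_size V r := by
    have : ProperSpace (AddE V 1) := FiniteDimensional.proper ℝ _
    have h := (isCompact_closedBall (0 : AddE V 1) r).prod (isCompact_univ (X := Gr d V))
    convert h using 1
    ext p
    simp
  act j p := ((j.add 1).emb p.1 + (j.add 1).vec, p.2.map j.emb)
  continuous_act V W := by
    have h : Continuous fun q : JPt V W × (AddE V 1 × Gr d V) => q.1.add 1 :=
      (JPt.continuous_add 1).comp continuous_fst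
    exact ((JPt.continuous_emb_apply h (continuous_fst.comp continuous_snd)).add
      (JPt.continuous_vec.comp h)).prodMk
      (Gr.continuous_map continuous_fst (continuous_snd.comp continuous_snd))
  vec_le j p := (JPt.norm_toLp_zero 1 j.vec).symm.trans_le ((j.add 1).vec_le p.1)
  size_le j p := (j.add 1).size_le p.1
  act_id p := Prod.ext (by rw [JPt.add_id]; simp) (Gr.map_id _)
  act_comp k j p := Prod.ext (by
    rw [JPt.add_comp, JPt.comp_emb_apply, JPt.comp_vec, map_add, add_assoc]) (Gr.map_comp _ _ _)

/-- The suspension `Σ^{∞+1}_+ B_G O(d)` of `Σ^∞_+ B_G O(d)`, with value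
`S^{V ⊕ ℝ} ∧ Gr_d(V)_+` at `V`. -/
def suspOneBO (d : ℕ) : OrthSpectrum G := (suspOneFunctor G d).spectrum

/-! ### The maps of the sequence -/

/-- The morphism `MTO_d → sh_1 MTO_{d+1}`, `(L, v) ↦ (L ⊕ ℝ, (v, 0))`. -/
def iota (d : ℕ) : OrthSpectrum.Hom (MTO G d) ((MTO G (d + 1)).shift 1) :=
  ThomFunctor.homToShift (mtoFunctor G d) (mtoFunctor G (d + 1)) 1
    (fun V p => ⟨(p.1.1.addLine, inclE V 1 p.1.2), Gr.inclE_mem_addLine p.2⟩)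
    (fun V => by
      have hp : Continuous fun q : PerpBundle d V => q.1 := continuous_subtype_val
      exact ((Gr.continuous_addLine.comp (continuous_fst.comp hp)).prodMk
        ((inclE V 1).continuous.comp (continuous_snd.comp hp))).subtype_mk _)
    (fun V p => ((inclE V 1).norm_map p.1.2).ge)
    (fun j p => Subtype.ext (Prod.ext (Gr.addLine_map _ _) (AddE.ext rfl (add_zero (0 : Eucl 1)).symm)))

/-- The morphism `MTO_d → Σ^∞_+ B_G O(d)` given by the inclusions of `ξ^⟂` into the trivial bundle
`V × Gr_d(V) = ξ^⟂ ⊕ ξ`, `(L, v) ↦ (v, L)`. -/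
def toSusp (d : ℕ) : OrthSpectrum.Hom (MTO G d) (suspBO G d) :=
  ThomFunctor.homOfMaps (mtoFunctor G d) (suspFunctor G d) (fun _ p => (p.1.2, p.1.1))
    (fun _ => continuous_swap.comp continuous_subtype_val) (fun _ _ => le_rfl)
    (fun _ _ => rfl)

/-- The morphism `Σ^{∞+1}_+ B_G O(d) → sh_1 Σ^∞_+ B_G O(d)`,
`((v, t), L) ↦ ((v, t), L ⊕ 0)`. -/
def suspToShift (d : ℕ) : OrthSpectrum.Hom (suspOneBO G d) ((suspBO G d).shift 1) :=
  ThomFunctor.homToShift (suspOneFunctor G d) (suspFunctor G d) 1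
    (fun V p => (p.1, p.2.map (inclE V 1)))
    (fun V => continuous_fst.prodMk
      (Gr.continuous_map (j := fun _ => JPt.ofIsom (inclE V 1)) continuous_const continuous_snd))
    (fun _ _ => le_rfl)
    (fun j p => Prod.ext rfl (by
      refine (Gr.map_comp _ _ _).symm.trans (Eq.trans ?_ (Gr.map_comp _ _ _))
      congr 1))

end Spectra

end

end GSpec

set_option linter.unusedSectionVars false

namespace GSpec

open Topology Set Filter OnePoint unitInterval

noncomputable section

section

/-! ### Families of maps out of one-point compactifications -/

section Families

variable {P A B C D Z : Type*} [TopologicalSpace P] [TopologicalSpace A] [TopologicalSpace B]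
  [TopologicalSpace C] [TopologicalSpace D] [TopologicalSpace Z]

/-! Write $d+1$ for the rank in the middle term. A point of $S^{V\oplus\mathbf R}\wedge
\mathrm{Gr}_{d+1}(V\oplus\mathbf R)_+$ is a pair $(w,L)$, and $w$ splits as $w^\perp+w_L$ with
$w_L\in L$. If $w_L=0$, the pair lies in the image of $\mathrm{sh}_1MTO_{d+1}$. If $w_L\ne 0$, it
splits the line of $w_L$ off $L$, and the complement of that line is a $d$-plane, as needed for
$MTO_d$. So the third term should be $\mathrm{sh}_1MTO_{d+1}$ with a cone on $MTO_d$ attached, the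
cone coordinate recording $|w_L|$. The only defect is that the $d$-plane and its vector lie in
$V\oplus\mathbf R$ instead of $V$, and this is repaired by one suspension.

The criterion `isPiIso_of_suspMap` makes this precise. A morphism $\varphi\colon E\to F$ is a
$\pi_*$-isomorphism as soon as for every $V$ there is a pointed equivariant map $\psi\colon
F(V)\wedge S^1\to E(V\oplus\mathbf R)$ for which $\varphi\psi$ and $\psi\varphi$ are homotopic to
the structure maps of $F$ and $E$. Indeed, every $V\subset\mathcal U$ sits in some $V\oplus\mathbf R
e\subset\mathcal U$ with $e$ fixed by $G$ (`exists_lineExt`), and stabilising along this inclusion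
is applying the structure map. No naturality of $\psi$ in $V$ is required.

The geometric tool is `tilt`: for $q\in X$ the space $X$ is rotated inside $X\oplus\mathbf R$ in the
plane of $q$ and the new coordinate, by an angle with sine $\min(1,|q|)$. It depends continuously on
$q$ and commutes with isometries, hence gives equivariant maps and homotopies.

The extension over the cone, `coneToSusp`, sends $((L,v),t)$ to $((v,(1-t)/t),L\oplus\mathbf R)$.
The map $\psi$ for it, `collapse`, takes $(w,L,s)$, tilts $L$ by $w_L$ and keeps only $w^\perp$
together with a vector of length $|s|$. When $|w_L|\ge 1$ the tilt is a quarter turn, which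
exchanges the line of $w_L$ with the new coordinate (`Gr.map_tiltEmb`). The result then comes from
$MTO_d$ along $\iota$ and is pushed into the cone to the height $1/|w_L|$. Shrinking the tilt from
$w_L$ to $0$ deforms `coneToSusp` after `collapse` into a rotated structure map (`spread`). The
other composite is exactly `coneTilt` at time $0$ (`collapse_precomp`), which is deformed to the
structure map of the cone by finishing the rotation and then reparametrising the cone coordinate
(`coneTilt_zero_homotopic`).

For the comparison of $\Sigma^{\infty+1}_+B_GO(d)$ with $\mathrm{sh}_1\Sigma^\infty_+B_GO(d)$, the
map $\psi$ applies a quarter turn to the vector and leaves the subspace alone. One composite is the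
structure map itself, and the other differs from it by a rotation of the subspace
(`isPiIso_suspToShift`). -/

/-- The version of `continuous_elim_of_smash` for families of maps. -/
theorem continuous_elim_of_smash_family [LocallyCompactSpace P]
    {Φ : P → OnePoint A × OnePoint B → Z}
    (hΦ : Continuous fun q : P × (OnePoint A × OnePoint B) => Φ q.1 q.2) {z : Z}
    (h1 : ∀ p y, Φ p (∞, y) = z) (h2 : ∀ p x, Φ p (x, ∞) = z) {r : C → A × B}
    (hr : Continuous r)
    (hp : ∀ (KA : Set A) (KB : Set B), IsCompact KA → IsCompact KB →
      ∃ KC : Set C, IsClosed KC ∧ IsCompact KC ∧ ∀ c, (r c).1 ∈ KA → (r c).2 ∈ KB → c ∈ KC) :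
    Continuous fun q : P × OnePoint C =>
      q.2.elim z fun c => Φ q.1 (((r c).1 : OnePoint A), ((r c).2 : OnePoint B)) := by
  -- Currying moves the parameter into the target $C(P,Z)$, where the version without parameters
  -- applies. Local compactness of $P$ is needed for uncurrying.
  let F : C(OnePoint A × OnePoint B, C(P, Z)) :=
    ContinuousMap.curry ⟨fun q => Φ q.2 q.1, hΦ.comp continuous_swap⟩
  have hF := continuous_elim_of_smash (Φ := F) F.continuous (z := ContinuousMap.const P z)
    (fun y => ContinuousMap.ext fun p => h1 p y) (fun x => ContinuousMap.ext fun p => h2 p x)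
    hr hp
  have hG := (ContinuousMap.continuous_uncurry_of_continuous ⟨_, hF⟩).comp
    (continuous_swap (X := P) (Y := OnePoint C))
  convert hG using 1
  ext ⟨p, c⟩
  induction c using OnePoint.rec <;> rfl

/-- A proper family of maps, parametrised by a compact space, extends to the one-point
compactifications. -/
theorem continuous_onePointMap_family [CompactSpace P] {m : P → B → C}
    (hm : Continuous fun q : P × B => m q.1 q.2)
    (hp : ∀ K : Set C, IsClosed K → IsCompact K → ∃ KB : Set B, (IsClosed KB ∧ IsCompact KB) ∧
      ∀ p b, m p b ∈ K → b ∈ KB) :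
    Continuous fun q : P × OnePoint B => OnePoint.map (m q.1) q.2 := by
  have h := continuous_smashMap hm fun K hK hK' => by
    obtain ⟨KB, h1, h2⟩ := hp K hK hK'
    exact ⟨univ, KB, ⟨isClosed_univ, isCompact_univ⟩, h1, fun a b hab => ⟨mem_univ _, h2 a b hab⟩⟩
  have h' := h.comp ((continuous_coe.comp continuous_fst).prodMk
    (continuous_snd (X := P) (Y := OnePoint B)))
  convert h' using 1
  ext ⟨p, b⟩
  induction b using OnePoint.rec <;> rfl

/-- Continuity on a one-point compactification can be checked on the one-point compactifications
of two closed subsets that cover. -/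
theorem continuous_onePoint_of_cover [T2Space C] [WeaklyLocallyCompactSpace C]
    {S T : Set C} (hS : IsClosed S) (hT : IsClosed T)
    (hST : ∀ c, c ∈ S ∨ c ∈ T) {g : OnePoint C → Z}
    (h1 : Continuous fun c : OnePoint S => g (OnePoint.map Subtype.val c))
    (h2 : Continuous fun c : OnePoint T => g (OnePoint.map Subtype.val c)) : Continuous g := by
  have hv : ∀ S : Set C, IsClosed S →
      Continuous (OnePoint.map (Subtype.val : S → C)) := fun S hS =>
    OnePoint.continuous_map continuous_subtype_val
      (by
        rw [hasBasis_coclosedCompact.tendsto_right_iff]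
        rintro K ⟨hK, hK'⟩
        exact hasBasis_coclosedCompact.mem_of_mem ⟨hK.preimage continuous_subtype_val,
          hS.isClosedEmbedding_subtypeVal.isCompact_preimage hK'⟩)
  -- A continuous surjection from a compact space to a Hausdorff space is a quotient map. The
  -- inclusions extend to `∞` because closed embeddings are proper.
  have hq : IsQuotientMap (Sum.elim (OnePoint.map (Subtype.val : S → C))
      (OnePoint.map (Subtype.val : T → C))) := by
    refine IsQuotientMap.of_surjective_continuous ?_ ((hv S hS).sumElim (hv T hT))
    intro c
    induction c using OnePoint.rec with
    | infty => exact ⟨Sum.inl ∞, rfl⟩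
    | coe c =>
      rcases hST c with h | h
      · exact ⟨Sum.inl ((⟨c, h⟩ : S) : OnePoint S), rfl⟩
      · exact ⟨Sum.inr ((⟨c, h⟩ : T) : OnePoint T), rfl⟩
  rw [hq.continuous_iff, continuous_sum_dom]
  exact ⟨h1, h2⟩

end Families

/-! ### Homotopies of maps from spheres -/

namespace OrthSpectrum

variable {G : Type*} [Group G]

namespace SphereMap

variable {H : Subgroup G} {m : ℕ} {E F : OrthSpectrum G}

/-- The pointed equivariant maps among the continuous ones. -/
def IsAdmissible (H : Subgroup G) {m : ℕ} (E : OrthSpectrum G) (V : OrthRep G)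
    (f : C(OnePoint (V × Eucl m), E.X V)) : Prop :=
  f ∞ = E.pt V ∧ ∀ h ∈ H, ∀ (v : V) (t : Eucl m),
    f ((V.ρ h v, t) : V × Eucl m) = h • f ((v, t) : V × Eucl m)

/-- The underlying continuous map. -/
def toContinuousMap {V : OrthRep G} (f : SphereMap H m E V) : C(OnePoint (V × Eucl m), E.X V) :=
  ⟨f.toFun, f.continuous_toFun⟩

theorem isAdmissible {V : OrthRep G} (f : SphereMap H m E V) :
    IsAdmissible H E V f.toContinuousMap := ⟨f.map_infty, f.map_smul⟩

/-- Homotopies through admissible maps are an instance of `ContinuousMap.HomotopicWith`, from which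
reflexivity, symmetry and transitivity are inherited. -/
theorem homotopic_iff {V : OrthRep G} {f g : SphereMap H m E V} :
    f.Homotopic g ↔
      f.toContinuousMap.HomotopicWith g.toContinuousMap (IsAdmissible H E V) := by
  constructor
  · rintro ⟨K, rfl, rfl, hK⟩
    exact ⟨⟨⟨⟨_, hK⟩, fun _ => rfl, fun _ => rfl⟩, fun t => (K t).isAdmissible⟩⟩
  · rintro ⟨K⟩
    refine ⟨fun t => ⟨fun x => K (t, x), K.continuous.comp (by fun_prop), (K.prop' t).1,
      (K.prop' t).2⟩, ?_, ?_, K.continuous⟩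
    · ext x; exact K.apply_zero x
    · ext x; exact K.apply_one x

theorem Homotopic.refl {V : OrthRep G} (f : SphereMap H m E V) : f.Homotopic f :=
  homotopic_iff.2 (.refl _ f.isAdmissible)

theorem Homotopic.symm {V : OrthRep G} {f g : SphereMap H m E V} (h : f.Homotopic g) :
    g.Homotopic f := homotopic_iff.2 (homotopic_iff.1 h).symm

theorem Homotopic.trans {V : OrthRep G} {f g k : SphereMap H m E V} (h : f.Homotopic g)
    (h' : g.Homotopic k) : f.Homotopic k :=
  homotopic_iff.2 ((homotopic_iff.1 h).trans (homotopic_iff.1 h'))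

end SphereMap

end OrthSpectrum

/-! ### The colimit over subrepresentations -/

namespace SubRep

variable {G : Type*} [Group G] {U : UnivRep G}

theorem proj_of_le {V W : SubRep U} (h : V.space ≤ W.space) (v : V.toRep) :
    proj V W (inclInto h v) = v :=
  V.incl_injective (Submodule.starProjection_eq_self_iff.2 v.2)

theorem proj_self (V : SubRep U) (v : V.toRep) : proj V V v = v := proj_of_le le_rfl v

theorem proj_proj {V W X : SubRep U} (h : V.space ≤ W.space) (x : X.toRep) :
    proj V W (proj W X x) = proj V X x := by
  apply V.incl_injective
  refine (Submodule.eq_starProjection_of_mem_of_inner_eq_zero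
    (Submodule.starProjection_apply_mem _ _) fun y hy => ?_).symm
  have h1 := Submodule.starProjection_inner_eq_zero (K := W.space) (X.incl x) y (h hy)
  have h2 := Submodule.starProjection_inner_eq_zero (K := V.space)
    (W.space.starProjection (X.incl x)) y hy
  rw [inner_sub_left] at h1 h2 ⊢
  change inner ℝ (X.incl x) y -
    inner ℝ (V.space.starProjection (W.space.starProjection (X.incl x))) y = 0
  linarith

theorem jInto_self (V : SubRep U) (v : V.toRep) : jInto (le_refl V.space) v = JPt.id V.toRep := by
  apply JPt.ext
  · rfl
  · change v - inclInto _ (proj V V v) = 0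
    rw [proj_self]
    exact sub_self v

theorem jInto_comp {V W X : SubRep U} (h : V.space ≤ W.space) (h' : W.space ≤ X.space)
    (x : X.toRep) :
    (jInto h' x).comp (jInto h (proj W X x)) = jInto (h.trans h') x := by
  apply JPt.ext
  · rfl
  · change inclInto h' (proj W X x - inclInto h (proj V W (proj W X x))) +
      (x - inclInto h' (proj W X x)) = x - inclInto _ (proj V X x)
    rw [proj_proj h, map_sub]
    change inclInto h' (proj W X x) - inclInto (h.trans h') (proj V X x) +
      (x - inclInto h' (proj W X x)) = x - inclInto _ (proj V X x)
    abel

/-- The sum of two finite dimensional subrepresentations. -/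
def sup (V W : SubRep U) : SubRep U where
  space := V.space ⊔ W.space
  finDim := inferInstance
  invariant g x hx := by
    obtain ⟨v, hv, w, hw, rfl⟩ := Submodule.mem_sup.1 hx
    rw [map_add]
    exact Submodule.add_mem_sup (V.invariant g v hv) (W.invariant g w hw)

end SubRep

namespace OrthSpectrum

variable {G : Type*} [Group G] {U : UnivRep G} {H : Subgroup G} {m : ℕ} {E F : OrthSpectrum G}

namespace SphereMap

theorem stab_self {V : SubRep U} (f : SphereMap H m E V.toRep) :
    f.stab (le_refl V.space) = f := by
  ext x
  induction x using OnePoint.rec with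
  | infty => exact f.map_infty.symm
  | coe p =>
    change E.act (OnePoint.some (SubRep.jInto _ p.1)) (f.toFun _) = _
    rw [SubRep.jInto_self, SubRep.proj_self]
    exact E.act_id _

theorem stab_stab {V W X : SubRep U} (h : V.space ≤ W.space) (h' : W.space ≤ X.space)
    (f : SphereMap H m E V.toRep) : (f.stab h).stab h' = f.stab (h.trans h') := by
  ext x
  induction x using OnePoint.rec with
  | infty => rfl
  | coe p =>
    change E.act (OnePoint.some (SubRep.jInto h' p.1)) (E.act (OnePoint.some
      (SubRep.jInto h (SubRep.proj W X p.1))) (f.toFun _)) =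
      E.act (OnePoint.some (SubRep.jInto _ p.1)) (f.toFun _)
    rw [← E.act_comp, SubRep.jInto_comp, SubRep.proj_proj h]

/-- The smash product argument for a single stabilised map works uniformly in the homotopy
parameter, since `I` is locally compact. -/
theorem Homotopic.stab {V W : SubRep U} (h : V.space ≤ W.space) {f g : SphereMap H m E V.toRep}
    (hfg : f.Homotopic g) : (f.stab h).Homotopic (g.stab h) := by
  obtain ⟨K, rfl, rfl, hK⟩ := hfg
  refine ⟨fun t => (K t).stab h, rfl, rfl, ?_⟩
  refine continuous_elim_of_smash_family (A := JPt V.toRep W.toRep) (B := V.toRep × Eucl m)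
    (C := W.toRep × Eucl m) (Φ := fun t p => E.act p.1 ((K t).toFun p.2))
    ((E.continuous_act V.toRep W.toRep).comp ((continuous_fst.comp continuous_snd).prodMk
      (hK.comp (continuous_fst.prodMk (continuous_snd.comp continuous_snd)))))
    (z := E.pt W.toRep) (fun _ _ => E.act_infty _)
    (fun t x => by simp only [(K t).map_infty]; exact E.act_pt x)
    (r := fun c => (SubRep.jInto h c.1, (SubRep.proj V W c.1, c.2)))
    (((continuous_jInto h).comp continuous_fst).prodMk
      (((continuous_proj V W).comp continuous_fst).prodMk continuous_snd)) ?_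
  intro KA KB hA hB
  obtain ⟨a, ha⟩ := (hA.image JPt.continuous_vec).isBounded.exists_norm_le
  obtain ⟨b, hb⟩ := hB.isBounded.exists_norm_le
  have : ProperSpace (W.toRep × Eucl m) := FiniteDimensional.proper ℝ _
  -- A vector $w$ is the sum of its component orthogonal to $V$, bounded by `a`, and its projection
  -- to $V$, bounded by `b`.
  refine ⟨Metric.closedBall 0 (max (a + b) b), Metric.isClosed_closedBall,
    isCompact_closedBall _ _, ?_⟩
  rintro ⟨w, t⟩ h1 h2
  have h3 : ‖(SubRep.jInto h w).vec‖ ≤ a := ha _ (mem_image_of_mem _ h1)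
  have h4 := hb _ h2
  simp only [Prod.norm_def, sup_le_iff] at h4
  have h5 : ‖w‖ ≤ a + b := by
    have e : w = (SubRep.jInto h w).vec + SubRep.inclInto h (SubRep.proj V W w) :=
      (sub_add_cancel _ _).symm
    rw [e]
    refine (norm_add_le _ _).trans (add_le_add h3 ?_)
    rw [LinearIsometry.norm_map]
    exact h4.1
  simp only [Metric.mem_closedBall, dist_zero_right, Prod.norm_def]
  exact max_le_max h5 h4.2

end SphereMap

/-- The system of subrepresentations is directed: given two homotopies over $W$ and $W'$ that share
a middle map, both can be stabilised to $W+W'$ and concatenated there. Hence the equivalence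
relation generated by `StabRel` reduces to a single homotopy at a common stage. -/
theorem stableMaps_exact {a b : Σ V : SubRep U, SphereMap H m E V.toRep}
    (hab : Quot.mk (StabRel U H m E) a = Quot.mk (StabRel U H m E) b) :
    ∃ (W : SubRep U) (ha : a.1.space ≤ W.space) (hb : b.1.space ≤ W.space),
      (a.2.stab ha).Homotopic (b.2.stab hb) := by
  induction Quot.eqvGen_exact hab with
  | rel a b h =>
    obtain ⟨h, hh⟩ := h
    refine ⟨b.1, h, le_rfl, ?_⟩
    rwa [SphereMap.stab_self]
  | refl a => exact ⟨a.1, le_rfl, le_rfl, .refl _⟩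
  | symm a b _ ih =>
    obtain ⟨W, ha, hb, h⟩ := ih (Quot.eqvGen_sound ‹_›)
    exact ⟨W, hb, ha, h.symm⟩
  | trans a b c _ _ ih1 ih2 =>
    obtain ⟨W, ha, hb, h⟩ := ih1 (Quot.eqvGen_sound ‹_›)
    obtain ⟨W', hb', hc, h'⟩ := ih2 (Quot.eqvGen_sound ‹_›)
    have hW : W.space ≤ (W.sup W').space := le_sup_left
    have hW' : W'.space ≤ (W.sup W').space := le_sup_right
    refine ⟨W.sup W', ha.trans hW, hc.trans hW', ?_⟩
    have h1 := h.stab hW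
    have h2 := h'.stab hW'
    rw [SphereMap.stab_stab, SphereMap.stab_stab] at h1 h2
    exact h1.trans h2

theorem stableMaps_stab {V W : SubRep U} (h : V.space ≤ W.space)
    (f : SphereMap H m E V.toRep) :
    Quot.mk (StabRel U H m E) ⟨V, f⟩ = Quot.mk (StabRel U H m E) ⟨W, f.stab h⟩ :=
  Quot.sound ⟨h, .refl _⟩

end OrthSpectrum

end

section

/-! ### The coordinate of `ℝ¹` -/

/-- The point of `ℝ¹` with coordinate `s`. -/
def line (s : ℝ) : Eucl 1 := WithLp.toLp 2 fun _ => s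

@[simp] theorem line_apply (s : ℝ) (i : Fin 1) : line s i = s := rfl

theorem eq_line (y : Eucl 1) : y = line (y 0) := by
  ext i
  rw [Subsingleton.elim i 0]; rfl

@[simp] theorem line_zero : line 0 = 0 := rfl

theorem line_add (s t : ℝ) : line (s + t) = line s + line t := rfl

theorem line_smul (c s : ℝ) : line (c * s) = c • line s := rfl

@[simp] theorem inner_line (s t : ℝ) : inner ℝ (line s) (line t) = s * t := by
  rw [EuclideanSpace.inner_eq_star_dotProduct]
  simp [dotProduct, line, mul_comm]

@[simp] theorem norm_line (s : ℝ) : ‖line s‖ = |s| := by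
  rw [EuclideanSpace.norm_eq]
  simp [Real.sqrt_sq_eq_abs]

theorem continuous_line : Continuous line :=
  (PiLp.continuous_toLp 2 _).comp (continuous_pi fun _ => continuous_id)

theorem JPt.norm_toLp_line {V : Type} [NormedAddCommGroup V]
    [InnerProductSpace ℝ V] (s : ℝ) : ‖(WithLp.toLp 2 (0, line s) : AddE V 1)‖ = |s| := by
  rw [← sq_eq_sq₀ (norm_nonneg _) (abs_nonneg _), WithLp.prod_norm_sq_eq_of_L2]
  simp

namespace JPt

variable {V W : Type} [NormedAddCommGroup V] [InnerProductSpace ℝ V]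
  [NormedAddCommGroup W] [InnerProductSpace ℝ W]

/-- A family of morphisms whose vectors tend to infinity with the parameter extends to
`OnePoint ℝ`. -/
theorem continuous_map_family {P : Type*} [TopologicalSpace P] [CompactSpace P]
    {j : P → ℝ → JPt V W} (hj : Continuous fun q : P × ℝ => j q.1 q.2)
    (hs : ∀ p s, |s| ≤ ‖(j p s).vec‖) :
    Continuous fun q : P × OnePoint ℝ => OnePoint.map (j q.1) q.2 := by
  refine continuous_onePointMap_family hj fun K _ hK => ?_
  obtain ⟨r, hr⟩ := (hK.image continuous_vec).isBounded.exists_norm_le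
  refine ⟨Metric.closedBall 0 r, ⟨Metric.isClosed_closedBall, isCompact_closedBall _ _⟩,
    fun p s h => ?_⟩
  rw [mem_closedBall_zero_iff, Real.norm_eq_abs]
  exact (hs p s).trans (hr _ (mem_image_of_mem _ h))

/-- The morphism `V → V ⊕ ℝ` given by the inclusion and the vector `(0, s)`. -/
def sigma (V : Type) [NormedAddCommGroup V] [InnerProductSpace ℝ V] (s : ℝ) :
    JPt V (AddE V 1) where
  emb := inclE V 1
  vec := WithLp.toLp 2 (0, line s)
  orth x := by simp [WithLp.prod_inner_apply]

theorem continuous_sigma [FiniteDimensional ℝ V] : Continuous (sigma V) :=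
  continuous_of_apply (fun _ => continuous_const)
    (continuous_toLp continuous_const continuous_line)

end JPt

theorem JPt.conj_sigma {G : Type*} [Group G] (V : OrthRep G) (g : G) (s : ℝ) :
    JPt.conj (V := V) (W := V.add 1) g (JPt.sigma V s) = JPt.sigma V s := by
  apply JPt.ext
  · ext x
    refine AddE.ext ?_ rfl
    change V.ρ g (V.ρ g⁻¹ x) = x
    rw [map_inv]; exact (V.ρ g).apply_symm_apply _
  · exact AddE.ext (map_zero (V.ρ g)) rfl

/-! ### One-dimensional extensions of subrepresentations -/

namespace SubRep

variable {G : Type*} [Group G] {U : UnivRep G}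

/-- The subrepresentation `W` is the orthogonal sum of `V` and a fixed line. -/
structure LineExt (V W : SubRep U) where
  le : V.space ≤ W.space
  e : W.toRep
  norm_e : ‖e‖ = 1
  fixed : ∀ g, W.toRep.ρ g e = e
  orth : ∀ v, inner ℝ (SubRep.inclInto le v) e = 0
  decomp : ∀ w, w - SubRep.inclInto le (SubRep.proj V W w) = (inner ℝ e w : ℝ) • e

/-- A trivial representation of dimension $\dim V+1$ embeds in $\mathcal U$ and is too large to
project injectively to $V$. A nonzero vector in the kernel of the projection is fixed by $G$ and
orthogonal to $V$; its normalisation spans the new line. -/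
theorem exists_lineExt (V : SubRep U) :
    ∃ W : SubRep U, Nonempty (LineExt V W) := by
  let T : OrthRep G := { carrier := Eucl (Module.finrank ℝ V.space + 1), ρ := 1 }
  obtain ⟨φ, hφ⟩ := U.universal T
  have hker : LinearMap.ker ((V.space.orthogonalProjectionOnto : U →L[ℝ] V.space).toLinearMap.comp
      φ.toLinearMap) ≠ ⊥ := by
    refine LinearMap.ker_ne_bot_of_finrank_lt ?_
    change _ < Module.finrank ℝ (Eucl (Module.finrank ℝ V.space + 1))
    rw [finrank_euclideanSpace_fin]
    exact Nat.lt_succ_self _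
  obtain ⟨x, hx, hx0⟩ := (Submodule.ne_bot_iff _).1 hker
  have hx' : V.space.orthogonalProjectionOnto (φ x) = 0 := hx
  have hperp : φ x ∈ V.spaceᗮ := Submodule.orthogonalProjectionOnto_eq_zero_iff.1 hx'
  have hnorm : ‖φ x‖ ≠ 0 := by
    rw [φ.norm_map]; exact norm_ne_zero_iff.2 hx0
  set e : U := ‖φ x‖⁻¹ • φ x with he
  have he1 : ‖e‖ = 1 := by
    rw [he, norm_smul, norm_inv, norm_norm, inv_mul_cancel₀ hnorm]
  have hfix : ∀ g, U.ρ g e = e := fun g => by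
    rw [he, _root_.map_smul, ← hφ]; rfl
  have heV : e ∈ V.spaceᗮ := Submodule.smul_mem _ _ hperp
  let L : SubRep U :=
    { space := ℝ ∙ e
      finDim := inferInstance
      invariant := fun g y hy => by
        obtain ⟨c, rfl⟩ := Submodule.mem_span_singleton.1 hy
        rw [_root_.map_smul, hfix]; exact hy }
  have hle : V.space ≤ (V.sup L).space := le_sup_left
  have heW : e ∈ (V.sup L).space :=
    (le_sup_right : L.space ≤ _) (Submodule.mem_span_singleton_self e)
  refine ⟨V.sup L, ⟨⟨hle, ⟨e, heW⟩, he1, fun g => ?_, fun v => heV v.1 v.2, fun w => ?_⟩⟩⟩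
  · exact (V.sup L).incl_injective (hfix g)
  · apply (V.sup L).incl_injective
    change w.1 - V.space.starProjection w.1 = (inner ℝ e w.1 : ℝ) • e
    obtain ⟨v, hv, y, hy, hw⟩ := Submodule.mem_sup.1 w.2
    obtain ⟨c, rfl⟩ := Submodule.mem_span_singleton.1 hy
    rw [← hw, map_add, Submodule.starProjection_eq_self_iff.2 hv, _root_.map_smul,
      (Submodule.starProjection_apply_eq_zero_iff _).2 heV, inner_add_right, inner_smul_right,
      real_inner_self_eq_norm_sq, he1, (Submodule.mem_orthogonal' _ _).1 heV v hv]
    simp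

namespace LineExt

variable {V W : SubRep U} (D : LineExt V W)

/-- The isometry `(V ⊕ ℝⁿ) ⊕ ℝ → W ⊕ ℝⁿ`, `((v, x), s) ↦ (v + s e, x)`. -/
def isom (n : ℕ) : AddE (AddE V.toRep n) 1 →ₗᵢ[ℝ] AddE W.toRep n where
  toFun x := WithLp.toLp 2 (inclInto D.le x.fst.fst + x.snd 0 • D.e, x.fst.snd)
  map_add' x y := by
    refine AddE.ext ?_ rfl
    change inclInto D.le (x.fst.fst + y.fst.fst) + (x.snd 0 + y.snd 0) • D.e = _
    rw [map_add, add_smul]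
    exact add_add_add_comm _ _ _ _
  map_smul' c x := by
    refine AddE.ext ?_ rfl
    change inclInto D.le (c • x.fst.fst) + (c • x.snd 0) • D.e = c • _
    rw [_root_.map_smul, smul_assoc, ← smul_add]
    rfl
  norm_map' x := by
    change ‖(WithLp.toLp 2 (inclInto D.le x.fst.fst + x.snd 0 • D.e, x.fst.snd) :
      AddE W.toRep n)‖ = ‖x‖
    rw [← sq_eq_sq₀ (norm_nonneg _) (norm_nonneg _), WithLp.prod_norm_sq_eq_of_L2,
      WithLp.prod_norm_sq_eq_of_L2, WithLp.prod_norm_sq_eq_of_L2, eq_line x.snd]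
    simp only [WithLp.toLp_fst, WithLp.toLp_snd, norm_line, sq_abs, line_apply]
    rw [norm_add_sq_real, inner_smul_right, D.orth, norm_smul, D.norm_e, LinearIsometry.norm_map]
    simp
    ring

theorem conj_isom (n : ℕ) (g : G) :
    JPt.conj (V := (V.toRep.add n).add 1) (W := W.toRep.add n) g (JPt.ofIsom (D.isom n)) =
      JPt.ofIsom (D.isom n) := by
  apply JPt.ext
  · ext x
    refine AddE.ext ?_ rfl
    change W.toRep.ρ g (inclInto D.le (V.toRep.ρ g⁻¹ x.fst.fst) + x.snd 0 • D.e) =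
      inclInto D.le x.fst.fst + x.snd 0 • D.e
    rw [map_add, _root_.map_smul, D.fixed]
    congr 1
    apply W.incl_injective
    change U.ρ g (U.ρ g⁻¹ (V.incl x.fst.fst)) = V.incl x.fst.fst
    rw [map_inv]; exact (U.ρ g).apply_symm_apply _
  · exact map_zero ((W.toRep.add n).ρ g)

/-- The inclusion $V\subset W$ with the orthogonal component of $w$ factors as a suspension
coordinate $\langle e,w\rangle$ followed by the isometry $V\oplus\mathbf R\cong W$. This is why
stabilising by one fixed line is governed by the structure map alone. -/
theorem isom_comp_sigma (n : ℕ) (w : W.toRep) :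
    (JPt.ofIsom (D.isom n)).comp (JPt.sigma (AddE V.toRep n) (inner ℝ D.e w)) =
      (jInto D.le w).add n := by
  apply JPt.ext
  · ext x
    refine AddE.ext ?_ rfl
    change inclInto D.le x.fst + (0 : ℝ) • D.e = inclInto D.le x.fst
    rw [zero_smul, add_zero]
  · refine AddE.ext ?_ (add_zero _)
    change inclInto D.le 0 + (inner ℝ D.e w : ℝ) • D.e + 0 = w - inclInto D.le (proj V W w)
    rw [map_zero, zero_add, add_zero, D.decomp]

end LineExt

end SubRep

namespace OrthSpectrum

variable {G : Type*} [Group G]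

/-! ### Maps from a suspension -/

/-- Pointed equivariant maps `F(V) ∧ S¹ → E(W)`. -/
@[ext] structure SuspMap (F E : OrthSpectrum G) (V W : OrthRep G) where
  toFun : F.X V → OnePoint ℝ → E.X W
  continuous_toFun : Continuous fun p : F.X V × OnePoint ℝ => toFun p.1 p.2
  map_pt : ∀ s, toFun (F.pt V) s = E.pt W
  map_infty : ∀ x, toFun x ∞ = E.pt W
  map_smul : ∀ (g : G) x s, toFun (g • x) s = g • toFun x s

namespace SuspMap

variable {E F K : OrthSpectrum G} {V W : OrthRep G}

/-- Pointed equivariant homotopy. -/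
def Homotopic (f₀ f₁ : SuspMap F E V W) : Prop :=
  ∃ k : I → SuspMap F E V W, k 0 = f₀ ∧ k 1 = f₁ ∧
    Continuous fun q : I × (F.X V × OnePoint ℝ) => (k q.1).toFun q.2.1 q.2.2

/-- Composition with a morphism on the left. -/
def postcomp (φ : Hom E K) (f : SuspMap F E V W) : SuspMap F K V W where
  toFun x s := φ.app W (f.toFun x s)
  continuous_toFun := (φ.continuous_app W).comp f.continuous_toFun
  map_pt s := by rw [f.map_pt, φ.app_pt]
  map_infty x := by rw [f.map_infty, φ.app_pt]
  map_smul g x s := by rw [f.map_smul, φ.app_smul]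

/-- Composition with a morphism on the right. -/
def precomp (φ : Hom K F) (f : SuspMap F E V W) : SuspMap K E V W where
  toFun x s := f.toFun (φ.app V x) s
  continuous_toFun := f.continuous_toFun.comp
    (((φ.continuous_app V).comp continuous_fst).prodMk continuous_snd)
  map_pt s := by rw [φ.app_pt, f.map_pt]
  map_infty x := f.map_infty _
  map_smul g x s := by rw [φ.app_smul, f.map_smul]

/-- The action of a family of invariant morphisms, parametrised by `ℝ`. -/
def ofFamily (E : OrthSpectrum G) (j : ℝ → JPt V W) (hj : Continuous j)
    (hs : ∀ s, |s| ≤ ‖(j s).vec‖) (hg : ∀ (g : G) s, (j s).conj g = j s) : SuspMap E E V W where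
  toFun x s := E.act (OnePoint.map j s) x
  continuous_toFun := by
    have h : Continuous (OnePoint.map j : OnePoint ℝ → _) :=
      (JPt.continuous_map_family (P := Unit) (j := fun _ => j) (hj.comp continuous_snd)
        fun _ => hs).comp (continuous_const.prodMk continuous_id : Continuous fun s => ((), s))
    exact (E.continuous_act V W).comp ((h.comp continuous_snd).prodMk continuous_fst)
  map_pt s := E.act_pt _
  map_infty x := E.act_infty x
  map_smul g x s := by
    induction s using OnePoint.rec with
    | infty =>
      change E.act ∞ _ = g • E.act ∞ _
      rw [E.act_infty, E.act_infty, E.smul_pt]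
    | coe s =>
      change E.act (OnePoint.some (j s)) _ = g • E.act (OnePoint.some (j s)) _
      rw [E.smul_act, hg]

/-- The structure map `E(V) ∧ S¹ → E(V ⊕ ℝ)`. -/
def structMap (E : OrthSpectrum G) (V : OrthRep G) : SuspMap E E V (V.add 1) :=
  ofFamily E (W := V.add 1) (JPt.sigma V) JPt.continuous_sigma
    (fun s => (JPt.norm_toLp_line s).ge) (JPt.conj_sigma V)

end SuspMap

open SubRep

namespace SuspMap

variable {U : UnivRep G} {H : Subgroup G} {m n : ℕ} {E F K : OrthSpectrum G} {V W : SubRep U}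
  (D : V.LineExt W)

/-- The underlying function of `SuspMap.apply`. -/
def applyFun (ψ : SuspMap F E (V.toRep.add n) ((V.toRep.add n).add 1))
    (f : SphereMap H m (F.shift n) V.toRep) (x : OnePoint (W.toRep × Eucl m)) :
    (E.shift n).X W.toRep :=
  x.elim ((E.shift n).pt W.toRep) fun p =>
    E.act (V := (V.toRep.add n).add 1) (W := W.toRep.add n) (OnePoint.some (JPt.ofIsom (D.isom n)))
      (ψ.toFun (f.toFun (OnePoint.some (proj V W p.1, p.2))) (OnePoint.some (inner ℝ D.e p.1)))

/-- The parameter space serves twice: a point gives continuity of a single map, the interval gives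
homotopies. -/
theorem continuous_applyFun {P : Type*} [TopologicalSpace P] [LocallyCompactSpace P]
    (ψ : P → SuspMap F E (V.toRep.add n) ((V.toRep.add n).add 1))
    (f : P → SphereMap H m (F.shift n) V.toRep)
    (hψ : Continuous fun q : P × (F.X (V.toRep.add n) × OnePoint ℝ) =>
      (ψ q.1).toFun q.2.1 q.2.2)
    (hf : Continuous fun q : P × OnePoint (V.toRep × Eucl m) => (f q.1).toFun q.2) :
    Continuous fun q : P × OnePoint (W.toRep × Eucl m) => applyFun D (ψ q.1) (f q.1) q.2 := by
  refine continuous_elim_of_smash_family (A := V.toRep × Eucl m) (B := ℝ) (C := W.toRep × Eucl m)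
    (Φ := fun t p => E.act (V := (V.toRep.add n).add 1) (W := W.toRep.add n)
      (OnePoint.some (JPt.ofIsom (D.isom n))) ((ψ t).toFun ((f t).toFun p.1) p.2))
    ((E.continuous_act ((V.toRep.add n).add 1) (W.toRep.add n)).comp
      (continuous_const.prodMk (hψ.comp (continuous_fst.prodMk ((hf.comp
        (continuous_fst.prodMk (continuous_fst.comp continuous_snd))).prodMk
          (continuous_snd.comp continuous_snd))))))
    (z := (E.shift n).pt W.toRep) (fun t y => ?_) (fun t x => ?_)
    (r := fun c => ((proj V W c.1, c.2), inner ℝ D.e c.1))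
    ((((continuous_proj V W).comp continuous_fst).prodMk continuous_snd).prodMk
      (continuous_const.inner continuous_fst)) ?_
  · simp only [(f t).map_infty]
    exact (congrArg _ ((ψ t).map_pt y)).trans (E.act_pt _)
  · exact (congrArg _ ((ψ t).map_infty _)).trans (E.act_pt _)
  intro KA KB hA hB
  obtain ⟨a, ha⟩ := hA.isBounded.exists_norm_le
  obtain ⟨b, hb⟩ := hB.isBounded.exists_norm_le
  have : ProperSpace (W.toRep × Eucl m) := FiniteDimensional.proper ℝ _
  -- Here $w=\langle e,w\rangle e+\mathrm{proj}_V w$, with the first summand bounded by `b` and the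
  -- second by `a`.
  refine ⟨Metric.closedBall 0 (max (b + a) a), Metric.isClosed_closedBall,
    isCompact_closedBall _ _, ?_⟩
  rintro ⟨w, t⟩ h1 h2
  have h3 := hb _ h2
  have h4 := ha _ h1
  simp only [Prod.norm_def, sup_le_iff] at h4
  have h5 : ‖w‖ ≤ b + a := by
    have e : w = (inner ℝ D.e w : ℝ) • D.e + inclInto D.le (proj V W w) := by
      rw [← D.decomp, sub_add_cancel]
    rw [e]
    refine (norm_add_le _ _).trans (add_le_add ?_ ?_)
    · rwa [norm_smul, D.norm_e, mul_one]
    · rw [LinearIsometry.norm_map]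
      exact h4.1
  simp only [Metric.mem_closedBall, dist_zero_right, Prod.norm_def]
  exact max_le_max h5 h4.2

/-- Postcomposition of the suspension of a map `S^{V ⊕ ℝᵐ} → F(V ⊕ ℝⁿ)` with `ψ`. -/
def apply (ψ : SuspMap F E (V.toRep.add n) ((V.toRep.add n).add 1))
    (f : SphereMap H m (F.shift n) V.toRep) : SphereMap H m (E.shift n) W.toRep where
  toFun := applyFun D ψ f
  continuous_toFun := (continuous_applyFun (P := Unit) D (fun _ => ψ) (fun _ => f)
    (ψ.continuous_toFun.comp continuous_snd) (f.continuous_toFun.comp continuous_snd)).comp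
      (continuous_const.prodMk continuous_id : Continuous fun x => ((), x))
  map_infty := rfl
  map_smul g hg w t := by
    have h1 : (inner ℝ D.e (W.toRep.ρ g w) : ℝ) = inner ℝ D.e w := by
      conv_lhs => rw [← D.fixed g]
      exact LinearIsometryEquiv.inner_map_map _ _ _
    have h2 : f.toFun (OnePoint.some (V.toRep.ρ g (proj V W w), t)) =
        g • f.toFun (OnePoint.some (proj V W w, t)) := f.map_smul g hg _ _
    have h3 : ψ.toFun (f.toFun (OnePoint.some (proj V W (W.toRep.ρ g w), t)))
        (OnePoint.some (inner ℝ D.e (W.toRep.ρ g w))) =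
        g • ψ.toFun (f.toFun (OnePoint.some (proj V W w, t))) (OnePoint.some (inner ℝ D.e w)) := by
      rw [h1, proj_ρ, h2]
      exact ψ.map_smul g _ _
    refine (congrArg _ h3).trans ?_
    refine Eq.trans ?_ (E.smul_act (V := (V.toRep.add n).add 1) (W := W.toRep.add n) g _ _).symm
    rw [D.conj_isom]
    rfl

variable {D}

theorem Homotopic.apply {ψ ψ' : SuspMap F E (V.toRep.add n) ((V.toRep.add n).add 1)}
    (hψ : ψ.Homotopic ψ') {f f' : SphereMap H m (F.shift n) V.toRep} (hf : f.Homotopic f') :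
    (ψ.apply D f).Homotopic (ψ'.apply D f') := by
  obtain ⟨k, rfl, rfl, hk⟩ := hψ
  obtain ⟨l, rfl, rfl, hl⟩ := hf
  exact ⟨fun t => (k t).apply D (l t), rfl, rfl, continuous_applyFun D k l hk hl⟩

theorem apply_homotopic_right (ψ : SuspMap F E (V.toRep.add n) ((V.toRep.add n).add 1))
    {f f' : SphereMap H m (F.shift n) V.toRep} (hf : f.Homotopic f') :
    (ψ.apply D f).Homotopic (ψ.apply D f') :=
  Homotopic.apply ⟨fun _ => ψ, rfl, rfl, ψ.continuous_toFun.comp continuous_snd⟩ hf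

/-- Generated equivalence suffices for suspension maps, because homotopy of the resulting sphere
maps is already known to be an equivalence relation. -/
theorem apply_homotopic_left {ψ ψ' : SuspMap F E (V.toRep.add n) ((V.toRep.add n).add 1)}
    (hψ : Relation.EqvGen Homotopic ψ ψ') (f : SphereMap H m (F.shift n) V.toRep) :
    (ψ.apply D f).Homotopic (ψ'.apply D f) := by
  induction hψ with
  | rel _ _ h => exact h.apply (.refl f)
  | refl _ => exact .refl _
  | symm _ _ _ ih => exact ih.symm
  | trans _ _ _ _ _ ih1 ih2 => exact ih1.trans ih2

theorem apply_structMap (f : SphereMap H m (E.shift n) V.toRep) :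
    (structMap E (V.toRep.add n)).apply D f = f.stab D.le := by
  ext x
  induction x using OnePoint.rec with
  | infty => rfl
  | coe p =>
    refine (E.act_comp (V := V.toRep.add n) (W := (V.toRep.add n).add 1) (Z := W.toRep.add n)
      (JPt.ofIsom (D.isom n)) (JPt.sigma _ (inner ℝ D.e p.1)) _).symm.trans ?_
    refine congrArg (fun j : JPt (V.toRep.add n) (W.toRep.add n) =>
      E.act (V := V.toRep.add n) (W := W.toRep.add n) (OnePoint.some j) _) ?_
    exact D.isom_comp_sigma n p.1

theorem apply_postcomp (φ : Hom E K) (ψ : SuspMap F E (V.toRep.add n) ((V.toRep.add n).add 1))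
    (f : SphereMap H m (F.shift n) V.toRep) :
    (ψ.postcomp φ).apply D f = (ψ.apply D f).map (φ.shift n) := by
  ext x
  induction x using OnePoint.rec with
  | infty => exact ((φ.shift n).app_pt W.toRep).symm
  | coe p => exact (φ.app_act (V := (V.toRep.add n).add 1) (W := W.toRep.add n) _ _).symm

theorem apply_precomp (φ : Hom K F) (ψ : SuspMap F E (V.toRep.add n) ((V.toRep.add n).add 1))
    (f : SphereMap H m (K.shift n) V.toRep) :
    (ψ.precomp φ).apply D f = ψ.apply D (f.map (φ.shift n)) := rfl

end SuspMap

open SuspMap in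
/-- A morphism which is invertible up to homotopy and suspension at every representation is a
`π_*`-isomorphism. -/
theorem isPiIso_of_suspMap (U : UnivRep G) {E F : OrthSpectrum G} (φ : Hom E F)
    (h : ∀ V : OrthRep G, ∃ ψ : SuspMap F E V (V.add 1),
      Relation.EqvGen Homotopic (ψ.postcomp φ) (structMap F V) ∧
      Relation.EqvGen Homotopic (ψ.precomp φ) (structMap E V)) : IsPiIso U φ := by
  intro H k
  change Function.Bijective (stableMapsMap U H k.toNat (φ.shift (-k).toNat))
  -- The sign of $k$ plays no role from here on: the hypothesis is used at $V\oplus\mathbf R^n$,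
  -- which takes care of the shift.
  generalize k.toNat = m
  generalize (-k).toNat = n
  constructor
  · intro x y hxy
    induction x using Quot.ind with
    | mk a =>
    induction y using Quot.ind with
    | mk b =>
    obtain ⟨W, ha, hb, hab⟩ := stableMaps_exact hxy
    change SphereMap.Homotopic ((a.2.map (φ.shift n)).stab ha)
      ((b.2.map (φ.shift n)).stab hb) at hab
    rw [SphereMap.stab_map, SphereMap.stab_map] at hab
    obtain ⟨X, ⟨D⟩⟩ := W.exists_lineExt
    obtain ⟨ψ, -, h2⟩ := h (W.toRep.add n)
    -- Injectivity: over the extension $X$ of $W$ by a line, each stabilised map is homotopic to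
    -- $\psi\varphi$ applied to it, and $\psi$ preserves the given homotopy between the images under
    -- $\varphi$.
    have key : ((a.2.stab ha).stab D.le).Homotopic ((b.2.stab hb).stab D.le) := by
      rw [← apply_structMap (D := D), ← apply_structMap (D := D)]
      refine (apply_homotopic_left h2 _).symm.trans (.trans ?_ (apply_homotopic_left h2 _))
      rw [apply_precomp, apply_precomp]
      exact apply_homotopic_right ψ hab
    refine (stableMaps_stab ha a.2).trans (.trans ?_ (stableMaps_stab hb b.2).symm)
    exact (Quot.sound (r := StabRel U H m (E.shift n)) (a := ⟨W, a.2.stab ha⟩)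
      (b := ⟨X, (b.2.stab hb).stab D.le⟩) ⟨D.le, key⟩).trans (stableMaps_stab D.le _).symm
  · intro y
    induction y using Quot.ind with
    | mk b =>
    obtain ⟨V, f⟩ := b
    obtain ⟨W, ⟨D⟩⟩ := V.exists_lineExt
    obtain ⟨ψ, h1, -⟩ := h (V.toRep.add n)
    -- Surjectivity: $\psi$ applied to $f$ is a preimage, since $\varphi\psi$ applied to $f$ is
    -- homotopic to the stabilisation of $f$.
    refine ⟨Quot.mk _ ⟨W, ψ.apply D f⟩, (Quot.sound (r := StabRel U H m (F.shift n))
      (a := ⟨V, f⟩) (b := ⟨W, (ψ.apply D f).map (φ.shift n)⟩) ⟨D.le, ?_⟩).symm⟩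
    rw [← apply_postcomp, ← apply_structMap (D := D)]
    exact (apply_homotopic_left h1 f).symm

end OrthSpectrum

end

section

/-! ### Rotations towards a new coordinate -/

section Tilt

variable {X Y : Type} [NormedAddCommGroup X] [InnerProductSpace ℝ X]
  [NormedAddCommGroup Y] [InnerProductSpace ℝ Y]

/-- The radial retraction onto the closed unit ball. -/
def clamp (q : X) : X := (max 1 ‖q‖)⁻¹ • q

theorem norm_clamp_le (q : X) : ‖clamp q‖ ≤ 1 := by
  have h : 0 < max 1 ‖q‖ := lt_max_of_lt_left one_pos
  rw [clamp, norm_smul, norm_inv, Real.norm_of_nonneg h.le, inv_mul_le_one₀ h]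
  exact le_max_right _ _

theorem clamp_of_norm_le {q : X} (h : ‖q‖ ≤ 1) : clamp q = q := by
  rw [clamp, max_eq_left h, inv_one, one_smul]

theorem clamp_of_le_norm {q : X} (h : 1 ≤ ‖q‖) : clamp q = ‖q‖⁻¹ • q := by
  rw [clamp, max_eq_right h]

theorem continuous_clamp : Continuous (clamp : X → X) :=
  ((continuous_const.max continuous_norm).inv₀ fun _ =>
    (lt_max_of_lt_left one_pos).ne').smul continuous_id

theorem clamp_map (φ : X →ₗᵢ[ℝ] Y) (q : X) : clamp (φ q) = φ (clamp q) := by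
  rw [clamp, clamp, φ.norm_map, _root_.map_smul]

theorem clamp_mem {L : Submodule ℝ X} {q : X} (h : q ∈ L) : clamp q ∈ L := L.smul_mem _ h

/-- The cosine belonging to the sine `‖clamp q‖`. -/
def tiltCos (q : X) : ℝ := √(1 - ‖clamp q‖ ^ 2)

theorem tiltCos_nonneg (q : X) : 0 ≤ tiltCos q := Real.sqrt_nonneg _

theorem tiltCos_sq (q : X) : tiltCos q ^ 2 = 1 - ‖clamp q‖ ^ 2 :=
  Real.sq_sqrt (by nlinarith [norm_clamp_le q, norm_nonneg (clamp q)])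

theorem tiltCos_of_le_norm {q : X} (h : 1 ≤ ‖q‖) : tiltCos q = 0 := by
  have h0 : ‖q‖ ≠ 0 := (zero_lt_one.trans_le h).ne'
  rw [tiltCos, clamp_of_le_norm h, norm_smul, norm_inv, norm_norm, inv_mul_cancel₀ h0]
  simp

theorem continuous_tiltCos : Continuous (tiltCos : X → ℝ) :=
  Real.continuous_sqrt.comp (continuous_const.sub (continuous_clamp.norm.pow 2))

theorem tiltCos_map (φ : X →ₗᵢ[ℝ] Y) (q : X) : tiltCos (φ q) = tiltCos q := by
  rw [tiltCos, tiltCos, clamp_map, φ.norm_map]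

/-- The restriction to `X` of the rotation of `X ⊕ ℝ` in the plane spanned by `q` and the last
coordinate, by the angle with sine `‖clamp q‖`. -/
def tiltEmb (q : X) : X →ₗᵢ[ℝ] AddE X 1 where
  toFun x := WithLp.toLp 2 (x - (inner ℝ (clamp q) x / (1 + tiltCos q)) • clamp q,
    line (inner ℝ (clamp q) x))
  map_add' x y := by
    refine AddE.ext ?_ ?_
    · change x + y - (inner ℝ (clamp q) (x + y) / (1 + tiltCos q)) • clamp q = _
      rw [inner_add_right, add_div, add_smul]
      exact add_sub_add_comm _ _ _ _
    · change line (inner ℝ (clamp q) (x + y)) = _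
      rw [inner_add_right, line_add]; rfl
  map_smul' c x := by
    refine AddE.ext ?_ ?_
    · change c • x - (inner ℝ (clamp q) (c • x) / (1 + tiltCos q)) • clamp q =
        c • (x - (inner ℝ (clamp q) x / (1 + tiltCos q)) • clamp q)
      rw [inner_smul_right, mul_div_assoc, mul_smul, smul_sub]
    · change line (inner ℝ (clamp q) (c • x)) = _
      rw [inner_smul_right, line_smul]; rfl
  norm_map' x := by
    change ‖(WithLp.toLp 2 (x - (inner ℝ (clamp q) x / (1 + tiltCos q)) • clamp q,
      line (inner ℝ (clamp q) x)) : AddE X 1)‖ = ‖x‖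
    rw [← sq_eq_sq₀ (norm_nonneg _) (norm_nonneg _), WithLp.prod_norm_sq_eq_of_L2]
    simp only [WithLp.toLp_fst, WithLp.toLp_snd, norm_line, sq_abs]
    have hc : 1 + tiltCos q ≠ 0 := (add_pos_of_pos_of_nonneg one_pos (tiltCos_nonneg q)).ne'
    -- With $c$ the cosine, $p$ the clamped vector and $i=\langle p,x\rangle$, the correction to
    -- $|x|^2$ is $i^2\bigl(-\tfrac{2}{1+c}+\tfrac{1-c^2}{(1+c)^2}+1\bigr)=0$. Dividing by $1+c$
    -- instead of $|p|^2$ keeps the formula continuous at $q=0$.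
    have hp : ‖clamp q‖ ^ 2 = 1 - tiltCos q ^ 2 := by rw [tiltCos_sq]; ring
    rw [norm_sub_sq_real, inner_smul_right, norm_smul, mul_pow, hp, Real.norm_eq_abs, sq_abs,
      real_inner_comm]
    field_simp
    ring

theorem tiltEmb_apply (q x : X) : tiltEmb q x =
    WithLp.toLp 2 (x - (inner ℝ (clamp q) x / (1 + tiltCos q)) • clamp q,
      line (inner ℝ (clamp q) x)) := rfl

theorem tiltEmb_of_inner_eq_zero {q x : X} (h : inner ℝ q x = 0) :
    tiltEmb q x = WithLp.toLp 2 (x, 0) := by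
  have : inner ℝ (clamp q) x = 0 := by rw [clamp, inner_smul_left, h, mul_zero]
  rw [tiltEmb_apply, this, zero_div, zero_smul, sub_zero, line_zero]

/-- Stated for $0\cdot q$ because the rotations are taken along paths $c\mapsto c\cdot q$ that start
there. -/
theorem tiltEmb_zero_smul (q : X) : tiltEmb ((0 : ℝ) • q) = inclE X 1 :=
  LinearIsometry.ext fun x =>
    tiltEmb_of_inner_eq_zero (by rw [zero_smul, inner_zero_left])

/-- The rotation is built only from $q$, norms and inner products, so it commutes with isometries.
Equivariance of all later constructions rests on this. -/
theorem tiltEmb_map (φ : X →ₗᵢ[ℝ] Y) (q x : X) :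
    tiltEmb (φ q) (φ x) = addIsom φ 1 (tiltEmb q x) := by
  rw [tiltEmb_apply, tiltCos_map, clamp_map, φ.inner_map_map]
  refine AddE.ext ?_ rfl
  change _ = φ (x - (inner ℝ (clamp q) x / (1 + tiltCos q)) • clamp q)
  rw [map_sub, _root_.map_smul]
  rfl

/-- The morphism given by the rotation `tiltEmb` and the vector `-s`-times the image of the last
coordinate vector under the rotation. -/
def tilt (q : X) (s : ℝ) : JPt X (AddE X 1) where
  emb := tiltEmb q
  vec := WithLp.toLp 2 (s • clamp q, line (-(s * tiltCos q)))
  orth x := by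
    rw [tiltEmb_apply, WithLp.prod_inner_apply]
    simp only [inner_line, inner_smul_right, inner_sub_left, inner_smul_left]
    have hc : 1 + tiltCos q ≠ 0 := (add_pos_of_pos_of_nonneg one_pos (tiltCos_nonneg q)).ne'
    have hp : ‖clamp q‖ ^ 2 = 1 - tiltCos q ^ 2 := by rw [tiltCos_sq]; ring
    rw [real_inner_self_eq_norm_sq, hp, real_inner_comm]
    simp only [conj_trivial]
    field_simp
    ring

theorem tilt_vec (q : X) (s : ℝ) :
    (tilt q s).vec = WithLp.toLp 2 (s • clamp q, line (-(s * tiltCos q))) := rfl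

/-- The vector is $-s$ times a rotated unit vector. Its length is therefore independent of $q$,
which makes the family proper in $s$ and lets it extend to $s=\infty$. -/
theorem norm_tilt_vec (q : X) (s : ℝ) : ‖(tilt q s).vec‖ = |s| := by
  rw [← sq_eq_sq₀ (norm_nonneg _) (abs_nonneg _), tilt_vec, WithLp.prod_norm_sq_eq_of_L2]
  simp only [WithLp.toLp_fst, WithLp.toLp_snd, norm_line, sq_abs, norm_smul, mul_pow,
    Real.norm_eq_abs]
  have := tiltCos_sq q
  linear_combination s ^ 2 * this

theorem continuous_tilt [FiniteDimensional ℝ X] :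
    Continuous fun p : X × ℝ => tilt p.1 p.2 := by
  have h1 : Continuous fun p : X × ℝ => clamp p.1 := continuous_clamp.comp continuous_fst
  have h2 : Continuous fun p : X × ℝ => tiltCos p.1 := continuous_tiltCos.comp continuous_fst
  refine JPt.continuous_of_apply (fun x => ?_) ?_
  · have h3 : Continuous fun p : X × ℝ => (inner ℝ (clamp p.1) x : ℝ) :=
      h1.inner continuous_const
    exact JPt.continuous_toLp (continuous_const.sub ((h3.div (continuous_const.add h2)
      fun p => (add_pos_of_pos_of_nonneg one_pos (tiltCos_nonneg p.1)).ne').smul h1))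
      (continuous_line.comp h3)
  · exact JPt.continuous_toLp (continuous_snd.smul h1)
      (continuous_line.comp (continuous_snd.mul h2).neg)

theorem norm_clamp_of_le {q : X} (h : 1 ≤ ‖q‖) : ‖clamp q‖ = 1 := by
  rw [clamp_of_le_norm h, norm_smul, norm_inv, norm_norm,
    inv_mul_cancel₀ (zero_lt_one.trans_le h).ne']

/-- The cosine vanishes: this is the quarter turn, which replaces the component along the unit
vector of $q$ by the new coordinate. -/
theorem tiltEmb_of_le {q : X} (h : 1 ≤ ‖q‖) (x : X) : tiltEmb q x =
    WithLp.toLp 2 (x - (inner ℝ (clamp q) x : ℝ) • clamp q, line (inner ℝ (clamp q) x)) := by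
  rw [tiltEmb_apply, tiltCos_of_le_norm h, add_zero, div_one]

theorem tilt_vec_of_le {q : X} (h : 1 ≤ ‖q‖) (s : ℝ) :
    (tilt q s).vec = WithLp.toLp 2 (s • clamp q, 0) := by
  rw [tilt_vec, tiltCos_of_le_norm h, mul_zero, neg_zero, line_zero]

theorem ofIsom_comp_tilt (φ : X →ₗᵢ[ℝ] X) (q : X) (s : ℝ) :
    (JPt.ofIsom (addIsom φ 1)).comp (tilt q s) = (tilt (φ q) s).comp (JPt.ofIsom φ) := by
  apply JPt.ext
  · ext x
    exact (tiltEmb_map φ q x).symm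
  · rw [JPt.comp_vec, JPt.comp_vec, tilt_vec, tilt_vec, tiltCos_map, clamp_map]
    refine AddE.ext ?_ ?_ <;> simp

end Tilt

variable {G : Type*} [Group G]

theorem conj_tilt (X : OrthRep G) (g : G) (q : X) (s : ℝ) :
    JPt.conj (V := X) (W := X.add 1) g (tilt q s) = tilt (X.ρ g q) s := by
  have h := ofIsom_comp_tilt (X.isom g) q s
  apply JPt.ext
  · ext x
    have h1 := congrArg (fun j : JPt X (AddE X 1) => j.emb (X.ρ g⁻¹ x)) h
    refine Eq.trans h1 ?_
    change tiltEmb (X.ρ g q) (X.ρ g (X.ρ g⁻¹ x)) = tiltEmb (X.ρ g q) x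
    congr 1
    rw [map_inv]; exact (X.ρ g).apply_symm_apply _
  · have h2 := congrArg JPt.vec h
    rw [JPt.comp_vec, JPt.comp_vec, JPt.ofIsom_vec, JPt.ofIsom_vec, map_zero, add_zero,
      zero_add] at h2
    exact h2

/-- The last coordinate vector of `V ⊕ ℝ`. -/
def lastVec (V : Type) [NormedAddCommGroup V] [InnerProductSpace ℝ V] : AddE V 1 :=
  WithLp.toLp 2 (0, line 1)

section LastVec

variable {V : Type} [NormedAddCommGroup V] [InnerProductSpace ℝ V]

@[simp] theorem norm_lastVec : ‖lastVec V‖ = 1 := by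
  rw [lastVec, JPt.norm_toLp_line, abs_one]

theorem smul_lastVec (c : ℝ) : c • lastVec V = WithLp.toLp 2 (0, line c) := by
  refine AddE.ext (smul_zero c) ?_
  change c • line 1 = line c
  rw [← line_smul, mul_one]

theorem inner_lastVec (x : AddE V 1) : inner ℝ (lastVec V) x = x.snd 0 := by
  rw [lastVec, WithLp.prod_inner_apply]
  change inner ℝ (0 : V) x.fst + inner ℝ (line 1) x.snd = _
  rw [inner_zero_left, zero_add, eq_line x.snd, inner_line, one_mul, line_apply]

/-- The structure map of a shift puts the suspension coordinate before the coordinate of the shift,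
and the quarter turn in the plane of these two does the same. The sign in the vector of `tilt` is
what makes the coordinate arrive here as $+s$. -/
theorem sigma_add_one (s : ℝ) : (JPt.sigma V s).add 1 = tilt (lastVec V) s := by
  have h : clamp (lastVec V) = lastVec V := clamp_of_norm_le norm_lastVec.le
  have hc : tiltCos (lastVec V) = 0 := tiltCos_of_le_norm norm_lastVec.ge
  apply JPt.ext
  · ext x
    refine AddE.ext ?_ ?_
    · change WithLp.toLp 2 (x.fst, 0) = x - (inner ℝ (clamp (lastVec V)) x /
        (1 + tiltCos (lastVec V))) • clamp (lastVec V)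
      rw [h, hc, add_zero, div_one, inner_lastVec, smul_lastVec, ← eq_line]
      exact AddE.ext (sub_zero _).symm (sub_self _).symm
    · change x.snd = line (inner ℝ (clamp (lastVec V)) x)
      rw [h, inner_lastVec, ← eq_line]
  · rw [tilt_vec, h, hc, smul_lastVec, mul_zero, neg_zero, line_zero]
    rfl

theorem continuous_smul_lastVec : Continuous fun c : ℝ => c • lastVec V := by
  simp only [smul_lastVec]
  exact JPt.continuous_toLp continuous_const continuous_line

theorem continuous_tilt_smul_lastVec [FiniteDimensional ℝ V] :
    Continuous fun p : ℝ × ℝ => tilt (p.1 • lastVec V) p.2 :=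
  Continuous.comp (g := fun q : AddE V 1 × ℝ => tilt q.1 q.2)
    (f := fun p : ℝ × ℝ => (p.1 • lastVec V, p.2)) continuous_tilt
    ((continuous_smul_lastVec.comp continuous_fst).prodMk continuous_snd)

end LastVec

theorem ρ_smul_lastVec (V : OrthRep G) (g : G) (c : ℝ) :
    (V.add 1).ρ g (c • lastVec V) = c • lastVec V := by
  rw [smul_lastVec]
  exact AddE.ext (map_zero (V.ρ g)) rfl

/-- The rotation `tilt` in the plane of the two new coordinates of `(V ⊕ ℝ) ⊕ ℝ`. -/
def tiltLast (V : OrthRep G) (c s : ℝ) : JPt (V.add 1) ((V.add 1).add 1) := tilt (c • lastVec V) s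

theorem continuous_tiltLast (V : OrthRep G) : Continuous fun p : ℝ × ℝ => tiltLast V p.1 p.2 :=
  continuous_tilt_smul_lastVec

theorem norm_tiltLast (V : OrthRep G) (c s : ℝ) : ‖(tiltLast V c s).vec‖ = |s| := norm_tilt_vec _ _

theorem conj_tiltLast (V : OrthRep G) (g : G) (c s : ℝ) : (tiltLast V c s).conj g =
    tiltLast V c s :=
  (conj_tilt (V.add 1) g _ s).trans
      (congrArg (fun q : AddE V 1 => tilt q s) (ρ_smul_lastVec V g c))

theorem tiltLast_one (V : OrthRep G) (s : ℝ) : tiltLast V 1 s = (JPt.sigma V s).add 1 := by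
  rw [sigma_add_one, tiltLast, one_smul]; rfl

theorem continuous_map_tiltLast (V : OrthRep G) :
    Continuous fun q : I × OnePoint ℝ => OnePoint.map (tiltLast V q.1) q.2 := by
  have h : Continuous fun q : I × ℝ => tiltLast V q.1 q.2 :=
    (continuous_tiltLast V).comp (f := fun q : I × ℝ => ((q.1 : ℝ), q.2))
      ((continuous_subtype_val.comp continuous_fst).prodMk continuous_snd)
  exact JPt.continuous_map_family (P := I) (V := V.add 1) (W := (V.add 1).add 1)
    (j := fun t s => tiltLast V t s) h fun t s => (norm_tiltLast V t s).ge

namespace OrthSpectrum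

/-- The action of the rotations `tiltLast` on the shift of a spectrum. -/
def tiltMap (E : OrthSpectrum G) (V : OrthRep G) (c : I) :
    SuspMap (E.shift 1) (E.shift 1) V (V.add 1) where
  toFun x s := E.act (V := V.add 1) (W := (V.add 1).add 1) (OnePoint.map (tiltLast V c) s) x
  continuous_toFun := (E.continuous_act (V.add 1) ((V.add 1).add 1)).comp
    (((continuous_map_tiltLast V).comp (continuous_const.prodMk continuous_snd)).prodMk
      continuous_fst)
  map_pt s := E.act_pt (V := V.add 1) (W := (V.add 1).add 1) _
  map_infty x := E.act_infty (V := V.add 1) (W := (V.add 1).add 1) x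
  map_smul g x s := by
    induction s using OnePoint.rec with
    | infty =>
      exact (E.act_infty (V := V.add 1) (W := (V.add 1).add 1) _).trans
        ((E.smul_pt ((V.add 1).add 1) g).symm.trans (congrArg (fun y => g • y)
          (E.act_infty (V := V.add 1) (W := (V.add 1).add 1) x).symm))
    | coe s =>
      refine Eq.trans ?_ (E.smul_act (V := V.add 1) (W := (V.add 1).add 1) g _ x).symm
      rw [conj_tiltLast]
      rfl

theorem continuous_tiltMap (E : OrthSpectrum G) (V : OrthRep G) :
    Continuous fun q : I × ((E.shift 1).X V × OnePoint ℝ) =>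
      (tiltMap E V q.1).toFun q.2.1 q.2.2 :=
  (E.continuous_act (V.add 1) ((V.add 1).add 1)).comp
    (((continuous_map_tiltLast V).comp (continuous_fst.prodMk
      (continuous_snd.comp continuous_snd))).prodMk (continuous_fst.comp continuous_snd))

theorem tiltMap_one (E : OrthSpectrum G) (V : OrthRep G) :
    tiltMap E V 1 = SuspMap.structMap (E.shift 1) V := by
  ext x s
  induction s using OnePoint.rec with
  | infty => rfl
  | coe s =>
    exact congrArg (fun j : JPt (V.add 1) ((V.add 1).add 1) =>
      E.act (OnePoint.some j) x) (tiltLast_one V s)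

/-- At $c=0$ the old coordinates stay in place and the new one is $-s$. Transposing two coordinates
and changing the sign of one lie in the same component of $O(2)$, and the rotations form a path
between the two. -/
theorem tiltMap_homotopic (E : OrthSpectrum G) (V : OrthRep G) :
    (tiltMap E V 0).Homotopic (SuspMap.structMap (E.shift 1) V) :=
  ⟨tiltMap E V, rfl, tiltMap_one E V, continuous_tiltMap E V⟩

end OrthSpectrum

/-! ### Maps between Thom spaces -/

theorem continuous_smash_mk {A B : Type*} [TopologicalSpace A] [TopologicalSpace B] [T2Space A]
    [T2Space B] : Continuous fun q : OnePoint A × OnePoint B => smashMap Prod.mk q.1 q.2 :=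
  continuous_smashMap continuous_id fun K _ hK =>
    ⟨Prod.fst '' K, Prod.snd '' K,
      ⟨(hK.image continuous_fst).isClosed, hK.image continuous_fst⟩,
      ⟨(hK.image continuous_snd).isClosed, hK.image continuous_snd⟩,
      fun _ _ h => ⟨⟨_, h, rfl⟩, ⟨_, h, rfl⟩⟩⟩

namespace ThomFunctor

/-- The constant `C` permits sizes to drop by a bounded amount, which does not affect properness. It
is nonzero only for `spreadCoe`, where a vector of length at most $1$ is subtracted. -/
theorem continuous_smashMap_family {P : Type*} [TopologicalSpace P] [CompactSpace P]
    (T S : ThomFunctor G) {V W : OrthRep G} {f : P → T.A V → ℝ → S.A W}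
    (hf : Continuous fun q : P × (T.A V × ℝ) => f q.1 q.2.1 q.2.2) (C : ℝ)
    (h1 : ∀ p a s, T.size V a ≤ S.size W (f p a s) + C)
    (h2 : ∀ p a s, |s| ≤ S.size W (f p a s) + C) :
    Continuous fun q : P × (OnePoint (T.A V) × OnePoint ℝ) => smashMap (f q.1) q.2.1 q.2.2 := by
  have hfam := continuous_onePointMap_family (P := P) (B := T.A V × ℝ)
    (m := fun p q => f p q.1 q.2) hf fun K _ hK => by
      obtain ⟨r, hr⟩ := (hK.image (S.continuous_size W)).isBounded.exists_norm_le
      have hc := (T.isCompact_size V (r + C)).prod (isCompact_closedBall (0 : ℝ) (r + C))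
      refine ⟨_, ⟨hc.isClosed, hc⟩, fun p b hb => ?_⟩
      have h3 : S.size W (f p b.1 b.2) ≤ r :=
        (le_abs_self _).trans (hr _ (mem_image_of_mem _ hb))
      refine ⟨(h1 p b.1 b.2).trans (add_le_add_left h3 C), ?_⟩
      rw [mem_closedBall_zero_iff]
      exact (h2 p b.1 b.2).trans (add_le_add_left h3 C)
  convert hfam.comp (continuous_fst.prodMk (continuous_smash_mk.comp continuous_snd)) using 1
  ext ⟨p, a, s⟩
  induction a using OnePoint.rec with
  | infty => rfl
  | coe a => induction s using OnePoint.rec <;> rfl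

end ThomFunctor

end

/-! ### The suspension spectrum and its shift -/

section

variable {G : Type*} [Group G]

/-- Invariance under conjugation amounts to commuting with the action of $g$ on source and target,
which is the form needed to check equivariance on Thom spaces. -/
theorem JPt.ofIsom_comp_of_conj {V W : OrthRep G} {g : G} {j : JPt V W} (h : j.conj g = j) :
    (JPt.ofIsom (W.isom g)).comp j = j.comp (JPt.ofIsom (V.isom g)) := by
  apply JPt.ext
  · ext x
    have h1 := congrArg (fun k : JPt V W => k.emb (V.ρ g x)) h
    refine Eq.trans ?_ h1
    change W.ρ g (j.emb x) = W.ρ g (j.emb (V.ρ g⁻¹ (V.ρ g x)))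
    rw [map_inv]
    exact congrArg (fun y => W.ρ g (j.emb y)) ((V.ρ g).symm_apply_apply x).symm
  · have h2 := congrArg JPt.vec h
    rw [JPt.comp_vec, JPt.comp_vec, JPt.ofIsom_vec, JPt.ofIsom_vec, map_zero, add_zero, zero_add]
    exact h2

theorem tiltLast_zero_emb (V : OrthRep G) (s : ℝ) :
    (tiltLast V 0 s).emb = inclE (AddE V 1) 1 :=
  tiltEmb_zero_smul (lastVec V)

theorem continuous_tiltLast_apply {P : Type*} [TopologicalSpace P] (V : OrthRep G) {s : P → ℝ}
    {w : P → AddE V 1} (c : ℝ) (hs : Continuous s) (hw : Continuous w) :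
    Continuous fun p => (tiltLast V c (s p)).emb (w p) + (tiltLast V c (s p)).vec := by
  have h : Continuous fun p => tiltLast V c (s p) :=
    (continuous_tiltLast V).comp (f := fun p => (c, s p)) (continuous_const.prodMk hs)
  exact (JPt.continuous_emb_apply h hw).add (JPt.continuous_vec.comp h)

theorem abs_le_norm_tiltLast (V : OrthRep G) (c s : ℝ) (w : AddE V 1) :
    |s| ≤ ‖(tiltLast V c s).emb w + (tiltLast V c s).vec‖ :=
  (norm_tiltLast V c s).ge.trans ((tiltLast V c s).vec_le w)

namespace OrthSpectrum

/-- The map `(S^{V ⊕ ℝ} ∧ Gr_d(V ⊕ ℝ)_+) ∧ S¹ → S^{(V ⊕ ℝ) ⊕ ℝ} ∧ Gr_d(V ⊕ ℝ)_+` exchanging the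
two new coordinates. -/
def unshiftSusp (d : ℕ) (V : OrthRep G) :
    SuspMap ((suspBO G d).shift 1) (suspOneBO G d) V (V.add 1) where
  toFun x s := smashMap (fun (p : AddE V 1 × Gr d (AddE V 1)) s =>
    (((tiltLast V 1 s).emb p.1 + (tiltLast V 1 s).vec, p.2) :
      AddE (AddE V 1) 1 × Gr d (AddE V 1))) x s
  continuous_toFun := by
    have h := ThomFunctor.continuous_smashMap_family (P := Unit) (suspFunctor G d)
      (suspOneFunctor G d) (V := V.add 1) (W := V.add 1)
      (f := fun _ p s => ((tiltLast V 1 s).emb p.1 + (tiltLast V 1 s).vec, p.2))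
      ((continuous_tiltLast_apply V 1 (continuous_snd.comp continuous_snd)
        (continuous_fst.comp (continuous_fst.comp continuous_snd))).prodMk
          (continuous_snd.comp (continuous_fst.comp continuous_snd))) 0
      (fun _ p s => ((tiltLast V 1 s).size_le p.1).trans (add_zero _).ge)
      (fun _ p s => (abs_le_norm_tiltLast V 1 s p.1).trans (add_zero _).ge)
    exact h.comp (f := fun q => ((), q)) (continuous_const.prodMk continuous_id)
  map_pt s := rfl
  map_infty x := smashMap_infty_right _ x
  map_smul g x s := by
    induction x using OnePoint.rec with
    | infty => rfl
    | coe p =>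
      induction s using OnePoint.rec with
      | infty => rfl
      | coe s =>
        have h := JPt.ofIsom_comp_of_conj (conj_tiltLast V g 1 s)
        have h1 := congrArg (fun j => ((suspFunctor G d).act j p).1) h
        simp only [ThomFunctor.act_comp] at h1
        exact congrArg OnePoint.some (Prod.ext h1.symm rfl)

theorem continuous_rotateSusp (d : ℕ) (V : OrthRep G) :
    Continuous fun q : I × (OnePoint (AddE V 1 × Gr d (AddE V 1)) × OnePoint ℝ) =>
      smashMap (fun p s => (((tiltLast V 1 s).emb p.1 + (tiltLast V 1 s).vec,
        p.2.map (tiltLast V q.1 0).emb) : AddE (AddE V 1) 1 × Gr d (AddE (AddE V 1) 1)))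
        q.2.1 q.2.2 := by
  have hj : Continuous fun q : I × ((AddE V 1 × Gr d (AddE V 1)) × ℝ) => tiltLast V q.1 0 :=
    (continuous_tiltLast V).comp
      (f := fun q : I × ((AddE V 1 × Gr d (AddE V 1)) × ℝ) => ((q.1 : ℝ), (0 : ℝ)))
      ((continuous_subtype_val.comp continuous_fst).prodMk continuous_const)
  exact ThomFunctor.continuous_smashMap_family (P := I) (suspFunctor G d)
    (suspFunctor G d) (V := V.add 1) (W := (V.add 1).add 1)
    (f := fun t p s => ((tiltLast V 1 s).emb p.1 + (tiltLast V 1 s).vec,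
      p.2.map (tiltLast V t 0).emb))
    ((continuous_tiltLast_apply V 1 (continuous_snd.comp continuous_snd)
      (continuous_fst.comp (continuous_fst.comp continuous_snd))).prodMk
        (Gr.continuous_map hj (continuous_snd.comp (continuous_fst.comp continuous_snd)))) 0
    (fun _ p s => ((tiltLast V 1 s).size_le p.1).trans (add_zero _).ge)
    (fun _ p s => (abs_le_norm_tiltLast V 1 s p.1).trans (add_zero _).ge)

/-- The homotopy between the structure map of `sh_1 Σ^∞_+ B_G O(d)` and its composition with the
rotation of the subspaces only. -/
def rotateSusp (d : ℕ) (V : OrthRep G) (t : I) :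
    SuspMap ((suspBO G d).shift 1) ((suspBO G d).shift 1) V (V.add 1) where
  toFun x s := smashMap (fun (p : AddE V 1 × Gr d (AddE V 1)) s =>
    (((tiltLast V 1 s).emb p.1 + (tiltLast V 1 s).vec, p.2.map (tiltLast V t 0).emb) :
      AddE (AddE V 1) 1 × Gr d (AddE (AddE V 1) 1))) x s
  continuous_toFun := (continuous_rotateSusp d V).comp (f := fun q => (t, q))
    (continuous_const.prodMk continuous_id)
  map_pt s := rfl
  map_infty x := smashMap_infty_right _ x
  map_smul g x s := by
    induction x using OnePoint.rec with
    | infty => rfl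
    | coe p =>
      induction s using OnePoint.rec with
      | infty => rfl
      | coe s =>
        have h := JPt.ofIsom_comp_of_conj (conj_tiltLast V g 1 s)
        have h1 := congrArg (fun j => ((suspFunctor G d).act j p).1) h
        have h' := JPt.ofIsom_comp_of_conj (conj_tiltLast V g t 0)
        have h2 := congrArg (fun j => ((suspFunctor G d).act j p).2) h'
        simp only [ThomFunctor.act_comp] at h1 h2
        exact congrArg OnePoint.some (Prod.ext h1.symm h2.symm)

/-- The quarter turn already places the vector as the structure map of the shift does, so only the
subspace has to move: in the first composite it is included by $L\mapsto L\oplus 0$, and rotating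
this inclusion to the quarter turn gives the structure map. In the second composite the subspace
lies in $V$, which the rotation fixes, and the two maps agree. -/
theorem isPiIso_suspToShift (U : UnivRep G) (d : ℕ) : IsPiIso U (suspToShift G d) := by
  refine isPiIso_of_suspMap U _ fun V => ⟨unshiftSusp d V, ?_, ?_⟩
  · have h0 : (unshiftSusp d V).postcomp (suspToShift G d) = rotateSusp d V 0 := by
      ext x s
      induction x using OnePoint.rec with
      | infty => rfl
      | coe p =>
        induction s using OnePoint.rec with
        | infty => rfl
        | coe s =>
          refine congrArg OnePoint.some (Prod.ext rfl ?_)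
          exact congrArg (fun φ => p.2.map φ) (tiltLast_zero_emb V 0).symm
    have h1 : rotateSusp d V 1 = SuspMap.structMap _ V := by
      rw [← tiltMap_one]
      ext x s
      induction x using OnePoint.rec with
      | infty => exact (SuspMap.map_pt _ s).trans (SuspMap.map_pt _ s).symm
      | coe p => induction s using OnePoint.rec <;> rfl
    rw [h0, ← h1]
    exact .rel _ _ ⟨rotateSusp d V, rfl, rfl, continuous_rotateSusp d V⟩
  · have h : (unshiftSusp d V).precomp (suspToShift G d) = SuspMap.structMap _ V := by
      ext x s
      induction x using OnePoint.rec with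
      | infty => exact (SuspMap.map_pt _ s).trans (SuspMap.map_pt _ s).symm
      | coe p =>
        induction s using OnePoint.rec with
        | infty => rfl
        | coe s =>
          refine congrArg OnePoint.some (Prod.ext ?_ rfl)
          exact congrArg (fun j : JPt (V.add 1) ((V.add 1).add 1) => j.emb p.1 + j.vec)
            (tiltLast_one V s)
    rw [h]
    exact .refl _

end OrthSpectrum

end

/-! ### Reparametrised cone coordinates and maps out of mapping cones -/

section

/-- The map `t ↦ t / max t (1 - t)`, which stretches `[0, 1/2]` to `[0, 1]`. -/
def stretch (t : I) : I :=
  ⟨t / max (t : ℝ) (1 - t), by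
    have h : 0 < max (t : ℝ) (1 - t) := by
      rcases le_or_gt (t : ℝ) 0 with h | h
      · exact lt_max_of_lt_right (by linarith)
      · exact lt_max_of_lt_left h
    exact ⟨div_nonneg t.2.1 h.le, (div_le_one h).2 (le_max_left _ _)⟩⟩

theorem continuous_stretch : Continuous stretch := by
  refine Continuous.subtype_mk (Continuous.div (by fun_prop) (by fun_prop) fun t => ?_) _
  rcases le_or_gt (t : ℝ) 0 with h | h
  · exact (lt_max_of_lt_right (by linarith)).ne'
  · exact (lt_max_of_lt_left h).ne'

theorem stretch_of_le {t : I} (h : (1 / 2 : ℝ) ≤ t) : stretch t = 1 := by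
  apply Subtype.ext
  change (t : ℝ) / max (t : ℝ) (1 - t) = 1
  rw [max_eq_left (by linarith)]
  exact div_self (by linarith)

theorem coe_stretch_of_le {t : I} (h : (t : ℝ) ≤ 1 / 2) : (stretch t : ℝ) = t / (1 - t) := by
  change (t : ℝ) / max (t : ℝ) (1 - t) = _
  rw [max_eq_right (by linarith)]

theorem stretch_zero : stretch 0 = 0 := Subtype.ext (zero_div _)

theorem stretch_one : stretch 1 = 1 :=
  stretch_of_le (by rw [Icc.coe_one]; norm_num)

/-- The linear homotopy from `stretch` to the identity. -/
def stretchHtpy (t u : I) : I :=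
  ⟨(1 - t) * stretch u + t * u, by
    have h1 := (stretch u).2
    have h2 := u.2
    have h3 := t.2
    constructor
    · exact add_nonneg (mul_nonneg (sub_nonneg.2 h3.2) h1.1) (mul_nonneg h3.1 h2.1)
    · nlinarith [mul_le_mul_of_nonneg_left h1.2 (sub_nonneg.2 h3.2),
        mul_le_mul_of_nonneg_left h2.2 h3.1]⟩

theorem continuous_stretchHtpy : Continuous fun p : I × I => stretchHtpy p.1 p.2 := by
  have h : Continuous fun p : I × I => (stretch p.2 : ℝ) :=
    continuous_subtype_val.comp (continuous_stretch.comp continuous_snd)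
  exact Continuous.subtype_mk (((continuous_const.sub
    (continuous_subtype_val.comp continuous_fst)).mul h).add (by fun_prop)) _

theorem stretchHtpy_zero_left (u : I) : stretchHtpy 0 u = stretch u :=
  Subtype.ext (by simp [stretchHtpy])

theorem stretchHtpy_one_left (u : I) : stretchHtpy 1 u = u :=
  Subtype.ext (by simp [stretchHtpy])

theorem stretchHtpy_zero_right (t : I) : stretchHtpy t 0 = 0 :=
  Subtype.ext (by simp [stretchHtpy, stretch_zero])

theorem stretchHtpy_one_right (t : I) : stretchHtpy t 1 = 1 :=
  Subtype.ext (by simp [stretchHtpy, stretch_one])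

namespace OrthSpectrum

variable {G : Type*} [Group G]

section Cone

variable {E F : OrthSpectrum G} (f : Hom E F)

/-- A point of the cone on `E(V)`. -/
def coneInl (V : OrthRep G) (x : E.X V) (t : I) : (cone f).X V :=
  (Quot.mk (ConeRel f V) (Sum.inl (x, t)))

/-- A point of `F(V)` in the mapping cone. -/
def coneInr (V : OrthRep G) (y : F.X V) : (cone f).X V :=
  (Quot.mk (ConeRel f V) (Sum.inr y))

variable {f} {V : OrthRep G}

theorem coneInl_one (x : E.X V) : coneInl f V x 1 = coneInr f V (f.app V x) :=
  Quot.sound (ConeRel.glue x)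

theorem coneInl_zero (x : E.X V) : coneInl f V x 0 = (cone f).pt V :=
  Quot.sound (ConeRel.tip x)

theorem coneInl_pt (t : I) : coneInl f V (E.pt V) t = (cone f).pt V :=
  Quot.sound (ConeRel.line t)

theorem continuous_coneInl : Continuous fun p : E.X V × I => coneInl f V p.1 p.2 :=
  continuous_quot_mk.comp continuous_inl

theorem continuous_coneInr : Continuous (coneInr f V) :=
  continuous_quot_mk.comp continuous_inr

theorem cone_induction {p : (cone f).X V → Prop} (h1 : ∀ x t, p (coneInl f V x t))
    (h2 : ∀ y, p (coneInr f V y)) (c : (cone f).X V) : p c := by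
  induction c using Quot.ind with
  | mk c =>
    rcases c with ⟨x, t⟩ | y
    · exact h1 x t
    · exact h2 y

/-- The product of a quotient map with a locally compact space is again a quotient map, so
continuity can be checked before the identifications. -/
theorem continuous_cone_family {P Z : Type*} [TopologicalSpace P] [LocallyCompactSpace P]
    [TopologicalSpace Z] {k : P → (cone f).X V → Z}
    (h1 : Continuous fun q : P × (E.X V × I) => k q.1 (coneInl f V q.2.1 q.2.2))
    (h2 : Continuous fun q : P × F.X V => k q.1 (coneInr f V q.2)) :
    Continuous fun q : P × (cone f).X V => k q.1 q.2 := by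
  refine (isQuotientMap_quot_mk (r := ConeRel f V)).continuous_lift_prod_right ?_
  rw [Homeomorph.prodSumDistrib.symm.isQuotientMap.continuous_iff, continuous_sum_dom]
  exact ⟨h1, h2⟩

/-- Maps out of the mapping cone. -/
def coneLift {Z : Type*} (a : E.X V → I → Z) (b : F.X V → Z)
    (h1 : ∀ x, a x 1 = b (f.app V x)) (h0 : ∀ x, a x 0 = b (F.pt V))
    (hp : ∀ t, a (E.pt V) t = b (F.pt V)) : (cone f).X V → Z :=
  Quot.lift (Sum.elim (fun p => a p.1 p.2) b) fun _ _ h => by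
    cases h with
    | glue x => exact h1 x
    | tip x => exact h0 x
    | line t => exact hp t

end Cone

/-! ### Two homotopies on the mapping cone of a morphism to a shift -/

section ConeHomotopies

theorem SuspMap.continuous_comp {E F : OrthSpectrum G} {V W : OrthRep G} (ψ : SuspMap F E V W)
    {P : Type*} [TopologicalSpace P] {x : P → F.X V} {s : P → OnePoint ℝ} (hx : Continuous x)
    (hs : Continuous s) : Continuous fun p => ψ.toFun (x p) (s p) :=
  ψ.continuous_toFun.comp (f := fun p => (x p, s p)) (hx.prodMk hs)

theorem continuous_tiltMap_comp {F : OrthSpectrum G} {V : OrthRep G}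
    {P : Type*} [TopologicalSpace P] {t : P → I} {x : P → (F.shift 1).X V} {s : P → OnePoint ℝ}
    (ht : Continuous t) (hx : Continuous x) (hs : Continuous s) :
    Continuous fun p => (tiltMap F V (t p)).toFun (x p) (s p) :=
  (continuous_tiltMap F V).comp (f := fun p => (t p, (x p, s p))) (ht.prodMk (hx.prodMk hs))

theorem continuous_coneInl_comp {E F : OrthSpectrum G} {f : Hom E F} {V : OrthRep G}
    {P : Type*} [TopologicalSpace P] {x : P → E.X V} {t : P → I} (hx : Continuous x)
    (ht : Continuous t) : Continuous fun p => coneInl f V (x p) (t p) :=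
  continuous_coneInl.comp (f := fun p => (x p, t p)) (hx.prodMk ht)

/-- The structure map of the shift is the rotation at $c=1$, and $f$ commutes with structure maps.
At other values of $c$ this fails, so rotating $F$ alone is not compatible with the gluing of the
cone. -/
theorem tiltMap_map {E F : OrthSpectrum G} (f : Hom E (F.shift 1)) (V : OrthRep G) (x : E.X V)
    (s : OnePoint ℝ) : (tiltMap F V 1).toFun (f.app V x) s =
      f.app (V.add 1) ((SuspMap.structMap E V).toFun x s) := by
  rw [tiltMap_one]
  exact (f.app_act' _ x).symm

variable {E F : OrthSpectrum G} (f : Hom E (F.shift 1)) (V : OrthRep G)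

/-- The map underlying the homotopy `coneTilt` on points of the cone. -/
def coneTiltInl (t : I) (s : OnePoint ℝ) (x : E.X V) (u : I) : (cone f).X (V.add 1) :=
  if (1 / 2 : ℝ) ≤ u then
    -- The upper half of the cone serves as a collar. The rotation parameter runs from $t$ at $u=1$
    -- to $1$ at $u=1/2$, where the image agrees with the base of the stretched lower half.
    coneInr f (V.add 1) ((tiltMap F V (max t (stretch (σ u)))).toFun (f.app V x) s)
  else coneInl f (V.add 1) ((SuspMap.structMap E V).toFun x s) (stretch u)

/-- At $u=1/2$ both formulas apply and agree, by `tiltMap_map` and the gluing at the base of the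
cone. -/
theorem coneTiltInl_of_le {t : I} {s : OnePoint ℝ} {x : E.X V} {u : I} (h : (u : ℝ) ≤ 1 / 2) :
    coneTiltInl f V t s x u =
      coneInl f (V.add 1) ((SuspMap.structMap E V).toFun x s) (stretch u) := by
  rw [coneTiltInl]
  split_ifs with h'
  · have h1 : stretch (σ u) = 1 := stretch_of_le (by rw [coe_symm_eq]; linarith)
    rw [stretch_of_le h', h1, coneInl_one, max_eq_right le_one', tiltMap_map]
  · rfl

theorem continuous_coneTiltInl : Continuous fun q : (I × OnePoint ℝ) × (E.X V × I) =>
    coneTiltInl f V q.1.1 q.1.2 q.2.1 q.2.2 := by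
  have ht : Continuous fun q : (I × OnePoint ℝ) × (E.X V × I) => q.1.1 :=
    continuous_fst.comp continuous_fst
  have hs : Continuous fun q : (I × OnePoint ℝ) × (E.X V × I) => q.1.2 :=
    continuous_snd.comp continuous_fst
  have hx : Continuous fun q : (I × OnePoint ℝ) × (E.X V × I) => q.2.1 :=
    continuous_fst.comp continuous_snd
  have hu : Continuous fun q : (I × OnePoint ℝ) × (E.X V × I) => q.2.2 :=
    continuous_snd.comp continuous_snd
  refine Continuous.if_le ?_ ?_ continuous_const (continuous_subtype_val.comp hu) fun q hq => ?_
  · exact continuous_coneInr.comp (continuous_tiltMap_comp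
      (ht.max (continuous_stretch.comp (continuous_symm.comp hu)))
        ((f.continuous_app V).comp hx) hs)
  · exact continuous_coneInl_comp ((SuspMap.structMap E V).continuous_comp hx hs)
      (continuous_stretch.comp hu)
  · have h := coneTiltInl_of_le f V (t := q.1.1) (s := q.1.2) (x := q.2.1) (u := q.2.2) hq.ge
    rwa [coneTiltInl, if_pos hq.le] at h

/-- The map underlying `coneTilt`. -/
def coneTiltFun (t : I) (s : OnePoint ℝ) : (cone f).X V → (cone f).X (V.add 1) :=
  coneLift (f := f) (coneTiltInl f V t s)
    (fun y => coneInr f (V.add 1) ((tiltMap F V t).toFun y s))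
    (fun x => by
      have h : (1 / 2 : ℝ) ≤ (1 : I) := by rw [Icc.coe_one]; norm_num
      rw [coneTiltInl, if_pos h, symm_one, stretch_zero, max_eq_left nonneg'])
    (fun x => by
      rw [coneTiltInl_of_le f V (by rw [Icc.coe_zero]; norm_num), stretch_zero, coneInl_zero,
        (tiltMap F V t).map_pt]
      rfl)
    (fun u => by
      rw [coneTiltInl, f.app_pt, (tiltMap F V _).map_pt, (SuspMap.structMap E V).map_pt,
        coneInl_pt, (tiltMap F V _).map_pt]
      exact ite_self _)

theorem continuous_coneTiltFun : Continuous fun q : (I × OnePoint ℝ) × (cone f).X V =>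
    coneTiltFun f V q.1.1 q.1.2 q.2 :=
  continuous_cone_family (f := f) (V := V) (P := I × OnePoint ℝ)
    (k := fun p c => coneTiltFun f V p.1 p.2 c) (continuous_coneTiltInl f V)
    (continuous_coneInr.comp (continuous_tiltMap_comp (continuous_fst.comp continuous_fst)
      continuous_snd (continuous_snd.comp continuous_fst)))

/-- The self-homotopy of the structure map of the cone which rotates the two new coordinates. -/
def coneTilt (t : I) : SuspMap (cone f) (cone f) V (V.add 1) where
  toFun c s := coneTiltFun f V t s c
  continuous_toFun := (continuous_coneTiltFun f V).comp
    (f := fun q : (cone f).X V × OnePoint ℝ => ((t, q.2), q.1))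
    ((continuous_const.prodMk continuous_snd).prodMk continuous_fst)
  map_pt s := congrArg (coneInr f (V.add 1)) ((tiltMap F V t).map_pt s)
  map_infty c := by
    induction c using cone_induction with
    | h1 x u =>
      change coneTiltInl f V t ∞ x u = _
      rw [coneTiltInl, (tiltMap F V _).map_infty, (SuspMap.structMap E V).map_infty, coneInl_pt]
      exact ite_self _
    | h2 y => exact congrArg (coneInr f (V.add 1)) ((tiltMap F V t).map_infty y)
  map_smul g c s := by
    induction c using cone_induction with
    | h1 x u =>
      change coneTiltInl f V t s (g • x) u = g • coneTiltInl f V t s x u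
      rw [coneTiltInl, coneTiltInl, f.app_smul, (tiltMap F V _).map_smul,
        (SuspMap.structMap E V).map_smul]
      split_ifs <;> rfl
    | h2 y => exact congrArg (coneInr f (V.add 1)) ((tiltMap F V t).map_smul g y s)

theorem continuous_coneTilt : Continuous fun q : I × ((cone f).X V × OnePoint ℝ) =>
    (coneTilt f V q.1).toFun q.2.1 q.2.2 :=
  (continuous_coneTiltFun f V).comp
    (f := fun q : I × ((cone f).X V × OnePoint ℝ) => ((q.1, q.2.2), q.2.1))
    ((continuous_fst.prodMk (continuous_snd.comp continuous_snd)).prodMk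
      (continuous_fst.comp continuous_snd))

/-- The map underlying `coneStretch`. -/
def coneStretchFun (t : I) (s : OnePoint ℝ) : (cone f).X V → (cone f).X (V.add 1) :=
  coneLift (f := f)
    (fun x u => coneInl f (V.add 1) ((SuspMap.structMap E V).toFun x s) (stretchHtpy t u))
    (fun y => coneInr f (V.add 1) ((tiltMap F V 1).toFun y s))
    (fun x => by rw [stretchHtpy_one_right, coneInl_one, tiltMap_map])
    (fun x => by
      rw [stretchHtpy_zero_right, coneInl_zero, (tiltMap F V _).map_pt]
      rfl)
    (fun u => by
      rw [(SuspMap.structMap E V).map_pt, coneInl_pt, (tiltMap F V _).map_pt]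
      rfl)

theorem continuous_coneStretchFun : Continuous fun q : (I × OnePoint ℝ) × (cone f).X V =>
    coneStretchFun f V q.1.1 q.1.2 q.2 :=
  continuous_cone_family (f := f) (V := V) (P := I × OnePoint ℝ)
    (k := fun p c => coneStretchFun f V p.1 p.2 c)
    (continuous_coneInl_comp ((SuspMap.structMap E V).continuous_comp
      (continuous_fst.comp continuous_snd) (continuous_snd.comp continuous_fst))
        (continuous_stretchHtpy.comp (f := fun q : (I × OnePoint ℝ) × (E.X V × I) =>
          (q.1.1, q.2.2)) ((continuous_fst.comp continuous_fst).prodMk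
            (continuous_snd.comp continuous_snd))))
    (continuous_coneInr.comp ((tiltMap F V 1).continuous_comp continuous_snd
      (continuous_snd.comp continuous_fst)))

/-- The homotopy of the structure map of the cone which reparametrises the cone coordinate. -/
def coneStretch (t : I) : SuspMap (cone f) (cone f) V (V.add 1) where
  toFun c s := coneStretchFun f V t s c
  continuous_toFun := (continuous_coneStretchFun f V).comp
    (f := fun q : (cone f).X V × OnePoint ℝ => ((t, q.2), q.1))
    ((continuous_const.prodMk continuous_snd).prodMk continuous_fst)
  map_pt s := congrArg (coneInr f (V.add 1)) ((tiltMap F V 1).map_pt s)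
  map_infty c := by
    induction c using cone_induction with
    | h1 x u =>
      change coneInl f (V.add 1) ((SuspMap.structMap E V).toFun x ∞) (stretchHtpy t u) = _
      rw [(SuspMap.structMap E V).map_infty, coneInl_pt]
    | h2 y => exact congrArg (coneInr f (V.add 1)) ((tiltMap F V 1).map_infty y)
  map_smul g c s := by
    induction c using cone_induction with
    | h1 x u =>
      change coneInl f (V.add 1) ((SuspMap.structMap E V).toFun (g • x) s) (stretchHtpy t u) = _
      rw [(SuspMap.structMap E V).map_smul]
      rfl
    | h2 y => exact congrArg (coneInr f (V.add 1)) ((tiltMap F V 1).map_smul g y s)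

theorem continuous_coneStretch : Continuous fun q : I × ((cone f).X V × OnePoint ℝ) =>
    (coneStretch f V q.1).toFun q.2.1 q.2.2 :=
  (continuous_coneStretchFun f V).comp
    (f := fun q : I × ((cone f).X V × OnePoint ℝ) => ((q.1, q.2.2), q.2.1))
    ((continuous_fst.prodMk (continuous_snd.comp continuous_snd)).prodMk
      (continuous_fst.comp continuous_snd))

/-- At $t=1$ the collar carries no rotation and collapses to the base of the cone, which leaves only
the stretched cone coordinate. -/
theorem coneTilt_one : coneTilt f V 1 = coneStretch f V 0 := by
  ext c s
  induction c using cone_induction with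
  | h1 x u =>
    change coneTiltInl f V 1 s x u = coneInl f (V.add 1) _ (stretchHtpy 0 u)
    rw [stretchHtpy_zero_left]
    rcases le_total (u : ℝ) (1 / 2) with h | h
    · exact coneTiltInl_of_le f V h
    · rw [coneTiltInl, if_pos h, max_eq_left le_one', stretch_of_le h, coneInl_one, tiltMap_map]
  | h2 y => rfl

theorem coneStretch_one : coneStretch f V 1 = SuspMap.structMap (cone f) V := by
  ext c s
  induction c using cone_induction with
  | h1 x u =>
    change coneInl f (V.add 1) _ (stretchHtpy 1 u) = _
    rw [stretchHtpy_one_left]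
    rfl
  | h2 y =>
    change coneInr f (V.add 1) ((tiltMap F V 1).toFun y s) = _
    rw [tiltMap_one]
    rfl

/-- Completing the rotation on $F$ shrinks the range of rotations in the collar until it is
constant; the remaining stretch is undone linearly. -/
theorem coneTilt_zero_homotopic :
    Relation.EqvGen SuspMap.Homotopic (coneTilt f V 0) (SuspMap.structMap (cone f) V) := by
  refine .trans _ (coneTilt f V 1) _
    (.rel _ _ ⟨coneTilt f V, rfl, rfl, continuous_coneTilt f V⟩) ?_
  rw [coneTilt_one, ← coneStretch_one]
  exact .rel _ _ ⟨coneStretch f V, rfl, rfl, continuous_coneStretch f V⟩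

end ConeHomotopies

end OrthSpectrum

end

section

/-! ### Complements of lines in points of the Grassmannian -/

section Lin

variable {X Y : Type} [NormedAddCommGroup X] [InnerProductSpace ℝ X] [FiniteDimensional ℝ X]
  [NormedAddCommGroup Y] [InnerProductSpace ℝ Y] [FiniteDimensional ℝ Y] {d : ℕ}

/-- The orthogonal complement of a unit vector `u` in a subspace that contains it. -/
def Gr.ominus (L : Gr (d + 1) X) (u : X) (hu : ‖u‖ = 1) (h : u ∈ L.1) : Gr d X :=
  ⟨(ℝ ∙ u)ᗮ ⊓ L.1, by
    have h1 := Submodule.finrank_add_inf_finrank_orthogonal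
      ((Submodule.span_singleton_le_iff_mem u L.1).2 h)
    have hu0 : u ≠ 0 := fun h0 => by simp [h0] at hu
    have h2 : Module.finrank ℝ L.1 = d + 1 := L.2
    rw [finrank_span_singleton hu0, h2] at h1
    omega⟩

theorem Gr.mem_ominus {L : Gr (d + 1) X} {u : X} {hu : ‖u‖ = 1} {h : u ∈ L.1} {x : X} :
    x ∈ (L.ominus u hu h).1 ↔ inner ℝ u x = 0 ∧ x ∈ L.1 := by
  change x ∈ (ℝ ∙ u)ᗮ ⊓ L.1 ↔ _
  rw [Submodule.mem_inf, Submodule.mem_orthogonal_singleton_iff_inner_right]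

/-- Since the Grassmannian is topologised by projections, this formula gives the continuity of the
complement in $L$ and $u$. -/
theorem Gr.toProj_ominus (L : Gr (d + 1) X) (u : X) (hu : ‖u‖ = 1) (h : u ∈ L.1) (x : X) :
    (L.ominus u hu h).toProj x = L.toProj x - (inner ℝ u x : ℝ) • u := by
  have hux : inner ℝ u (L.toProj x) = inner ℝ u x := by
    have h1 := Submodule.starProjection_inner_eq_zero (K := L.1) x u h
    rw [real_inner_comm, inner_sub_right] at h1
    exact (sub_eq_zero.1 h1).symm
  refine Submodule.eq_starProjection_of_mem_of_inner_eq_zero (Gr.mem_ominus.2 ⟨?_, ?_⟩) ?_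
  · rw [inner_sub_right, inner_smul_right, real_inner_self_eq_norm_sq, hu, hux]
    ring
  · exact L.1.sub_mem (Submodule.starProjection_apply_mem _ _) (L.1.smul_mem _ h)
  · intro y hy
    obtain ⟨h1, h2⟩ := Gr.mem_ominus.1 hy
    have h3 := Submodule.starProjection_inner_eq_zero (K := L.1) x y h2
    rw [← sub_add, inner_add_left, inner_smul_left, h1, mul_zero, add_zero]
    exact h3

/-- The proofs carried by `ominus` depend on the vector, which prevents direct rewriting. -/
theorem Gr.ominus_congr (L : Gr (d + 1) X) {u v : X} (huv : u = v) (hu : ‖u‖ = 1)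
    (h : u ∈ L.1) (hv : ‖v‖ = 1) (h' : v ∈ L.1) : L.ominus u hu h = L.ominus v hv h' := by
  subst huv; rfl

theorem Gr.ominus_map (φ : X →ₗᵢ[ℝ] Y) (L : Gr (d + 1) X) (u : X) (hu : ‖u‖ = 1) (h : u ∈ L.1)
    (hu' : ‖φ u‖ = 1) (h' : φ u ∈ (L.map φ).1) :
    (L.map φ).ominus (φ u) hu' h' = (L.ominus u hu h).map φ := by
  apply Subtype.ext
  ext y
  rw [Gr.mem_ominus]
  constructor
  · rintro ⟨h1, x, hx, rfl⟩
    exact ⟨x, Gr.mem_ominus.2 ⟨(φ.inner_map_map u x).symm.trans h1, hx⟩, rfl⟩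
  · rintro ⟨x, hx, rfl⟩
    obtain ⟨h1, h2⟩ := Gr.mem_ominus.1 hx
    exact ⟨(φ.inner_map_map u x).trans h1, x, h2, rfl⟩

theorem Gr.ominus_lastVec (L : Gr d X) (u : AddE X 1) (hu : ‖u‖ = 1) (h : u ∈ L.addLine.1)
    (hu' : u = lastVec X) : L.addLine.ominus u hu h = L.map (inclE X 1) := by
  subst hu'
  apply Subtype.ext
  ext y
  rw [Gr.mem_ominus, inner_lastVec]
  constructor
  · rintro ⟨h1, h2⟩
    refine ⟨y.fst, h2, AddE.ext rfl ?_⟩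
    rw [eq_line y.snd, h1]
    rfl
  · rintro ⟨x, hx, rfl⟩
    exact ⟨rfl, hx⟩

/-- In $L=(L\ominus u)\oplus\mathbf R u$ the quarter turn fixes the first summand and carries $u$ to
the new coordinate. This is the reason why long vectors in $L$ lead to the image of $\iota$. -/
theorem Gr.map_tiltEmb (L : Gr (d + 1) X) {q : X} (h : 1 ≤ ‖q‖) (hq : clamp q ∈ L.1) :
    L.map (tiltEmb q) = (L.ominus (clamp q) (norm_clamp_of_le h) hq).addLine := by
  have hn : inner ℝ (clamp q) (clamp q) = (1 : ℝ) := by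
    rw [real_inner_self_eq_norm_sq, norm_clamp_of_le h, one_pow]
  apply Subtype.ext
  ext y
  constructor
  · rintro ⟨x, hx, rfl⟩
    change (tiltEmb q x).fst ∈ (L.ominus (clamp q) (norm_clamp_of_le h) hq).1
    rw [tiltEmb_of_le h]
    refine Gr.mem_ominus.2 ⟨?_, L.1.sub_mem hx (L.1.smul_mem _ hq)⟩
    rw [WithLp.toLp_fst, inner_sub_right, inner_smul_right, hn, mul_one, sub_self]
  · intro hy
    obtain ⟨h1, h2⟩ : inner ℝ (clamp q) y.fst = 0 ∧ y.fst ∈ L.1 :=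
      (Gr.mem_ominus (hu := norm_clamp_of_le h) (h := hq)).1 hy
    refine ⟨y.fst + y.snd 0 • clamp q, L.1.add_mem h2 (L.1.smul_mem _ hq), ?_⟩
    change tiltEmb q _ = y
    have h3 : inner ℝ (clamp q) (y.fst + y.snd 0 • clamp q) = y.snd 0 := by
      rw [inner_add_right, inner_smul_right, hn, h1, mul_one, zero_add]
    rw [tiltEmb_of_le h, h3, ← eq_line]
    exact AddE.ext (add_sub_cancel_right _ _) rfl

/-- The component in `L` of the vector of a pair `(w, L)`. -/
def par (p : X × Gr d X) : X := p.2.toProj p.1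

/-- The component orthogonal to `L` of the vector of a pair `(w, L)`. -/
def perp (p : X × Gr d X) : X := p.1 - par p

theorem par_mem (p : X × Gr d X) : par p ∈ p.2.1 := Submodule.starProjection_apply_mem _ _

theorem perp_mem (p : X × Gr d X) : perp p ∈ p.2.1ᗮ :=
  Submodule.sub_starProjection_mem_orthogonal _

theorem perp_add_par (p : X × Gr d X) : perp p + par p = p.1 := sub_add_cancel _ _

theorem continuous_par : Continuous (par : X × Gr d X → X) :=
  (Gr.continuous_toProj.comp continuous_snd).clm_apply continuous_fst

theorem continuous_perp : Continuous (perp : X × Gr d X → X) :=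
  continuous_fst.sub continuous_par

theorem inner_perp {p : X × Gr d X} {x : X} (hx : x ∈ p.2.1) : inner ℝ x (perp p) = 0 :=
  perp_mem p x hx

theorem par_map (φ : X →ₗᵢ[ℝ] Y) (w : X) (L : Gr d X) : par (φ w, L.map φ) = φ (par (w, L)) := by
  refine Submodule.eq_starProjection_of_mem_of_inner_eq_zero
    (Submodule.mem_map_of_mem (par_mem (w, L))) ?_
  rintro _ ⟨x, hx, rfl⟩
  rw [← map_sub]
  refine (φ.inner_map_map _ _).trans ?_
  rw [real_inner_comm]
  exact inner_perp (p := (w, L)) hx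

theorem perp_map (φ : X →ₗᵢ[ℝ] Y) (w : X) (L : Gr d X) :
    perp (φ w, L.map φ) = φ (perp (w, L)) := by
  rw [perp, par_map, perp, map_sub]

theorem par_of_mem_orthogonal {w : X} {L : Gr d X} (h : w ∈ L.1ᗮ) : par (w, L) = 0 :=
  (Submodule.starProjection_apply_eq_zero_iff _).2 h

theorem perp_of_mem_orthogonal {w : X} {L : Gr d X} (h : w ∈ L.1ᗮ) : perp (w, L) = w := by
  rw [perp, par_of_mem_orthogonal h, sub_zero]

theorem perp_add_smul_clamp_mem (p : X × Gr (d + 1) X) (s : ℝ) (h : 1 ≤ ‖par p‖) :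
    perp p + s • clamp (par p) ∈
      (p.2.ominus (clamp (par p)) (norm_clamp_of_le h) (clamp_mem (par_mem p))).1ᗮ := by
  intro y hy
  obtain ⟨h1, h2⟩ :=
    (Gr.mem_ominus (hu := norm_clamp_of_le h) (h := clamp_mem (par_mem p))).1 hy
  rw [inner_add_right, inner_smul_right, inner_perp h2, real_inner_comm, h1, mul_zero, add_zero]

theorem norm_sq_perp_add_smul_clamp (p : X × Gr d X) (s : ℝ) (h : 1 ≤ ‖par p‖) :
    ‖perp p + s • clamp (par p)‖ ^ 2 = ‖perp p‖ ^ 2 + s ^ 2 := by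
  rw [norm_add_sq_real, inner_smul_right, real_inner_comm,
    inner_perp (clamp_mem (par_mem p)), norm_smul, norm_clamp_of_le h]
  simp

theorem tiltEmb_perp (p : X × Gr d X) : tiltEmb (par p) (perp p) = inclE X 1 (perp p) :=
  tiltEmb_of_inner_eq_zero (inner_perp (par_mem p))

theorem tilt_par_perp (p : X × Gr d X) (s : ℝ) (h : 1 ≤ ‖par p‖) :
    tiltEmb (par p) (perp p) + (tilt (par p) s).vec = inclE X 1 (perp p + s • clamp (par p)) := by
  rw [tiltEmb_perp, tilt_vec_of_le h]
  exact AddE.ext rfl (add_zero _)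

end Lin

/-! ### The map from the mapping cone to the shifted suspension spectrum -/

/-- The homeomorphism `t ↦ (1 - t) / t` from the unit interval to `[0, ∞]`. -/
def ratio (t : I) : OnePoint ℝ := if (t : ℝ) = 0 then ∞ else (((1 - t) / t : ℝ) : OnePoint ℝ)

theorem ratio_zero : ratio 0 = ∞ := if_pos rfl

theorem ratio_of_ne {t : I} (h : (t : ℝ) ≠ 0) : ratio t = (((1 - t) / t : ℝ) : OnePoint ℝ) :=
  if_neg h

theorem continuous_ratio : Continuous ratio := by
  rw [continuous_iff_continuousAt]
  intro t
  by_cases ht : (t : ℝ) = 0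
  · unfold ContinuousAt
    rw [ratio, if_pos ht, hasBasis_nhds_infty.tendsto_right_iff]
    rintro K ⟨-, hK⟩
    obtain ⟨r, hr⟩ := hK.isBounded.exists_norm_le
    -- If $u(|r|+2)<1$ and $u>0$, then $(1-u)/u>|r|+1$, which is outside the bound on $K$.
    have hU : ∀ᶠ u : I in 𝓝 t, (u : ℝ) * (|r| + 2) < 1 := by
      refine ((continuous_subtype_val.mul continuous_const).tendsto t).eventually_lt_const ?_
      change (t : ℝ) * (|r| + 2) < 1
      rw [ht, zero_mul]; exact one_pos
    filter_upwards [hU] with u hu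
    by_cases h0 : (u : ℝ) = 0
    · right; exact if_pos h0
    · left
      refine ⟨(1 - u) / u, fun hk => ?_, (if_neg h0).symm⟩
      have h1 := (le_abs_self _).trans ((hr _ hk).trans (le_abs_self r))
      have hu0 : (0 : ℝ) < u := lt_of_le_of_ne u.2.1 (Ne.symm h0)
      rw [div_le_iff₀ hu0] at h1
      nlinarith
  · have h1 : ContinuousAt (fun u : I => (((1 - u) / u : ℝ) : OnePoint ℝ)) t :=
      continuous_coe.continuousAt.comp (ContinuousAt.div (by fun_prop) (by fun_prop) ht)
    refine h1.congr ?_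
    filter_upwards [continuous_subtype_val.continuousAt.eventually_ne ht] with u hu
    exact (if_neg hu).symm

/-- A left inverse `r ↦ 1 / r` of the restriction to `[1, ∞]` of the coordinate change between
the cone coordinate and the length of a vector. -/
def invLen (r : ℝ) : I :=
  ⟨(max 1 |r|)⁻¹, inv_nonneg.2 (zero_le_one.trans (le_max_left _ _)),
    inv_le_one_of_one_le₀ (le_max_left _ _)⟩

theorem continuous_elim_invLen : Continuous fun r : OnePoint ℝ => r.elim (0 : I) invLen := by
  have hc : Continuous invLen := Continuous.subtype_mk
    ((continuous_const.max continuous_abs).inv₀ fun r => (lt_max_of_lt_left one_pos).ne') _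
  rw [continuous_iff_continuousAt]
  intro r
  induction r using OnePoint.rec with
  | coe r => rw [continuousAt_coe]; exact hc.continuousAt
  | infty =>
    rw [continuousAt_infty]
    intro s hs
    obtain ⟨ε, hε, hεs⟩ := Metric.mem_nhds_iff.1 hs
    refine ⟨Metric.closedBall 0 (2 / ε), Metric.isClosed_closedBall, isCompact_closedBall _ _,
      fun r hr => hεs ?_⟩
    rw [mem_compl_iff, mem_closedBall_zero_iff, not_le, Real.norm_eq_abs] at hr
    rw [Metric.mem_ball, Subtype.dist_eq, Real.dist_eq]
    change |(max 1 |r|)⁻¹ - 0| < ε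
    have h1 : 2 / ε < max 1 |r| := lt_max_of_lt_right hr
    have h2 : 0 < max 1 |r| := lt_max_of_lt_left one_pos
    rw [sub_zero, abs_of_pos (inv_pos.2 h2), inv_lt_comm₀ h2 hε]
    refine lt_of_lt_of_le ?_ h1.le
    rw [inv_eq_one_div]
    exact div_lt_div_of_pos_right (by norm_num) hε

variable (G : Type*) [Group G]

namespace OrthSpectrum

variable {G}

/-- The map `MTO_d(V) ∧ [0, 1] → S^{V ⊕ ℝ} ∧ Gr_{d+1}(V ⊕ ℝ)_+`. -/
def coneToSuspInl (d : ℕ) (V : OrthRep G) (x : OnePoint (PerpBundle d V)) (t : I) :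
    OnePoint (AddE V 1 × Gr (d + 1) (AddE V 1)) :=
  smashMap (fun (p : PerpBundle d V) s => ((WithLp.toLp 2 (p.1.2, line s), p.1.1.addLine) :
    AddE V 1 × Gr (d + 1) (AddE V 1))) x (ratio t)

theorem continuous_coneToSuspInl (d : ℕ) (V : OrthRep G) :
    Continuous fun p : OnePoint (PerpBundle d V) × I => coneToSuspInl d V p.1 p.2 := by
  have hp : Continuous fun q : Unit × (PerpBundle d V × ℝ) => q.2.1.1 :=
    continuous_subtype_val.comp (continuous_fst.comp continuous_snd)
  have h := ThomFunctor.continuous_smashMap_family (P := Unit) (mtoFunctor G d)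
    (suspFunctor G (d + 1)) (V := V) (W := V.add 1)
    (f := fun _ p s => (WithLp.toLp 2 (p.1.2, line s), p.1.1.addLine))
    ((JPt.continuous_toLp (continuous_snd.comp hp)
      (continuous_line.comp (continuous_snd.comp continuous_snd))).prodMk
        (Gr.continuous_addLine.comp (continuous_fst.comp hp))) 0
    (fun _ p s => by
      refine le_trans ?_ (add_zero _).ge
      exact WithLp.norm_fst_le V (WithLp.toLp 2 (p.1.2, line s) : AddE V 1))
    (fun _ p s => by
      refine le_trans ?_ (add_zero _).ge
      rw [← norm_line]
      exact WithLp.norm_snd_le V (WithLp.toLp 2 (p.1.2, line s) : AddE V 1))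
  exact h.comp (f := fun p : OnePoint (PerpBundle d V) × I => ((), (p.1, ratio p.2)))
    (continuous_const.prodMk (continuous_fst.prodMk (continuous_ratio.comp continuous_snd)))

variable (G)

/-- The extension of `sh_1 MTO_{d+1} → sh_1 Σ^∞_+ B_G O(d+1)` over the mapping cone. -/
def coneToSusp (d : ℕ) : Hom (cone (iota G d)) ((suspBO G (d + 1)).shift 1) where
  app V := coneLift (f := iota G d) (coneToSuspInl d V) ((toSusp G (d + 1)).app (V.add 1))
    (fun x => by
      have h1 : ((1 : I) : ℝ) ≠ 0 := by rw [Icc.coe_one]; exact one_ne_zero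
      change smashMap _ x (ratio 1) = _
      rw [ratio_of_ne h1]
      induction x using OnePoint.rec with
      | infty => rfl
      | coe p =>
        refine congrArg OnePoint.some (Prod.ext (AddE.ext rfl ?_) rfl)
        change line _ = 0
        simp)
    (fun x => by
      change smashMap _ x (ratio 0) = _
      rw [ratio_zero]
      exact smashMap_infty_right _ x)
    (fun t => rfl)
  continuous_app V := by
    refine continuous_quot_lift _ (continuous_sum_dom.2 ⟨?_, ?_⟩)
    · exact continuous_coneToSuspInl d V
    · exact (toSusp G (d + 1)).continuous_app (V.add 1)
  app_pt V := rfl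
  app_smul V g c := by
    induction c using cone_induction with
    | h1 x t =>
      change smashMap _ (g • x) (ratio t) =
        (g • (smashMap _ x (ratio t)) : ((suspBO G (d + 1)).shift 1).X V)
      induction x using OnePoint.rec with
      | infty => rfl
      | coe p =>
        induction ratio t using OnePoint.rec with
        | infty => rfl
        | coe s =>
          exact congrArg OnePoint.some (Prod.ext (AddE.ext rfl (add_zero (line s)).symm)
            (Gr.addLine_map _ _))
    | h2 y => exact (toSusp G (d + 1)).app_smul (V.add 1) g y
  app_act {V W} j c := by
    induction c using cone_induction with
    | h1 x t =>
      change smashMap _ ((MTO G d).act (OnePoint.some j) x) (ratio t) =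
        ((suspBO G (d + 1)).shift 1).act (OnePoint.some j) (smashMap _ x (ratio t))
      induction x using OnePoint.rec with
      | infty => rfl
      | coe p =>
        induction ratio t using OnePoint.rec with
        | infty => rfl
        | coe s =>
          exact congrArg OnePoint.some (Prod.ext (AddE.ext rfl (add_zero (line s)).symm)
            (Gr.addLine_map _ _))
    | h2 y => exact (toSusp G (d + 1)).app_act (V := V.add 1) (W := W.add 1) (j.add 1) y

theorem coneToSusp_comp_coneIncl (d : ℕ) :
    (coneToSusp G d).comp (coneIncl (iota G d)) = (toSusp G (d + 1)).shift 1 := rfl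

end OrthSpectrum

end

section

variable {G : Type*} [Group G] {d : ℕ} {X : OrthRep G}

/-! ### The homotopy inverse of the map from the mapping cone -/

/-- The point `(w, L, s)` with the component of `w` in `L` rotated towards the new coordinate. -/
def rotateInr (p : X × Gr (d + 1) X) (s : ℝ) : PerpBundle (d + 1) (AddE X 1) :=
  (mtoFunctor G (d + 1)).act (V := X) (W := X.add 1) (tilt (par p) s) ⟨(p.2, perp p), perp_mem p⟩

theorem rotateInr_snd (p : X × Gr (d + 1) X) (s : ℝ) :
    (rotateInr p s).1.2 = (tilt (par p) s).emb (perp p) + (tilt (par p) s).vec := rfl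

/-- For `w` with component `w_L` in `L` of length at least `1`, the pair of the complement of
the line of `w_L` in `L` and of the vector in its complement. -/
def slideInl (p : X × Gr (d + 1) X) (s : ℝ) (h : 1 ≤ ‖par p‖) : PerpBundle d X :=
  ⟨(p.2.ominus (clamp (par p)) (norm_clamp_of_le h) (clamp_mem (par_mem p)),
    perp p + s • clamp (par p)), perp_add_smul_clamp_mem p s h⟩

/-- After the quarter turn both the plane and the vector have the form required by $\iota$. On
$|w_L|=1$ this is the compatibility that glues the two halves of `collapseCoe`. -/
theorem rotateInr_eq_slideInl (p : X × Gr (d + 1) X) (s : ℝ) (h : 1 ≤ ‖par p‖) :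
    (OnePoint.some (rotateInr p s) : OnePoint (PerpBundle (d + 1) (AddE X 1))) =
      (iota G d).app X (OnePoint.some (slideInl p s h)) := by
  refine congrArg OnePoint.some (Subtype.ext (Prod.ext ?_ ?_))
  · exact Gr.map_tiltEmb p.2 h (clamp_mem (par_mem p))
  · exact tilt_par_perp p s h

theorem norm_sq_rotateInr (p : X × Gr (d + 1) X) (s : ℝ) :
    ‖(rotateInr p s).1.2‖ ^ 2 = ‖perp p‖ ^ 2 + s ^ 2 := by
  rw [rotateInr_snd, JPt.norm_sq, norm_tilt_vec, sq_abs]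

theorem norm_sq_slideInl (p : X × Gr (d + 1) X) (s : ℝ) (h : 1 ≤ ‖par p‖) :
    ‖(slideInl p s h).1.2‖ ^ 2 = ‖perp p‖ ^ 2 + s ^ 2 :=
  norm_sq_perp_add_smul_clamp p s h

theorem continuous_rotateInr :
    Continuous fun c : (X × Gr (d + 1) X) × ℝ => rotateInr c.1 c.2 := by
  have h1 : Continuous fun c : (X × Gr (d + 1) X) × ℝ => tilt (par c.1) c.2 :=
    continuous_tilt.comp (f := fun c : (X × Gr (d + 1) X) × ℝ => (par c.1, c.2))
      ((continuous_par.comp continuous_fst).prodMk continuous_snd)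
  have h2 : Continuous fun c : (X × Gr (d + 1) X) × ℝ =>
      (tilt (par c.1) c.2).emb (perp c.1) + (tilt (par c.1) c.2).vec :=
    (JPt.continuous_emb_apply h1 (continuous_perp.comp continuous_fst)).add
      (JPt.continuous_vec.comp h1)
  exact Continuous.subtype_mk
    ((Gr.continuous_map h1 (continuous_snd.comp continuous_fst)).prodMk h2) _

theorem continuous_slideInl :
    Continuous fun c : {c : (X × Gr (d + 1) X) × ℝ | 1 ≤ ‖par c.1‖} =>
      slideInl c.1.1 c.1.2 c.2 := by
  have hv : Continuous fun c : {c : (X × Gr (d + 1) X) × ℝ | 1 ≤ ‖par c.1‖} => c.1.1 :=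
    continuous_fst.comp continuous_subtype_val
  have h1 : Continuous fun c : {c : (X × Gr (d + 1) X) × ℝ | 1 ≤ ‖par c.1‖} =>
      clamp (par c.1.1) := continuous_clamp.comp (continuous_par.comp hv)
  refine Continuous.subtype_mk (Continuous.prodMk ?_ ?_) _
  · refine Gr.continuous_of_apply fun x => ?_
    simp only [Gr.toProj_ominus]
    exact ((Gr.continuous_toProj.comp (continuous_snd.comp hv)).clm_apply continuous_const).sub
      ((h1.inner continuous_const).smul h1)
  · exact (continuous_perp.comp hv).add
      ((continuous_snd.comp continuous_subtype_val).smul h1)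

theorem slideInl_map (g : G) (w : X) (L : Gr (d + 1) X) (s : ℝ) (h : 1 ≤ ‖par (w, L)‖)
    (h' : 1 ≤ ‖par (X.isom g w, L.map (X.isom g))‖) :
    slideInl (X.isom g w, L.map (X.isom g)) s h' =
      (mtoFunctor G d).act (JPt.ofIsom (X.isom g)) (slideInl (w, L) s h) := by
  have hc : clamp (par (X.isom g w, L.map (X.isom g))) = X.isom g (clamp (par (w, L))) := by
    rw [par_map, clamp_map]
  refine Subtype.ext (Prod.ext ?_ ?_)
  · refine Eq.trans ?_ (Gr.ominus_map (X.isom g) L (clamp (par (w, L))) (norm_clamp_of_le h)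
      (clamp_mem (par_mem (w, L))) (by rw [LinearIsometry.norm_map, norm_clamp_of_le h])
      (Submodule.mem_map_of_mem (clamp_mem (par_mem (w, L)))))
    exact Gr.ominus_congr _ hc (norm_clamp_of_le h') (clamp_mem (par_mem _)) _ _
  · change perp (X.isom g w, L.map (X.isom g)) + s • clamp (par (X.isom g w, L.map (X.isom g)))
      = X.isom g (perp (w, L) + s • clamp (par (w, L))) + 0
    rw [hc, perp_map, map_add, _root_.map_smul, add_zero]

/-- The splitting $w=w^\perp+w_L$ and the rotation `tilt` both commute with isometries; the rest is
functoriality of the action. -/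
theorem rotateInr_map (g : G) (w : X) (L : Gr (d + 1) X) (s : ℝ) :
    rotateInr (X.isom g w, L.map (X.isom g)) s =
      (mtoFunctor G (d + 1)).act (V := X.add 1) (W := X.add 1)
        (JPt.ofIsom ((X.add 1).isom g)) (rotateInr (w, L) s) := by
  have hpar : par (X.isom g w, L.map (X.isom g)) = X.isom g (par (w, L)) := par_map _ _ _
  have h1 := congrArg (fun j : JPt X (X.add 1) => (mtoFunctor G (d + 1)).act (V := X)
    (W := X.add 1) j ⟨(L, perp (w, L)), perp_mem (w, L)⟩)
    (ofIsom_comp_tilt (X.isom g) (par (w, L)) s)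
  refine Eq.trans ?_ (h1.symm.trans ((mtoFunctor G (d + 1)).act_comp (V := X) (W := X.add 1)
    (Z := X.add 1) _ _ _))
  refine Eq.trans ?_ ((mtoFunctor G (d + 1)).act_comp (V := X) (W := X) (Z := X.add 1) _ _ _).symm
  change (mtoFunctor G (d + 1)).act (V := X) (W := X.add 1)
    (tilt (par (X.isom g w, L.map (X.isom g))) s) _ = _
  rw [hpar]
  refine congrArg ((mtoFunctor G (d + 1)).act (V := X) (W := X.add 1)
    (tilt (X.isom g (par (w, L))) s)) (Subtype.ext (Prod.ext rfl ?_))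
  change perp (X.isom g w, L.map (X.isom g)) = X.isom g (perp (w, L)) + 0
  rw [perp_map, add_zero]

namespace OrthSpectrum

open Classical in
/-- The map `(w, L, s) ↦ C(ι)(X)` on points different from the base point: a vector `w` whose
component in `L` is short is mapped to `sh_1 MTO_{d+1}`, the others into the cone on `MTO_d`. -/
def collapseCoe (c : (X × Gr (d + 1) X) × ℝ) : (cone (iota G d)).X X :=
  if h : 1 ≤ ‖par c.1‖ then
    coneInl (iota G d) X (OnePoint.some (slideInl c.1 c.2 h)) (invLen ‖par c.1‖)
  else coneInr (iota G d) X (OnePoint.some (rotateInr c.1 c.2))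

theorem collapseCoe_of_le {c : (X × Gr (d + 1) X) × ℝ} (h : 1 ≤ ‖par c.1‖) : collapseCoe c =
    coneInl (iota G d) X (OnePoint.some (slideInl c.1 c.2 h)) (invLen ‖par c.1‖) := dif_pos h

/-- On the overlap $|w_L|=1$ the cone coordinate is $1$, and the cone is glued there along $\iota$.
-/
theorem collapseCoe_of_ge {c : (X × Gr (d + 1) X) × ℝ} (h : ‖par c.1‖ ≤ 1) :
    collapseCoe c = coneInr (iota G d) X (OnePoint.some (rotateInr c.1 c.2)) := by
  by_cases h' : 1 ≤ ‖par c.1‖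
  · have h1 : invLen ‖par c.1‖ = 1 := by
      apply Subtype.ext
      change (max 1 |‖par c.1‖|)⁻¹ = 1
      rw [le_antisymm h h']
      simp
    rw [collapseCoe_of_le h', h1]
    refine (coneInl_one (f := iota G d) _).trans ?_
    exact congrArg (coneInr (iota G d) X) (rotateInr_eq_slideInl c.1 c.2 h').symm
  · exact dif_neg h'

/-- A closed subset of `(X × Gr) × ℝ` with bounded components is compact. -/
theorem isCompact_bounded (r : ℝ) {S : Set ((X × Gr (d + 1) X) × ℝ)} (hS : IsClosed S) :
    IsCompact {c : S | ‖c.1.1.1‖ ≤ r ∧ |c.1.2| ≤ r} := by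
  have h := ((isCompact_closedBall (0 : X) r).prod (isCompact_univ (X := Gr (d + 1) X))).prod
    (isCompact_closedBall (0 : ℝ) r)
  convert hS.isClosedEmbedding_subtypeVal.isCompact_preimage h using 1
  ext c
  simp

theorem bounds_of_sq {a b s : ℝ} (_ : 0 ≤ a) (hb : 0 ≤ b) (h : b ^ 2 = a ^ 2 + s ^ 2) :
    a ≤ b ∧ |s| ≤ b :=
  ⟨by nlinarith [sq_nonneg s], abs_le_of_sq_le_sq (by nlinarith [sq_nonneg a]) hb⟩

theorem norm_le_perp_add_par (p : X × Gr (d + 1) X) : ‖p.1‖ ≤ ‖perp p‖ + ‖par p‖ := by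
  rw [← perp_add_par p]
  exact norm_add_le _ _

/-- Continuity is checked on the two closed pieces. The vector in the image has squared length
$|w^\perp|^2+s^2$, so it controls everything except $w_L$. That component is bounded on the first
piece, while on the second its growth drives the cone coordinate to the tip. -/
theorem continuous_elim_collapseCoe : Continuous fun c : OnePoint ((X × Gr (d + 1) X) × ℝ) =>
    c.elim ((cone (iota G d)).pt X) collapseCoe := by
  have hpar : Continuous fun c : (X × Gr (d + 1) X) × ℝ => ‖par c.1‖ :=
    (continuous_par.comp continuous_fst).norm
  have hS : IsClosed {c : (X × Gr (d + 1) X) × ℝ | ‖par c.1‖ ≤ 1} :=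
    isClosed_le hpar continuous_const
  have hT : IsClosed {c : (X × Gr (d + 1) X) × ℝ | 1 ≤ ‖par c.1‖} :=
    isClosed_le continuous_const hpar
  refine continuous_onePoint_of_cover hS hT (fun c => le_total ‖par c.1‖ 1) ?_ ?_
  · have h1 : Continuous (OnePoint.map fun c : {c : (X × Gr (d + 1) X) × ℝ | ‖par c.1‖ ≤ 1} =>
        rotateInr c.1.1 c.1.2) := by
      refine OnePoint.continuous_map (continuous_rotateInr.comp continuous_subtype_val) ?_
      rw [hasBasis_coclosedCompact.tendsto_right_iff]
      rintro K ⟨-, hK⟩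
      obtain ⟨r, hr⟩ := (hK.image ((mtoFunctor G (d + 1)).continuous_size
        (X.add 1))).isBounded.exists_norm_le
      have hc := isCompact_bounded (r + 1) hS
      refine mem_of_superset (hasBasis_coclosedCompact.mem_of_mem ⟨hc.isClosed, hc⟩) ?_
      intro c hc' hcK
      refine hc' ?_
      have h2 : ‖(rotateInr c.1.1 c.1.2).1.2‖ ≤ r :=
        (le_abs_self _).trans (hr _ (mem_image_of_mem _ hcK))
      obtain ⟨h3, h4⟩ := bounds_of_sq (norm_nonneg _) (norm_nonneg _)
        (norm_sq_rotateInr c.1.1 c.1.2)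
      have h5 := norm_le_perp_add_par c.1.1
      have h6 : ‖par c.1.1‖ ≤ 1 := c.2
      exact ⟨by linarith, by linarith⟩
    convert (continuous_coneInr (f := iota G d) (V := X)).comp h1 using 1
    ext c
    induction c using OnePoint.rec with
    | infty => rfl
    | coe c => exact collapseCoe_of_ge c.2
  · have hΦ : Continuous fun q : OnePoint (PerpBundle d X) × OnePoint ℝ =>
        coneInl (iota G d) X q.1 (q.2.elim 0 invLen) :=
      continuous_coneInl_comp (f := iota G d) continuous_fst
        (continuous_elim_invLen.comp continuous_snd)
    have h1 := continuous_elim_of_smash hΦ (z := (cone (iota G d)).pt X)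
      (fun y => coneInl_pt (f := iota G d) _) (fun x => coneInl_zero (f := iota G d) (V := X) x)
      (r := fun c : {c : (X × Gr (d + 1) X) × ℝ | 1 ≤ ‖par c.1‖} =>
        (slideInl c.1.1 c.1.2 c.2, ‖par c.1.1‖))
      (continuous_slideInl.prodMk (hpar.comp continuous_subtype_val)) fun KA KB hA hB => by
        obtain ⟨a, ha⟩ := (hA.image
          ((mtoFunctor G d).continuous_size X)).isBounded.exists_norm_le
        obtain ⟨b, hb⟩ := hB.isBounded.exists_norm_le
        -- The length of the image vector is at most `a`, and $|w_L|$ is at most `b`. The absolute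
        -- value makes the same radius bound $|s|$ as well, even if `b` is negative.
        have hc := isCompact_bounded (a + |b|) hT
        refine ⟨_, hc.isClosed, hc, fun c hcA hcB => ?_⟩
        have h2 : ‖(slideInl c.1.1 c.1.2 c.2).1.2‖ ≤ a :=
          (le_abs_self _).trans (ha _ (mem_image_of_mem _ hcA))
        obtain ⟨h3, h4⟩ := bounds_of_sq (norm_nonneg _) (norm_nonneg _)
          (norm_sq_slideInl c.1.1 c.1.2 c.2)
        have h5 := norm_le_perp_add_par c.1.1
        have h6 : ‖par c.1.1‖ ≤ b := (le_abs_self _).trans (hb _ hcB)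
        have h7 := le_abs_self b
        have h8 := abs_nonneg b
        exact ⟨by linarith, by linarith⟩
    convert h1 using 1
    ext c
    induction c using OnePoint.rec with
    | infty => rfl
    | coe c => exact collapseCoe_of_le c.2

theorem collapseCoe_smul (g : G) (w : X) (L : Gr (d + 1) X) (s : ℝ) :
    collapseCoe (((X.isom g w, L.map (X.isom g)), s) : (X × Gr (d + 1) X) × ℝ) =
      g • collapseCoe ((w, L), s) := by
  have hpar : par (X.isom g w, L.map (X.isom g)) = X.isom g (par (w, L)) := par_map _ _ _
  have hn : ‖par (X.isom g w, L.map (X.isom g))‖ = ‖par (w, L)‖ := by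
    rw [hpar, LinearIsometry.norm_map]
  rcases le_total 1 ‖par (w, L)‖ with h | h
  · have h' := hn.ge.trans' h
    rw [collapseCoe_of_le (c := ((w, L), s)) h,
      collapseCoe_of_le (c := ((_, _), s)) h']
    exact congrArg₂ (coneInl (iota G d) X) (congrArg OnePoint.some (slideInl_map g w L s h h'))
      (congrArg invLen hn)
  · have h' := hn.le.trans h
    rw [collapseCoe_of_ge (c := ((w, L), s)) h,
      collapseCoe_of_ge (c := ((_, _), s)) h']
    exact congrArg (coneInr (iota G d) X) (congrArg OnePoint.some (rotateInr_map g w L s))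

variable (d)

/-- The map `(S^{V ⊕ ℝ} ∧ Gr_{d+1}(V ⊕ ℝ)_+) ∧ S¹ → C(ι)(V ⊕ ℝ)`. -/
def collapse (V : OrthRep G) :
    SuspMap ((suspBO G (d + 1)).shift 1) (cone (iota G d)) V (V.add 1) where
  toFun x s := (smashMap Prod.mk x s : OnePoint ((V.add 1 × Gr (d + 1) (V.add 1)) × ℝ)).elim
    ((cone (iota G d)).pt (V.add 1)) collapseCoe
  continuous_toFun := continuous_elim_collapseCoe.comp continuous_smash_mk
  map_pt s := rfl
  map_infty x := congrArg (fun c : OnePoint ((V.add 1 × Gr (d + 1) (V.add 1)) × ℝ) =>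
    c.elim ((cone (iota G d)).pt (V.add 1)) collapseCoe)
    (smashMap_infty_right _ x)
  map_smul g x s := by
    induction x using OnePoint.rec with
    | infty => exact ((cone (iota G d)).smul_pt (V.add 1) g).symm
    | coe p =>
      induction s using OnePoint.rec with
      | infty => exact ((cone (iota G d)).smul_pt (V.add 1) g).symm
      | coe s =>
        refine Eq.trans ?_ (collapseCoe_smul g p.1 p.2 s)
        refine congrArg (fun w => collapseCoe (((w, p.2.map ((V.add 1).isom g)), s) :
          ((V.add 1) × Gr (d + 1) (V.add 1)) × ℝ)) ?_
        exact add_zero _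

end OrthSpectrum

end

/-! ### The two composites of the collapse with the map from the cone -/

section

section Lin

variable {X : Type} [NormedAddCommGroup X] [InnerProductSpace ℝ X] [FiniteDimensional ℝ X] {d : ℕ}

theorem clamp_zero : clamp (0 : X) = 0 := smul_zero _

theorem inner_clamp_par {p : X × Gr d X} (h : 1 ≤ ‖par p‖) :
    inner ℝ (clamp (par p)) (par p) = ‖par p‖ := by
  rw [clamp_of_le_norm h, inner_smul_left, real_inner_self_eq_norm_sq, conj_trivial, sq,
    inv_mul_cancel_left₀ (zero_lt_one.trans_le h).ne']

theorem norm_smul_clamp_par {p : X × Gr d X} (h : 1 ≤ ‖par p‖) :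
    ‖par p‖ • clamp (par p) = par p := by
  rw [clamp_of_le_norm h, smul_smul, mul_inv_cancel₀ (zero_lt_one.trans_le h).ne', one_smul]

/-- The pair `(w, L)` rotated towards the new coordinate, with the component of `w` in `L`
shortened. -/
def spreadCoe (t : I) (p : X × Gr d X) (s : ℝ) : AddE X 1 × Gr d (AddE X 1) :=
  ((tilt ((t : ℝ) • par p) s).emb (p.1 - clamp ((t : ℝ) • par p)) +
    (tilt ((t : ℝ) • par p) s).vec, p.2.map (tilt ((t : ℝ) • par p) s).emb)

theorem continuous_spreadCoe : Continuous fun q : I × ((X × Gr d X) × ℝ) =>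
    spreadCoe q.1 q.2.1 q.2.2 := by
  have hp : Continuous fun q : I × ((X × Gr d X) × ℝ) => q.2.1 :=
    continuous_fst.comp continuous_snd
  have h1 : Continuous fun q : I × ((X × Gr d X) × ℝ) => (q.1 : ℝ) • par q.2.1 :=
    (continuous_subtype_val.comp continuous_fst).smul (continuous_par.comp hp)
  have h2 : Continuous fun q : I × ((X × Gr d X) × ℝ) => tilt ((q.1 : ℝ) • par q.2.1) q.2.2 :=
    continuous_tilt.comp (f := fun q : I × ((X × Gr d X) × ℝ) => ((q.1 : ℝ) • par q.2.1, q.2.2))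
      (h1.prodMk (continuous_snd.comp continuous_snd))
  exact ((JPt.continuous_emb_apply h2 ((continuous_fst.comp hp).sub
    (continuous_clamp.comp h1))).add (JPt.continuous_vec.comp h2)).prodMk
      (Gr.continuous_map h2 (continuous_snd.comp hp))

/-- The rotation and its vector do not decrease lengths, so the only loss comes from the subtracted
vector, of length at most $1$. -/
theorem norm_le_spreadCoe (t : I) (p : X × Gr d X) (s : ℝ) :
    ‖p.1‖ ≤ ‖(spreadCoe t p s).1‖ + 1 := by
  have h1 := (tilt ((t : ℝ) • par p) s).size_le (p.1 - clamp ((t : ℝ) • par p))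
  have h2 := norm_sub_norm_le p.1 (clamp ((t : ℝ) • par p))
  have h3 := norm_clamp_le ((t : ℝ) • par p)
  change ‖p.1‖ ≤ ‖_ + _‖ + 1
  linarith

theorem abs_le_spreadCoe (t : I) (p : X × Gr d X) (s : ℝ) :
    |s| ≤ ‖(spreadCoe t p s).1‖ + 1 := by
  have h1 := (tilt ((t : ℝ) • par p) s).vec_le (p.1 - clamp ((t : ℝ) • par p))
  rw [norm_tilt_vec] at h1
  exact h1.trans (le_add_of_nonneg_right zero_le_one)

theorem spreadCoe_map (φ : X →ₗᵢ[ℝ] X) (t : I) (w : X) (L : Gr d X) (s : ℝ) :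
    spreadCoe t (φ w, L.map φ) s =
      (addIsom φ 1 (spreadCoe t (w, L) s).1, (spreadCoe t (w, L) s).2.map (addIsom φ 1)) := by
  have h := ofIsom_comp_tilt φ ((t : ℝ) • par (w, L)) s
  have h1 : (t : ℝ) • par (φ w, L.map φ) = φ ((t : ℝ) • par (w, L)) := by
    rw [par_map, _root_.map_smul]
  have h2 : ∀ x, (tilt (φ ((t : ℝ) • par (w, L))) s).emb (φ x) =
      addIsom φ 1 ((tilt ((t : ℝ) • par (w, L)) s).emb x) := fun x =>
    (congrArg (fun j => j.emb x) h).symm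
  have h3 : (tilt (φ ((t : ℝ) • par (w, L))) s).vec =
      addIsom φ 1 ((tilt ((t : ℝ) • par (w, L)) s).vec) := by
    have := congrArg JPt.vec h
    rw [JPt.comp_vec, JPt.comp_vec, JPt.ofIsom_vec, JPt.ofIsom_vec, map_zero, add_zero,
      zero_add] at this
    exact this.symm
  refine Prod.ext ?_ ?_
  · change (tilt ((t : ℝ) • par (φ w, L.map φ)) s).emb
      (φ w - clamp ((t : ℝ) • par (φ w, L.map φ))) + (tilt ((t : ℝ) • par (φ w, L.map φ)) s).vec
      = addIsom φ 1 (_ + _)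
    rw [h1, clamp_map, ← map_sub, h2, h3, map_add]
  · change (L.map φ).map (tilt ((t : ℝ) • par (φ w, L.map φ)) s).emb = (L.map _).map _
    rw [h1, ← Gr.map_comp, ← Gr.map_comp]
    exact congrArg (fun j => L.map j.emb) h.symm

theorem spreadCoe_zero (p : X × Gr d X) (q : X) (s : ℝ) : spreadCoe 0 p s =
    ((tilt ((0 : ℝ) • q) s).emb p.1 + (tilt ((0 : ℝ) • q) s).vec,
      p.2.map (tilt ((0 : ℝ) • q) s).emb) := by
  rw [spreadCoe, Icc.coe_zero, zero_smul, zero_smul, clamp_zero, sub_zero]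

theorem spreadCoe_one_of_ge {p : X × Gr d X} (h : ‖par p‖ ≤ 1) (s : ℝ) : spreadCoe 1 p s =
    ((tilt (par p) s).emb (perp p) + (tilt (par p) s).vec, p.2.map (tilt (par p) s).emb) := by
  rw [spreadCoe, Icc.coe_one, one_smul, clamp_of_norm_le h]
  rfl

/-- Subtracting the unit vector of $w_L$ leaves $w^\perp$ plus $|w_L|-1$ times that vector, and the
quarter turn makes $|w_L|-1$ the new coordinate. -/
theorem spreadCoe_one_of_le {p : X × Gr (d + 1) X} (h : 1 ≤ ‖par p‖) (s : ℝ) :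
    spreadCoe 1 p s = (WithLp.toLp 2 (perp p + s • clamp (par p), line (‖par p‖ - 1)),
      (p.2.ominus (clamp (par p)) (norm_clamp_of_le h) (clamp_mem (par_mem p))).addLine) := by
  rw [spreadCoe, Icc.coe_one, one_smul]
  refine Prod.ext ?_ (Gr.map_tiltEmb p.2 h (clamp_mem (par_mem p)))
  have h1 : p.1 - clamp (par p) = perp p + (par p - clamp (par p)) := by
    rw [← add_sub_assoc, perp_add_par]
  have h2 : tiltEmb (par p) (par p - clamp (par p)) = WithLp.toLp 2 (0, line (‖par p‖ - 1)) := by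
    rw [tiltEmb_of_le h, inner_sub_right, inner_clamp_par h, real_inner_self_eq_norm_sq,
      norm_clamp_of_le h, one_pow, sub_smul, norm_smul_clamp_par h, one_smul, sub_self]
  change tiltEmb (par p) (p.1 - clamp (par p)) + (tilt (par p) s).vec = _
  rw [h1, map_add, h2, add_right_comm, tilt_par_perp p s h]
  exact AddE.ext (add_zero _) (zero_add _)

theorem par_addLine {v : X} {L : Gr d X} (h : v ∈ L.1ᗮ) (r : ℝ) :
    par (WithLp.toLp 2 (v, line r), L.addLine) = r • lastVec X := by
  rw [par, Gr.toProj_addLine, smul_lastVec]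
  refine AddE.ext ?_ rfl
  exact par_of_mem_orthogonal h

theorem perp_addLine {v : X} {L : Gr d X} (h : v ∈ L.1ᗮ) (r : ℝ) :
    perp (WithLp.toLp 2 (v, line r), L.addLine) = WithLp.toLp 2 (v, 0) := by
  rw [perp, par_addLine h, smul_lastVec]
  exact AddE.ext (sub_zero v) (sub_self _)

theorem norm_par_addLine {v : X} {L : Gr d X} (h : v ∈ L.1ᗮ) {r : ℝ} (hr : 0 ≤ r) :
    ‖par (WithLp.toLp 2 (v, line r), L.addLine)‖ = r := by
  rw [par_addLine h, norm_smul, norm_lastVec, mul_one, Real.norm_of_nonneg hr]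

theorem clamp_par_addLine {v : X} {L : Gr d X} (h : v ∈ L.1ᗮ) {r : ℝ} (hr : 1 ≤ r) :
    clamp (par (WithLp.toLp 2 (v, line r), L.addLine)) = lastVec X := by
  have h0 : 0 ≤ r := zero_le_one.trans hr
  rw [clamp_of_le_norm (hr.trans (norm_par_addLine h h0).ge), norm_par_addLine h h0,
    par_addLine h, smul_smul, inv_mul_cancel₀ (zero_lt_one.trans_le hr).ne', one_smul]

end Lin

/-- This matches the height $1/|w_L|$ chosen by `collapse` with the coordinate $|w_L|-1$ reached by
`spreadCoe` at $t=1$. -/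
theorem ratio_invLen {r : ℝ} (h : 1 ≤ r) : ratio (invLen r) = ((r - 1 : ℝ) : OnePoint ℝ) := by
  have h0 : r ≠ 0 := (zero_lt_one.trans_le h).ne'
  have h1 : (invLen r : ℝ) = r⁻¹ := by
    change (max 1 |r|)⁻¹ = r⁻¹
    rw [abs_of_pos (zero_lt_one.trans_le h), max_eq_right h]
  rw [ratio_of_ne (by rw [h1]; exact inv_ne_zero h0), h1]
  congr 1
  field_simp

/-- For $u\le 1/2$ the length $(1-u)/u$ is at least $1$, and its inverse $u/(1-u)$ is the stretched
coordinate: this is where the shape of `stretch` comes from. -/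
theorem invLen_eq_stretch {u : I} (h0 : (u : ℝ) ≠ 0) (h : (u : ℝ) ≤ 1 / 2) :
    invLen ((1 - u) / u) = stretch u := by
  have hu : (0 : ℝ) < u := lt_of_le_of_ne u.2.1 (Ne.symm h0)
  have h1 : (1 : ℝ) ≤ (1 - u) / u := by rw [le_div_iff₀ hu]; linarith
  apply Subtype.ext
  rw [coe_stretch_of_le h]
  change (max 1 |(1 - (u : ℝ)) / u|)⁻¹ = _
  rw [abs_of_pos (zero_lt_one.trans_le h1), max_eq_right h1, inv_div]

theorem coe_max_stretch_symm {u : I} (h : (1 / 2 : ℝ) ≤ u) :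
    ((max 0 (stretch (σ u)) : I) : ℝ) = (1 - u) / u := by
  rw [max_eq_right nonneg', coe_stretch_of_le (by rw [coe_symm_eq]; linarith), coe_symm_eq,
    sub_sub_cancel]

variable {G : Type*} [Group G]

namespace OrthSpectrum

theorem coneToSuspInl_of_ratio {d : ℕ} {V : OrthRep G} (p : PerpBundle d V) {t : I} {r : ℝ}
    (h : ratio t = (r : OnePoint ℝ)) : coneToSuspInl d V (OnePoint.some p) t =
      OnePoint.some (WithLp.toLp 2 (p.1.2, line r), p.1.1.addLine) := by
  rw [coneToSuspInl, h]
  rfl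

/-- Allows the two components to be replaced although the proof of orthogonality depends on them. -/
theorem rotateInr_eq {d : ℕ} {X : OrthRep G} {p : X × Gr (d + 1) X} {q w : X}
    (hq : par p = q) (hw : perp p = w) (h : w ∈ p.2.1ᗮ) (s : ℝ) : rotateInr p s =
      (mtoFunctor G (d + 1)).act (V := X) (W := X.add 1) (tilt q s) ⟨(p.2, w), h⟩ := by
  subst hq hw
  rfl

variable (d : ℕ) (V : OrthRep G)

theorem continuous_spread : Continuous fun q : I ×
    (OnePoint (AddE V 1 × Gr (d + 1) (AddE V 1)) × OnePoint ℝ) =>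
      smashMap (spreadCoe q.1) q.2.1 q.2.2 :=
  ThomFunctor.continuous_smashMap_family (P := I) (suspFunctor G (d + 1))
    (suspFunctor G (d + 1)) (V := V.add 1) (W := (V.add 1).add 1)
    (f := fun t p s => spreadCoe (X := V.add 1) t p s) continuous_spreadCoe 1
    (fun t p s => norm_le_spreadCoe (X := V.add 1) t p s)
    (fun t p s => abs_le_spreadCoe (X := V.add 1) t p s)

/-- The homotopy which rotates `(w, L)` towards the new coordinate. -/
def spread (t : I) : SuspMap ((suspBO G (d + 1)).shift 1) ((suspBO G (d + 1)).shift 1) V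
    (V.add 1) where
  toFun x s := (smashMap (spreadCoe t) x s : OnePoint (AddE (AddE V 1) 1 × _))
  continuous_toFun := (continuous_spread d V).comp
    (f := fun q : OnePoint (AddE V 1 × Gr (d + 1) (AddE V 1)) × OnePoint ℝ => (t, q))
    (continuous_const.prodMk continuous_id)
  map_pt s := rfl
  map_infty x := smashMap_infty_right _ x
  map_smul g x s := by
    induction x using OnePoint.rec with
    | infty => rfl
    | coe p =>
      induction s using OnePoint.rec with
      | infty => rfl
      | coe s =>
        refine congrArg OnePoint.some ?_
        have h := spreadCoe_map (X := V.add 1) ((V.add 1).isom g) t p.1 p.2 s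
        refine Eq.trans ?_ (h.trans (Prod.ext (add_zero _).symm rfl))
        exact congrArg (fun w : AddE V 1 => spreadCoe (X := V.add 1) t
          (w, p.2.map ((V.add 1).isom g)) s) (add_zero _)

theorem spread_zero : spread d V 0 = tiltMap (suspBO G (d + 1)) V 0 := by
  ext x s
  induction x using OnePoint.rec with
  | infty => exact (SuspMap.map_pt _ s).trans (SuspMap.map_pt _ s).symm
  | coe p =>
    induction s using OnePoint.rec with
    | infty => rfl
    | coe s => exact congrArg OnePoint.some (spreadCoe_zero (X := V.add 1) p (lastVec V) s)

/-- The two cases $|w_L|\ge 1$ and $|w_L|\le 1$ of `spreadCoe` at $t=1$ match the two branches of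
`collapseCoe`. -/
theorem spread_one : spread d V 1 = (collapse d V).postcomp (coneToSusp G d) := by
  ext x s
  induction x using OnePoint.rec with
  | infty => exact (SuspMap.map_pt _ s).trans (SuspMap.map_pt _ s).symm
  | coe p =>
    induction s using OnePoint.rec with
    | infty => rfl
    | coe s =>
      change (OnePoint.some (spreadCoe (X := V.add 1) 1 p s) :
        OnePoint (AddE (AddE V 1) 1 × Gr (d + 1) (AddE (AddE V 1) 1))) =
        (coneToSusp G d).app (V.add 1) (collapseCoe (X := V.add 1) (p, s))
      rcases le_total 1 ‖par (X := V.add 1) p‖ with h | h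
      · rw [collapseCoe_of_le (c := (p, s)) h]
        refine (congrArg OnePoint.some (spreadCoe_one_of_le (X := V.add 1) h s)).trans ?_
        exact (coneToSuspInl_of_ratio (V := V.add 1) (slideInl (X := V.add 1) p s h)
          (ratio_invLen h)).symm
      · rw [collapseCoe_of_ge (c := (p, s)) h]
        exact congrArg OnePoint.some (spreadCoe_one_of_ge (X := V.add 1) h s)

/-- Undoing the tilt by $w_L$ leads to the inclusion with new coordinate $-s$, and rotating the last
two coordinates then leads to the structure map. -/
theorem collapse_postcomp_homotopic :
    Relation.EqvGen SuspMap.Homotopic ((collapse d V).postcomp (coneToSusp G d))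
      (SuspMap.structMap ((suspBO G (d + 1)).shift 1) V) := by
  refine .trans _ (tiltMap (suspBO G (d + 1)) V 0) _ (.symm _ _ ?_)
    (.rel _ _ (tiltMap_homotopic _ V))
  rw [← spread_zero, ← spread_one]
  exact .rel _ _ ⟨spread d V, rfl, rfl, continuous_spread d V⟩

/-- Here the component in $L\oplus\mathbf R$ points along the last coordinate, so removing its line
returns $L$ and the parameter $s$ takes over that coordinate, exactly as in the structure map of
$MTO_d$. -/
theorem slideInl_addLine (p : PerpBundle d V) (s : ℝ) {r : ℝ} (hr : 1 ≤ r)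
    (h : 1 ≤ ‖par (X := V.add 1) (WithLp.toLp 2 (p.1.2, line r), p.1.1.addLine)‖) :
    slideInl (X := V.add 1) (WithLp.toLp 2 (p.1.2, line r), p.1.1.addLine) s h =
      (mtoFunctor G d).act (V := V) (W := V.add 1) (JPt.sigma V s) p := by
  refine Subtype.ext (Prod.ext ?_ ?_)
  · exact Gr.ominus_lastVec p.1.1 _ (norm_clamp_of_le h)
      (clamp_mem (par_mem (_, p.1.1.addLine))) (clamp_par_addLine p.2 hr)
  · refine (congrArg₂ (fun a b : AddE V 1 => a + s • b) (perp_addLine p.2 r)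
      (clamp_par_addLine p.2 hr)).trans ?_
    exact congrArg (fun b : AddE V 1 => WithLp.toLp 2 (p.1.2, 0) + b) (smul_lastVec s)

/-- The component in the plane has length $(1-u)/u$, which passes $1$ at $u=1/2$. Below, the point
lands in the cone at height `stretch u`; above, it is rotated with parameter $(1-u)/u$, which is
`stretch (σ u)`. -/
theorem collapseCoe_addLine (p : PerpBundle d V) (s : ℝ) {u : I} (h0 : (u : ℝ) ≠ 0) :
    collapseCoe (X := V.add 1)
      ((WithLp.toLp 2 (p.1.2, line ((1 - u) / u)), p.1.1.addLine), s) =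
      coneTiltInl (iota G d) V 0 (s : OnePoint ℝ) (OnePoint.some p) u := by
  have hu : (0 : ℝ) < u := lt_of_le_of_ne u.2.1 (Ne.symm h0)
  have hr : 0 ≤ (1 - (u : ℝ)) / u := div_nonneg (sub_nonneg.2 u.2.2) hu.le
  have hn : ‖par (X := V.add 1) (WithLp.toLp 2 (p.1.2, line ((1 - (u : ℝ)) / u)),
    p.1.1.addLine)‖ = (1 - (u : ℝ)) / u := norm_par_addLine p.2 hr
  rcases le_total (u : ℝ) (1 / 2) with h | h
  · have h1 : 1 ≤ (1 - (u : ℝ)) / u := by rw [le_div_iff₀ hu]; linarith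
    refine Eq.trans ?_ (coneTiltInl_of_le (iota G d) V h).symm
    refine (collapseCoe_of_le (X := V.add 1) (c := ((_, p.1.1.addLine), s))
      (h1.trans hn.ge)).trans ?_
    exact congrArg₂ (coneInl (iota G d) (V.add 1))
      (congrArg OnePoint.some (slideInl_addLine d V p s h1 _))
      ((congrArg invLen hn).trans (invLen_eq_stretch h0 h))
  · have h1 : (1 - (u : ℝ)) / u ≤ 1 := by rw [div_le_one hu]; linarith
    refine Eq.trans ?_ (if_pos h).symm
    refine (collapseCoe_of_ge (X := V.add 1) (c := ((_, p.1.1.addLine), s))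
      (hn.le.trans h1)).trans ?_
    refine congrArg (fun x => coneInr (iota G d) (V.add 1) (OnePoint.some x))
      (rotateInr_eq (X := V.add 1) ((par_addLine p.2 _).trans ?_) (perp_addLine p.2 _)
        (Gr.inclE_mem_addLine p.2) s)
    exact congrArg (fun r : ℝ => r • lastVec V) (coe_max_stretch_symm h).symm

/-- On $\mathrm{sh}_1MTO_{d+1}$ the component $w_L$ is zero, so the tilt has parameter $0$. On the
cone the claim is `collapseCoe_addLine`, and the tip needs separate treatment because `ratio` is
infinite there. -/
theorem collapse_precomp : (collapse d V).precomp (coneToSusp G d) = coneTilt (iota G d) V 0 := by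
  ext c s
  induction c using cone_induction with
  | h2 y =>
    induction y using OnePoint.rec with
    | infty => exact (SuspMap.map_pt _ s).trans (SuspMap.map_pt (coneTilt (iota G d) V 0) s).symm
    | coe p =>
      induction s using OnePoint.rec with
      | infty =>
        exact (SuspMap.map_infty _ _).trans
          (SuspMap.map_infty (coneTilt (iota G d) V 0) _).symm
      | coe s =>
        have h1 : par (X := V.add 1) (p.1.2, p.1.1) = 0 := par_of_mem_orthogonal p.2
        have h2 : perp (X := V.add 1) (p.1.2, p.1.1) = p.1.2 := perp_of_mem_orthogonal p.2
        refine (collapseCoe_of_ge (X := V.add 1) (c := ((p.1.2, p.1.1), s)) ?_).trans ?_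
        · exact (congrArg norm h1).le.trans (norm_zero.le.trans zero_le_one)
        · exact congrArg (fun x => coneInr (iota G d) (V.add 1) (OnePoint.some x))
            (rotateInr_eq (X := V.add 1) (p := (p.1.2, p.1.1))
              (h1.trans (zero_smul ℝ (lastVec V)).symm) h2 p.2 s)
  | h1 x u =>
    induction x using OnePoint.rec with
    | infty =>
      rw [show coneInl (iota G d) V ∞ u = (cone (iota G d)).pt V from coneInl_pt u]
      exact (SuspMap.map_pt _ s).trans (SuspMap.map_pt (coneTilt (iota G d) V 0) s).symm
    | coe p =>
      induction s using OnePoint.rec with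
      | infty =>
        exact (SuspMap.map_infty _ _).trans
          (SuspMap.map_infty (coneTilt (iota G d) V 0) _).symm
      | coe s =>
        by_cases h0 : (u : ℝ) = 0
        · obtain rfl : u = 0 := Subtype.ext h0
          rw [show coneInl (iota G d) V (OnePoint.some p) 0 = (cone (iota G d)).pt V from
            coneInl_zero (f := iota G d) (V := V) (OnePoint.some p)]
          exact (SuspMap.map_pt _ _).trans (SuspMap.map_pt (coneTilt (iota G d) V 0) _).symm
        · exact (congrArg (fun x => (collapse d V).toFun x s)
            (coneToSuspInl_of_ratio p (ratio_of_ne h0))).trans (collapseCoe_addLine d V p s h0)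

/-- The extension of `sh_1 MTO_{d+1} → sh_1 Σ^∞_+ B_G O(d+1)` over the mapping cone is a
`π_*`-isomorphism. -/
theorem isPiIso_coneToSusp (U : UnivRep G) : IsPiIso U (coneToSusp G d) :=
  isPiIso_of_suspMap U _ fun V => ⟨collapse d V, collapse_postcomp_homotopic d V, by
    rw [collapse_precomp]
    exact coneTilt_zero_homotopic (iota G d) V⟩

end OrthSpectrum

end

end

end GSpec

/-- Let `G` be a finite group and `U` a universal representation of `G`. The maps
`(L, v) ↦ (L ⊕ ℝ, (v, 0))` and `(L, w) ↦ (w, L)` form a cofiber sequence of orthogonal `G`-spectra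
`MTO_d → sh_1 MTO_{d+1} → sh_1 Σ^∞_+ B_G O(d+1)`, and the canonical morphism
`Σ^{∞+1}_+ B_G O(d+1) → sh_1 Σ^∞_+ B_G O(d+1)` is a `π_*`-isomorphism, so that the third term is
`Σ^{∞+1}_+ B_G O(d+1)` in the stable homotopy category. -/
theorem mainTheorem10 {G : Type*} [Group G] [Finite G] (U : GSpec.UnivRep G) (d : ℕ) :
    GSpec.OrthSpectrum.IsCofiberSequence U
        (GSpec.iota G d : GSpec.OrthSpectrum.Hom (GSpec.MTO G d) ((GSpec.MTO G (d + 1)).shift 1))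
        ((GSpec.toSusp G (d + 1)).shift 1 :
          GSpec.OrthSpectrum.Hom ((GSpec.MTO G (d + 1)).shift 1)
            ((GSpec.suspBO G (d + 1)).shift 1)) ∧
      GSpec.OrthSpectrum.IsPiIso U
        (GSpec.suspToShift G (d + 1) :
          GSpec.OrthSpectrum.Hom (GSpec.suspOneBO G (d + 1))
            ((GSpec.suspBO G (d + 1)).shift 1)) :=
  ⟨⟨GSpec.OrthSpectrum.coneToSusp G d, GSpec.OrthSpectrum.coneToSusp_comp_coneIncl G d,
    GSpec.OrthSpectrum.isPiIso_coneToSusp d U⟩,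
    GSpec.OrthSpectrum.isPiIso_suspToShift U (d + 1)⟩
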